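/- Let $d\ge 1$, $d-1<s<d$, $\beta>0$, and $g(x)=\|x\|^{-s}$ on $\mathbb R^d$ (Euclidean norm, $g(0)=+\infty$). **Configurations.** Let $\mathcal C$ be the set of subsets $\gamma\subset\mathbb R^d$ with finitely many points in every bounded Borel set, $N_A(\gamma)=|\gamma\cap A|$, $\gamma_A=\gamma\cap A$. For a Borel set $\Lambda$ let $\mathcal F_\Lambda$ be the $\sigma$-algebra generated by the $N_A$ with $A\subset\Lambda$ bounded Borel; $\mathcal C$ carries $\mathcal F=\mathcal F_{\mathbb R^d}$. A function $f:\mathcal C\to\mathbb R$ is local and tame if for some bounded Borel $A$ and some $b\in\mathbb R$ it is $\mathcal F_A$-measurable and $|f|\le b(1+N_A)$. The local topology on measures on $\mathcal C$ is the coarsest one making $\mathbb P\mapsto\int f\,d\mathbb P$ continuous for all local tame $f$. **Gases.** For $n\ge 1$ let $\Lambda_n=[-n^{1/d}/2,n^{1/d}/2]^d$, $$g_n(x)=\sum_{k\in\mathbb Z^d}\Big(g(x+kn^{1/d})-\frac1n\int_{\Lambda_n}g(y+kn^{1/d})\,dy\Big),\qquad H_n(\gamma)=\sum_{\{x,y\}\subset\gamma}g_n(x-y),$$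 and let $\mathcal B_{A,N}$ be the binomial process, i.e. the law of $\{X_1,\dots,X_N\}$ with $X_i$ independent and uniform in $A$ (for $N=0$ the Dirac mass at $\emptyset$). Let $\mathbb P^\beta_n=\frac1{Z^\beta_n}e^{-\beta H_n}\mathcal B_{\Lambda_n,n}$ with $Z_n^\beta=\int e^{-\beta H_n}d\mathcal B_{\Lambda_n,n}$. A $\beta$-circular Riesz gas is a probability measure on $\mathcal C$ that is an accumulation point of $(\mathbb P^\beta_n)_{n\ge1}$ (as $n\to\infty$) for the local topology. **Theorem.** Let $\mathbb P^\beta$ be a $\beta$-circular Riesz gas and $\Delta\subset\mathbb R^d$ a bounded Borel set. For $p\ge1$ and $\eta,\gamma\in\mathcal C$ put $$M^{(p)}_\Delta(\eta,\gamma)=\sum_{x\in\eta_\Delta}\ \sum_{y\in\gamma_{\Lambda_p\setminus\Delta}}\big[g(x-y)-g(y)\big].$$ 1. For $\mathbb P^\beta$-almost every $\gamma$, $0\notin\gamma$ and, for every $\eta\in\mathcal C$, the limit $M_\Delta(\eta,\gamma)=\lim_{p\to\infty}M_\Delta^{(p)}(\eta,\gamma)$ exists and is finite. 2. With $H(\eta)=\sum_{\{x,y\}\subset\eta}g(x-y)$,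 for $\mathbb P^\beta$-almost every $\gamma$, $$Z^\beta_\Delta(\gamma)=\int e^{-\beta(H(\eta)+M_\Delta(\eta,\gamma))}\,\mathcal B_{\Delta,N_\Delta(\gamma)}(d\eta)\in(0,\infty).$$ 3. For every bounded measurable $f:\mathcal C\to\mathbb R$, the function $$f_\Delta(\gamma)=\int\frac1{Z^\beta_\Delta(\gamma)}f(\eta\cup\gamma_{\Delta^c})\,e^{-\beta(H(\eta)+M_\Delta(\eta,\gamma))}\,\mathcal B_{\Delta,N_\Delta(\gamma)}(d\eta)$$ is $\mathbb P^\beta$-integrable and satisfies the canonical DLR equation $$\int f\,d\mathbb P^\beta=\int f_\Delta\,d\mathbb P^\beta .$$ Equivalently, $f_\Delta=E_{\mathbb P^\beta}[f\mid\mathcal E_\Delta]$ $\mathbb P^\beta$-almost surely, where $\mathcal E_\Delta=\sigma(N_\Delta,\mathcal F_{\Delta^c})$. -/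

import Mathlib

open MeasureTheory Filter Topology

noncomputable section

namespace RieszGas

/-- `ℝ^d` with the Euclidean norm. -/
abbrev Space (d : ℕ) : Type := EuclideanSpace ℝ (Fin d)

/-! ### Point configurations -/

/-- Point configurations: subsets of `ℝ^d` with finitely many points in every bounded Borel set. -/
@[ext]
structure Configuration (d : ℕ) where
  carrier : Set (Space d)
  locallyFinite : ∀ A : Set (Space d), MeasurableSet A → Bornology.IsBounded A →
    (carrier ∩ A).Finite

namespace Configuration

/-- The restriction `γ_A = γ ∩ A`. -/
def restrict {d : ℕ} (γ : Configuration d) (A : Set (Space d)) : Configuration d where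
  carrier := γ.carrier ∩ A
  locallyFinite := fun B hB hb =>
    (γ.locallyFinite B hB hb).subset (fun _ hx => ⟨hx.1.1, hx.2⟩)

/-- The union of two configurations. -/
def union {d : ℕ} (η γ : Configuration d) : Configuration d where
  carrier := η.carrier ∪ γ.carrier
  locallyFinite := fun B hB hb => by
    rw [Set.union_inter_distrib_right]
    exact (η.locallyFinite B hB hb).union (γ.locallyFinite B hB hb)

/-- The configuration `{x_1, …, x_N}`. -/
def ofPoints {d N : ℕ} (x : Fin N → Space d) : Configuration d where
  carrier := Set.range x
  locallyFinite := fun _ _ _ => (Set.finite_range x).subset Set.inter_subset_left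

/-- The counting function `N_A(γ) = |γ ∩ A|` (used for bounded Borel sets `A`). -/
def count {d : ℕ} (A : Set (Space d)) (γ : Configuration d) : ℕ := (γ.carrier ∩ A).ncard

end Configuration

/-- The `σ`-algebra `F_Λ` generated by the counting functions `N_A`, for `A ⊆ Λ` bounded Borel. -/
@[reducible]
def sigmaOf (d : ℕ) (Λ : Set (Space d)) : MeasurableSpace (Configuration d) :=
  ⨆ A : {A : Set (Space d) // MeasurableSet A ∧ Bornology.IsBounded A ∧ A ⊆ Λ},
    MeasurableSpace.comap (Configuration.count A.1) ⊤

instance instMeasurableSpaceConfiguration (d : ℕ) : MeasurableSpace (Configuration d) :=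
  sigmaOf d Set.univ

/-- The `σ`-algebra `E_Δ` generated by `N_Δ` and the configuration outside `Δ`. -/
@[reducible]
def exteriorSigma {d : ℕ} (Δ : Set (Space d)) : MeasurableSpace (Configuration d) :=
  MeasurableSpace.comap (Configuration.count Δ) ⊤ ⊔ sigmaOf d Δᶜ

/-! ### Local topology -/

/-- Local tame functions: for some bounded Borel `A` and some `b`, the function is
`F_A`-measurable and bounded by `b (1 + N_A)`. -/
def IsLocalTame {d : ℕ} (f : Configuration d → ℝ) : Prop :=
  ∃ A : Set (Space d), MeasurableSet A ∧ Bornology.IsBounded A ∧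
    Measurable[sigmaOf d A] f ∧
    ∃ b : ℝ, ∀ γ, |f γ| ≤ b * (1 + (Configuration.count A γ : ℝ))

/-- The local topology: the coarsest one for which `P ↦ ∫ f dP` is continuous for every local
tame `f`. -/
@[reducible]
def localTopology (d : ℕ) : TopologicalSpace (Measure (Configuration d)) :=
  ⨅ f : {f : Configuration d → ℝ // IsLocalTame f},
    TopologicalSpace.induced (fun P => ∫ γ, f.1 γ ∂P) inferInstance

/-! ### Riesz interaction and its periodization -/

/-- The Riesz potential `g(x) = ‖x‖^{-s}`, for `x ≠ 0`. (In Lean the value at `0` is `0`. The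
energies below evaluate `g` at differences of distinct points. The remaining occurrences of `g(0)`
lie in null sets, see the comments at `periodicRiesz` and `truncatedMove`.) -/
def riesz {d : ℕ} (s : ℝ) (x : Space d) : ℝ := ‖x‖ ^ (-s)

/-- The side length `n^{1/d}`. -/
def side (d n : ℕ) : ℝ := (n : ℝ) ^ ((1 : ℝ) / (d : ℝ))

/-- The box `Λ_n = [-n^{1/d}/2, n^{1/d}/2]^d` of volume `n`. -/
def box (d n : ℕ) : Set (Space d) := {x | ∀ i, |x i| ≤ side d n / 2}

/-- The vector `n^{1/d} k` for `k ∈ ℤ^d`. -/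
def latticeVec (d n : ℕ) (k : Fin d → ℤ) : Space d :=
  side d n • WithLp.toLp 2 (fun i => (k i : ℝ))

/-- The periodized potential
`g_n(x) = ∑_{k ∈ ℤ^d} (g(x + k n^{1/d}) - (1/n) ∫_{Λ_n} g(y + k n^{1/d}) dy)`;
the series converges absolutely for `d - 1 < s < d`. The value at points `x ∈ n^{1/d} ℤ^d` is
immaterial: it only enters for configurations with two points differing by such a vector, which
form a null set for the binomial process. -/
def periodicRiesz {d : ℕ} (s : ℝ) (n : ℕ) (x : Space d) : ℝ :=
  ∑' k : Fin d → ℤ,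
    (riesz s (x + latticeVec d n k)
      - (1 / (n : ℝ)) * ∫ y in box d n, riesz s (y + latticeVec d n k))

/-- The pair energy `∑_{{x,y} ⊂ γ} φ(x - y)` of a finite configuration for an even potential `φ`,
written as half of the sum over ordered pairs of distinct points. -/
def pairEnergy {d : ℕ} (φ : Space d → ℝ) (γ : Configuration d) : ℝ :=
  (1 / 2) * ∑ᶠ p ∈ γ.carrier.offDiag, φ (p.1 - p.2)

/-- `H(γ) = ∑_{{x,y} ⊂ γ} g(x - y)`. -/
def energy {d : ℕ} (s : ℝ) (γ : Configuration d) : ℝ := pairEnergy (riesz s) γ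

/-- `H_n(γ) = ∑_{{x,y} ⊂ γ} g_n(x - y)`. -/
def periodicEnergy {d : ℕ} (s : ℝ) (n : ℕ) (γ : Configuration d) : ℝ :=
  pairEnergy (periodicRiesz s n) γ

/-! ### Gibbs measures on the torus and their limits -/

/-- The binomial point process: `N` independent uniform points in `A`. For `N = 0` it is the
Dirac mass at the empty configuration, whatever `A` is. -/
def binomialProcess {d : ℕ} (A : Set (Space d)) (N : ℕ) : Measure (Configuration d) :=
  Measure.map Configuration.ofPoints
    (Measure.pi (fun _ : Fin N => ProbabilityTheory.cond (volume : Measure (Space d)) A))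

/-- The canonical partition function `Z_n^β`. -/
def torusPartition (d : ℕ) (s β : ℝ) (n : ℕ) : ℝ :=
  ∫ γ, Real.exp (-β * periodicEnergy s n γ) ∂(binomialProcess (box d n) n)

/-- The canonical Gibbs measure `P_n^β = (1 / Z_n^β) e^{-β H_n} Bin_{Λ_n, n}`. -/
def torusGibbs (d : ℕ) (s β : ℝ) (n : ℕ) : Measure (Configuration d) :=
  (binomialProcess (box d n) n).withDensity
    (fun γ => ENNReal.ofReal
      ((1 / torusPartition d s β n) * Real.exp (-β * periodicEnergy s n γ)))

/-- A `β`-circular Riesz gas: a point process that is an accumulation point, for the local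
topology, of the sequence `(P_n^β)` as `n → ∞`. Limits of subsequences are accumulation points
in this sense. -/
def IsCircularRieszGas {d : ℕ} (s β : ℝ) (P : Measure (Configuration d)) : Prop :=
  IsProbabilityMeasure P ∧
    @MapClusterPt (Measure (Configuration d)) (localTopology d) ℕ P atTop (torusGibbs d s β)

/-! ### Move functions and the canonical DLR kernel -/

/-- `M_Δ^{(p)}(η, γ) = ∑_{x ∈ η_Δ} ∑_{y ∈ γ_{Λ_p ∖ Δ}} (g(x - y) - g(y))`. Here `x ≠ y`, so that
`g` is evaluated at `0` only if `0 ∈ γ`. -/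
def truncatedMove {d : ℕ} (s : ℝ) (Δ : Set (Space d)) (p : ℕ) (η γ : Configuration d) : ℝ :=
  ∑ᶠ x ∈ η.carrier ∩ Δ, ∑ᶠ y ∈ γ.carrier ∩ (box d p \ Δ), (riesz s (x - y) - riesz s y)

/-- `M_Δ(η, γ) = lim_{p → ∞} M_Δ^{(p)}(η, γ)` (wherever the limit exists). -/
def move {d : ℕ} (s : ℝ) (Δ : Set (Space d)) (η γ : Configuration d) : ℝ :=
  limUnder atTop (fun p : ℕ => truncatedMove s Δ p η γ)

/-- The weight `e^{-β (H(η) + M_Δ(η, γ))}`. -/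
def weight {d : ℕ} (s β : ℝ) (Δ : Set (Space d)) (γ η : Configuration d) : ℝ :=
  Real.exp (-β * (energy s η + move s Δ η γ))

/-- `Z_Δ^β(γ) = ∫ e^{-β (H(η) + M_Δ(η, γ))} Bin_{Δ, N_Δ(γ)}(dη)`. -/
def localPartition {d : ℕ} (s β : ℝ) (Δ : Set (Space d)) (γ : Configuration d) : ℝ :=
  ∫ η, weight s β Δ γ η ∂(binomialProcess Δ (γ.count Δ))

/-- `f_Δ(γ) = ∫ (1 / Z_Δ^β(γ)) f(η ∪ γ_{Δᶜ}) e^{-β (H(η) + M_Δ(η, γ))} Bin_{Δ, N_Δ(γ)}(dη)`. -/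
def dlrAverage {d : ℕ} (s β : ℝ) (Δ : Set (Space d)) (f : Configuration d → ℝ)
    (γ : Configuration d) : ℝ :=
  ∫ η, (1 / localPartition s β Δ γ) * f (η.union (γ.restrict Δᶜ)) * weight s β Δ γ η
    ∂(binomialProcess Δ (γ.count Δ))

end RieszGas

end

/-!
Resampling the points that a binomial process has in `Δ` does not change its law, so each torus
Gibbs measure is invariant under resampling its points in `Δ` with the torus energy, conditionally
on their number and on the points outside `Δ`. By translation invariance on the torus its intensity
is Lebesgue measure on `Λ_n`, so the intensity of a circular Riesz gas is at most Lebesgue measure.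
Since `s + 1 > d` and `|g(x - y) - g(y)| ≤ C (1 + ‖y‖)^{-(s+1)}` for `x ∈ Δ` and `y` far away, this
makes the series defining the move absolutely convergent almost surely.

For the passage to the limit, `g_n - g` is Lipschitz near `0` with constant `O(n^{-(s+1)/d})`. Up to
an additive constant, which the normalization cancels, the torus energy of a resampled configuration
therefore differs from the potential truncated to `Λ_p` by a tail that is small in mean, uniformly
in `n`. The averages of a local event under the truncated resampling are local functions, so
`n → ∞` is allowed along an ultrafilter, and letting `p → ∞` afterwards gives the invariance of the
gas under resampling in the field of all outside points.
-/

open MeasureTheory Filter Topology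

noncomputable section

namespace RieszGas

open RieszGas.Configuration ProbabilityTheory Bornology

variable {d : ℕ}

/-! ### Measurability on the space of configurations -/

lemma measurable_count_sigmaOf {A Λ : Set (Space d)} (hA : MeasurableSet A) (hb : IsBounded A)
    (h : A ⊆ Λ) : Measurable[sigmaOf d Λ] (count A : Configuration d → ℕ) := by
  have hle : MeasurableSpace.comap (count A : Configuration d → ℕ) ⊤ ≤ sigmaOf d Λ :=
    le_iSup (fun A : {A : Set (Space d) // MeasurableSet A ∧ IsBounded A ∧ A ⊆ Λ} =>
      MeasurableSpace.comap (count A.1) ⊤) ⟨A, hA, hb, h⟩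
  exact (comap_measurable _).mono hle le_rfl

lemma measurable_count {A : Set (Space d)} (hA : MeasurableSet A) (hb : IsBounded A) :
    Measurable (count A : Configuration d → ℕ) :=
  measurable_count_sigmaOf hA hb (Set.subset_univ _)

lemma measurable_to_sigmaOf {E : Type*} [MeasurableSpace E] {Λ : Set (Space d)}
    {F : E → Configuration d}
    (h : ∀ A, MeasurableSet A → IsBounded A → A ⊆ Λ → Measurable fun e => count A (F e)) :
    Measurable[_, sigmaOf d Λ] F := by
  rw [measurable_iff_comap_le, sigmaOf, MeasurableSpace.comap_iSup]
  refine iSup_le fun A => ?_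
  rw [MeasurableSpace.comap_comp, ← measurable_iff_comap_le]
  exact h A.1 A.2.1 A.2.2.1 A.2.2.2

lemma measurable_to_configuration {E : Type*} [MeasurableSpace E] {F : E → Configuration d}
    (h : ∀ A, MeasurableSet A → IsBounded A → Measurable fun e => count A (F e)) :
    Measurable F :=
  measurable_to_sigmaOf fun A hA hb _ => h A hA hb

lemma sigmaOf_mono {A B : Set (Space d)} (h : A ⊆ B) : sigmaOf d A ≤ sigmaOf d B :=
  iSup_le fun C => measurable_iff_comap_le.1
    (measurable_count_sigmaOf C.2.1 C.2.2.1 (C.2.2.2.trans h))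

lemma sigmaOf_le (A : Set (Space d)) : sigmaOf d A ≤ instMeasurableSpaceConfiguration d :=
  sigmaOf_mono (Set.subset_univ A)

@[simp] lemma count_restrict (γ : Configuration d) (A B : Set (Space d)) :
    count B (γ.restrict A) = count (A ∩ B) γ := by
  simp only [count, restrict, Set.inter_assoc]

lemma measurable_restrict_sigmaOf {A : Set (Space d)} (hA : MeasurableSet A) :
    Measurable[sigmaOf d A] fun γ : Configuration d => γ.restrict A := by
  refine @measurable_to_sigmaOf d _ (sigmaOf d A) _ _ fun B hB hb _ => ?_
  simp only [count_restrict]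
  exact measurable_count_sigmaOf (hA.inter hB) (hb.subset Set.inter_subset_right)
    Set.inter_subset_left

lemma restrict_mem_iff {A : Set (Space d)} {E : Set (Configuration d)}
    (hE : MeasurableSet[sigmaOf d A] E) (γ : Configuration d) : γ.restrict A ∈ E ↔ γ ∈ E := by
  have hle : sigmaOf d A ≤
      MeasurableSpace.comap (fun γ : Configuration d => γ.restrict A) (sigmaOf d A) := by
    refine iSup_le fun C => ?_
    have hcount : (count C.1 : Configuration d → ℕ) = count C.1 ∘ fun γ => γ.restrict A := by
      funext γ
      simp only [Function.comp_apply, count_restrict, Set.inter_eq_right.2 C.2.2.2]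
    rw [hcount, ← MeasurableSpace.comap_comp]
    exact MeasurableSpace.comap_mono
      (measurable_iff_comap_le.1 (measurable_count_sigmaOf C.2.1 C.2.2.1 C.2.2.2))
  obtain ⟨F, -, rfl⟩ := hle _ hE
  simp [restrict, Set.inter_assoc]

lemma restrict_of_subset {A : Set (Space d)} {γ : Configuration d} (h : γ.carrier ⊆ A) :
    γ.restrict A = γ :=
  Configuration.ext (Set.inter_eq_left.2 h)

lemma carrier_inter_finite (γ : Configuration d) {A : Set (Space d)} (hb : IsBounded A) :
    (γ.carrier ∩ A).Finite :=
  (γ.locallyFinite (closure A) isClosed_closure.measurableSet hb.closure).subset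
    (Set.inter_subset_inter_right _ subset_closure)

/-- The configuration `η_Δ ∪ γ_{Δᶜ}`, obtained from `γ` by resampling its points in `Δ`. The first
argument is cut down to `Δ`, so that the union is disjoint for all `η` and `γ`. -/
def glue (Δ : Set (Space d)) (η γ : Configuration d) : Configuration d :=
  (η.restrict Δ).union (γ.restrict Δᶜ)

lemma count_glue {Δ A : Set (Space d)} (hb : IsBounded A) (η γ : Configuration d) :
    count A (glue Δ η γ) = count (Δ ∩ A) η + count (Δᶜ ∩ A) γ := by
  have hinter : (glue Δ η γ).carrier ∩ A = (η.carrier ∩ (Δ ∩ A)) ∪ (γ.carrier ∩ (Δᶜ ∩ A)) := by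
    simp only [glue, Configuration.union, restrict, Set.union_inter_distrib_right, Set.inter_assoc]
  have hdisj : Disjoint (η.carrier ∩ (Δ ∩ A)) (γ.carrier ∩ (Δᶜ ∩ A)) :=
    disjoint_compl_right.mono (fun _ hx => hx.2.1) (fun _ hx => hx.2.1)
  rw [count, hinter, Set.ncard_union_eq hdisj
    (carrier_inter_finite η (hb.subset Set.inter_subset_right))
    (carrier_inter_finite γ (hb.subset Set.inter_subset_right))]
  rfl

lemma count_glue_self {Δ : Set (Space d)} (hb : IsBounded Δ) (η γ : Configuration d) :
    count Δ (glue Δ η γ) = count Δ η := by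
  rw [count_glue hb, Set.inter_self, Set.compl_inter_self]
  simp [count]

lemma measurable_glue {Δ : Set (Space d)} (hΔ : MeasurableSet Δ) :
    Measurable fun p : Configuration d × Configuration d => glue Δ p.1 p.2 := by
  refine measurable_to_configuration fun A hA hb => ?_
  simp only [count_glue hb]
  exact ((measurable_count (hΔ.inter hA) (hb.subset Set.inter_subset_right)).comp
    measurable_fst).add
    ((measurable_count (hΔ.compl.inter hA) (hb.subset Set.inter_subset_right)).comp measurable_snd)

lemma measurable_glue_left {Δ : Set (Space d)} (hΔ : MeasurableSet Δ) (γ : Configuration d) :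
    Measurable fun η => glue Δ η γ :=
  (measurable_glue hΔ).comp (measurable_id.prodMk measurable_const)

@[simp] lemma glue_restrict_compl (Δ : Set (Space d)) (η γ : Configuration d) :
    (glue Δ η γ).restrict Δᶜ = γ.restrict Δᶜ := by
  ext x
  simp only [glue, Configuration.union, restrict, Set.mem_inter_iff, Set.mem_union,
    Set.mem_compl_iff]
  tauto

lemma glue_restrict_compl_right (Δ : Set (Space d)) (η γ : Configuration d) :
    glue Δ η (γ.restrict Δᶜ) = glue Δ η γ := by
  simp only [glue, restrict, Set.inter_assoc, Set.inter_self]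

lemma glue_glue (Δ : Set (Space d)) (η η' γ : Configuration d) :
    glue Δ η (glue Δ η' γ) = glue Δ η γ := by
  rw [← glue_restrict_compl_right, glue_restrict_compl, glue_restrict_compl_right]

lemma glue_of_subset {Δ : Set (Space d)} {η : Configuration d} (h : η.carrier ⊆ Δ)
    (γ : Configuration d) : glue Δ η γ = η.union (γ.restrict Δᶜ) := by
  rw [glue, restrict_of_subset h]

/-! ### The counting measure of a configuration -/

/-- The point measure `∑_{y ∈ γ} δ_y`, through which sums over `γ` become integrals. -/
def pointMeasure (γ : Configuration d) : Measure (Space d) := Measure.count.restrict γ.carrier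

lemma pointMeasure_apply (γ : Configuration d) {A : Set (Space d)} (hA : MeasurableSet A)
    (hb : IsBounded A) : pointMeasure γ A = count A γ := by
  have hfin := carrier_inter_finite γ hb
  rw [pointMeasure, Measure.restrict_apply hA, Set.inter_comm, count,
    Measure.count_apply_finite _ hfin, Set.ncard_eq_toFinset_card _ hfin]

/-- The shell of all points with norm in `[m, m + 1)`. The shells form a countable partition of
`ℝ^d` into bounded sets, which reduces statements on configurations to finite ones. -/
def shell (d m : ℕ) : Set (Space d) := (fun x => ⌊‖x‖⌋₊) ⁻¹' {m}

lemma measurableSet_shell (m : ℕ) : MeasurableSet (shell d m) :=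
  (Nat.measurable_floor.comp measurable_norm) (measurableSet_singleton m)

lemma isBounded_shell (m : ℕ) : IsBounded (shell d m) := by
  refine isBounded_iff_forall_norm_le.2 ⟨m + 1, fun x hx => ?_⟩
  rw [shell, Set.mem_preimage, Set.mem_singleton_iff] at hx
  exact hx ▸ (Nat.lt_floor_add_one ‖x‖).le

lemma sum_restrict_shell (μ : Measure (Space d)) :
    Measure.sum (fun m => μ.restrict (shell d m)) = μ := by
  have hunion : ⋃ m, shell d m = Set.univ :=
    Set.eq_univ_of_forall fun x => Set.mem_iUnion.2 ⟨⌊‖x‖⌋₊, rfl⟩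
  rw [← Measure.restrict_iUnion (fun _ _ hij => Set.disjoint_left.2 fun _ hi hj =>
    hij (hi.symm.trans hj)) measurableSet_shell, hunion, Measure.restrict_univ]

lemma measurable_pointMeasure : Measurable (pointMeasure : Configuration d → _) := by
  refine Measure.measurable_of_measurable_coe _ fun A hA => ?_
  have hsum (γ : Configuration d) :
      pointMeasure γ A = ∑' m, (count (A ∩ shell d m) γ : ENNReal) := by
    rw [← sum_restrict_shell (pointMeasure γ), Measure.sum_apply _ hA]
    refine tsum_congr fun m => ?_
    rw [Measure.restrict_apply hA, pointMeasure_apply _ (hA.inter (measurableSet_shell m))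
      ((isBounded_shell m).subset Set.inter_subset_right)]
  simp only [hsum]
  exact Measurable.tsum fun m => measurable_from_top.comp (measurable_count
    (hA.inter (measurableSet_shell m)) ((isBounded_shell m).subset Set.inter_subset_right))

/-- The kernel `γ ↦ ∑_{y ∈ γ} δ_y`. -/
def pointKernel : Kernel (Configuration d) (Space d) := ⟨pointMeasure, measurable_pointMeasure⟩

@[simp] lemma pointKernel_apply (γ : Configuration d) : pointKernel γ = pointMeasure γ := rfl

lemma isSFiniteKernel_of_forall_isFiniteMeasure {α X : Type*} [MeasurableSpace α]
    [MeasurableSpace X] (κ : Kernel α X) [∀ a, IsFiniteMeasure (κ a)] : IsSFiniteKernel κ := by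
  classical
  -- Split the parameter space according to the integer part of the total mass.
  let mass (a : α) : ℕ := ⌊(κ a).real Set.univ⌋₊
  have hmass (N : ℕ) : MeasurableSet {a | mass a = N} :=
    (Nat.measurable_floor.comp (κ.measurable_coe .univ).ennreal_toReal) (measurableSet_singleton N)
  let κ' (N : ℕ) : Kernel α X := Kernel.piecewise (hmass N) κ 0
  have hfin (N : ℕ) : IsFiniteKernel (κ' N) := by
    refine ⟨⟨ENNReal.ofReal (N + 1), ENNReal.ofReal_lt_top, fun a => ?_⟩⟩
    rw [Kernel.piecewise_apply']
    split_ifs with ha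
    · rw [← ofReal_measureReal]
      exact ENNReal.ofReal_le_ofReal (ha ▸ (Nat.lt_floor_add_one _).le)
    · simp
  have hsum : κ = Kernel.sum κ' := by
    ext a A hA
    rw [Kernel.sum_apply' _ _ hA, tsum_eq_single (mass a)]
    · simp [κ', Kernel.piecewise_apply']
    · intro N hN
      simp [κ', Kernel.piecewise_apply', hN.symm]
  rw [hsum]
  infer_instance

instance : IsSFiniteKernel (pointKernel (d := d)) := by
  have hsum : pointKernel (d := d)
      = Kernel.sum fun m => pointKernel.restrict (measurableSet_shell m) := by
    ext γ : 1
    simp only [Kernel.sum_apply, Kernel.restrict_apply, pointKernel_apply, sum_restrict_shell]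
  have hshell (m : ℕ) :
      IsSFiniteKernel (pointKernel.restrict (measurableSet_shell (d := d) m)) := by
    have (γ : Configuration d) :
        IsFiniteMeasure (pointKernel.restrict (measurableSet_shell m) γ) := by
      refine ⟨?_⟩
      rw [Kernel.restrict_apply, Measure.restrict_apply_univ, pointKernel_apply,
        pointMeasure_apply _ (measurableSet_shell m) (isBounded_shell m)]
      exact ENNReal.natCast_lt_top _
    exact isSFiniteKernel_of_forall_isFiniteMeasure _
  rw [hsum]
  infer_instance

/-! ### Sums over configurations -/

lemma finsum_mem_eq_integral (γ : Configuration d) {A : Set (Space d)} (hA : MeasurableSet A)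
    (hb : IsBounded A) (φ : Space d → ℝ) :
    ∑ᶠ y ∈ γ.carrier ∩ A, φ y = ∫ y in A, φ y ∂(pointMeasure γ) := by
  have hfin := carrier_inter_finite γ hb
  have hint : IntegrableOn φ hfin.toFinset Measure.count := by
    rw [← Set.biUnion_of_singleton (hfin.toFinset : Set (Space d))]
    exact integrableOn_finset_iUnion.2 (by simp)
  rw [pointMeasure, Measure.restrict_restrict hA, Set.inter_comm A, ← hfin.coe_toFinset,
    finsum_mem_coe_finset, setIntegral_finset _ hint]
  simp [Measure.real]

lemma measurable_finsum_mem {E : Type*} [MeasurableSpace E] {φ : E → Space d → ℝ}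
    (hφ : Measurable (Function.uncurry φ)) {A : Set (Space d)} (hA : MeasurableSet A)
    (hb : IsBounded A) :
    Measurable fun p : E × Configuration d => ∑ᶠ y ∈ p.2.carrier ∩ A, φ p.1 y := by
  simp only [finsum_mem_eq_integral _ hA hb]
  let κ : Kernel (E × Configuration d) (Space d) := Kernel.prodMkLeft E (pointKernel.restrict hA)
  have hint : StronglyMeasurable fun p : E × Configuration d => ∫ y, φ p.1 y ∂(κ p) := by
    refine StronglyMeasurable.integral_kernel_prod_right' (κ := κ)
      (f := fun q : (E × Configuration d) × Space d => φ q.1.1 q.2) ?_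
    exact (hφ.comp ((measurable_fst.comp measurable_fst).prodMk
      measurable_snd)).stronglyMeasurable
  simpa [κ, Kernel.restrict_apply] using hint.measurable

lemma measurable_finsum_mem_finsum_mem {φ : Space d → Space d → ℝ}
    (hφ : Measurable (Function.uncurry φ)) {A B : Set (Space d)} (hA : MeasurableSet A)
    (hAb : IsBounded A) (hB : MeasurableSet B) (hBb : IsBounded B) :
    Measurable fun q : Configuration d × Configuration d =>
      ∑ᶠ x ∈ q.1.carrier ∩ A, ∑ᶠ y ∈ q.2.carrier ∩ B, φ x y :=
  (measurable_finsum_mem (E := Configuration d) (φ := fun γ x => ∑ᶠ y ∈ γ.carrier ∩ B, φ x y)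
    ((measurable_finsum_mem hφ hB hBb).comp measurable_swap) hA hAb).comp measurable_swap

lemma pairEnergy_restrict_eq_finsum {φ : Space d → ℝ} (γ : Configuration d) {A : Set (Space d)}
    (hb : IsBounded A) :
    pairEnergy φ (γ.restrict A) = (1 / 2) * ∑ᶠ x ∈ γ.carrier ∩ A, ∑ᶠ y ∈ γ.carrier ∩ A,
      ({x}ᶜ : Set (Space d)).indicator (fun y => φ (x - y)) y := by
  classical
  obtain ⟨S, hS⟩ := (carrier_inter_finite γ hb).exists_finset_coe
  have hoffDiag : S.offDiag = (S ×ˢ S).filter fun p => p.1 ≠ p.2 := by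
    ext p
    simp only [Finset.mem_offDiag, Finset.mem_filter, Finset.mem_product, and_assoc]
  rw [pairEnergy, show (γ.restrict A).carrier = γ.carrier ∩ A from rfl, ← hS]
  simp only [finsum_mem_coe_finset]
  rw [← Finset.coe_offDiag, finsum_mem_coe_finset, hoffDiag, Finset.sum_filter,
    Finset.sum_product]
  congr 1
  refine Finset.sum_congr rfl fun x _ => Finset.sum_congr rfl fun y _ => ?_
  by_cases h : x = y
  · simp [h]
  · simp [h, Ne.symm h]

lemma measurable_pairEnergy_restrict {φ : Space d → ℝ} (hφ : Measurable φ) {A : Set (Space d)}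
    (hA : MeasurableSet A) (hb : IsBounded A) :
    Measurable fun γ : Configuration d => pairEnergy φ (γ.restrict A) := by
  have hindicator : Measurable (Function.uncurry fun x y : Space d =>
      ({x}ᶜ : Set (Space d)).indicator (fun y => φ (x - y)) y) := by
    have heq : Function.uncurry (fun x y : Space d =>
        ({x}ᶜ : Set (Space d)).indicator (fun y => φ (x - y)) y)
        = Set.indicator {q : Space d × Space d | q.1 = q.2}ᶜ (fun q => φ (q.1 - q.2)) := by
      funext q
      by_cases hq : q.1 = q.2
      · simp [Function.uncurry, hq]
      · simp [Function.uncurry, hq, Ne.symm hq]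
    rw [heq]
    exact (hφ.comp (measurable_fst.sub measurable_snd)).indicator
      (measurableSet_eq_fun measurable_fst measurable_snd).compl
  simp only [pairEnergy_restrict_eq_finsum _ hb]
  exact ((measurable_finsum_mem_finsum_mem hindicator hA hb hA hb).comp
    (measurable_id.prodMk measurable_id)).const_mul _

/-! ### The binomial process -/

lemma count_ofPoints {N : ℕ} (x : Fin N → Space d) (A : Set (Space d)) [DecidablePred (· ∈ A)] :
    count A (ofPoints x) = ∑ i, if x i ∈ A ∧ ∀ j < i, x j ≠ x i then 1 else 0 := by
  classical
  rw [Finset.sum_boole, Nat.cast_id, count]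
  -- Coinciding points are counted at the first index at which they occur.
  set I : Finset (Fin N) := {i | x i ∈ A ∧ ∀ j < i, x j ≠ x i} with hI
  have hmem (i : Fin N) : i ∈ I ↔ x i ∈ A ∧ ∀ j < i, x j ≠ x i := by
    simp only [hI, Finset.mem_filter, Finset.mem_univ, true_and]
  have himage : (ofPoints x).carrier ∩ A = x '' I := by
    ext y
    constructor
    · rintro ⟨⟨i, rfl⟩, hA⟩
      obtain ⟨k, hk, hmin⟩ := wellFounded_lt.has_min {k | x k = x i} ⟨i, rfl⟩
      rw [Set.mem_ofPred_eq] at hk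
      exact ⟨k, (hmem k).2 ⟨hk ▸ hA, fun j hj hjk => hmin j (hjk.trans hk) hj⟩, hk⟩
    · rintro ⟨i, hi, rfl⟩
      exact ⟨⟨i, rfl⟩, ((hmem i).1 hi).1⟩
  have hinj : Set.InjOn x I := by
    intro i hi j hj hij
    rcases lt_trichotomy i j with h | h | h
    · exact absurd hij (((hmem j).1 hj).2 i h)
    · exact h
    · exact absurd hij.symm (((hmem i).1 hi).2 j h)
  rw [himage, hinj.ncard_image, Set.ncard_coe_finset]

lemma measurable_ofPoints {N : ℕ} : Measurable (ofPoints : (Fin N → Space d) → _) := by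
  classical
  refine measurable_to_configuration fun A hA _ => ?_
  simp only [count_ofPoints]
  refine Finset.measurable_sum _ fun i _ => Measurable.ite ?_ measurable_const measurable_const
  exact (measurable_pi_apply i hA).inter <| measurableSet_setOfPred.2 <| Measurable.forall fun j =>
    measurable_const.imp <| measurableSet_setOfPred.1
      (measurableSet_eq_fun (measurable_pi_apply j) (measurable_pi_apply i)).compl

lemma count_ofPoints_of_injective {N : ℕ} {x : Fin N → Space d} (hx : Function.Injective x)
    (A : Set (Space d)) [DecidablePred (· ∈ A)] :
    count A (ofPoints x) = (Finset.univ.filter fun i => x i ∈ A).card := by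
  rw [count_ofPoints, Finset.sum_boole, Nat.cast_id]
  congr 1
  ext i
  simp only [Finset.mem_filter, Finset.mem_univ, true_and, and_iff_left_iff_imp]
  exact fun _ j hj h => hj.ne (hx h)

section ProductMeasure

variable {ι κ X : Type*} [Fintype ι] [MeasurableSpace X] {μ : Measure X}

lemma ae_pi_forall [SigmaFinite μ] {p : X → Prop} (h : ∀ᵐ x ∂μ, p x) :
    ∀ᵐ x ∂(Measure.pi fun _ : ι => μ), ∀ i, p (x i) :=
  ae_all_iff.2 fun _ => Measure.tendsto_eval_ae_ae.eventually h

variable [IsProbabilityMeasure μ]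

lemma iIndepFun_eval_pi :
    iIndepFun (fun (i : ι) (x : ι → X) => x i) (Measure.pi fun _ => μ) :=
  iIndepFun_pi (X := fun _ => id) fun _ => aemeasurable_id

lemma measurePreserving_comp_pi [Fintype κ] {σ : κ → ι} (hσ : Function.Injective σ) :
    MeasurePreserving (fun y : ι → X => y ∘ σ) (Measure.pi fun _ => μ) (Measure.pi fun _ => μ) := by
  have hcoord (k : κ) : Measurable fun y : ι → X => y (σ k) := measurable_pi_apply _
  refine ⟨measurable_pi_lambda _ hcoord, ?_⟩
  refine ((iIndepFun_iff_map_fun_eq_pi_map fun k => (hcoord k).aemeasurable).1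
    (iIndepFun_eval_pi.precomp hσ)).trans ?_
  congr 1
  funext k
  exact (measurePreserving_eval (fun _ => μ) (σ k)).map_eq

lemma prod_self_diagonal [MeasurableEq X] [NullSingletonClass μ] :
    (μ.prod μ) (Set.diagonal X) = 0 := by
  rw [Measure.measure_prod_null measurableSet_diagonal]
  refine Eventually.of_forall fun a => ?_
  have hfiber : Prod.mk a ⁻¹' Set.diagonal X = {a} := by
    ext
    simp [eq_comm]
  simp [hfiber]

lemma ae_injective_pi [MeasurableEq X] [NullSingletonClass μ] :
    ∀ᵐ x ∂(Measure.pi fun _ : ι => μ), Function.Injective x := by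
  have hne (i j : ι) (hij : i ≠ j) : ∀ᵐ x ∂(Measure.pi fun _ : ι => μ), x i ≠ x j := by
    have hlaw := (indepFun_iff_map_prod_eq_prod_map_map (measurable_pi_apply i).aemeasurable
      (measurable_pi_apply j).aemeasurable).1 (iIndepFun_eval_pi (μ := μ).indepFun hij)
    rw [(measurePreserving_eval (fun _ => μ) i).map_eq,
      (measurePreserving_eval (fun _ => μ) j).map_eq] at hlaw
    refine ae_of_ae_map (f := fun x : ι → X => (x i, x j)) (p := fun q => q.1 ≠ q.2)
      ((measurable_pi_apply i).prodMk (measurable_pi_apply j)).aemeasurable ?_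
    rw [hlaw]
    exact measure_eq_zero_iff_ae_notMem.1 prod_self_diagonal
  have hall : ∀ᵐ x ∂(Measure.pi fun _ : ι => μ), ∀ i j, i ≠ j → x i ≠ x j := by
    simpa only [ae_all_iff] using hne
  filter_upwards [hall] with x hx i j hij
  exact not_imp_not.1 (hx i j) hij

end ProductMeasure

lemma isProbabilityMeasure_binomialProcess {A : Set (Space d)} (hA : volume A ≠ 0)
    (hb : IsBounded A) (N : ℕ) : IsProbabilityMeasure (binomialProcess A N) := by
  have := cond_isProbabilityMeasure_of_finite hA hb.measure_lt_top.ne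
  exact Measure.isProbabilityMeasure_map measurable_ofPoints.aemeasurable

lemma binomialProcess_zero (A : Set (Space d)) :
    binomialProcess A 0 = Measure.dirac (ofPoints Fin.elim0) := by
  rw [binomialProcess, Measure.pi_of_empty _ Fin.elim0, Measure.map_dirac' measurable_ofPoints]

lemma ofPoints_elim0_carrier : (ofPoints (Fin.elim0 : Fin 0 → Space d)).carrier = ∅ := by
  simp [ofPoints]

lemma binomialProcess_eq_zero {A : Set (Space d)} (hA : volume A = 0) {N : ℕ} (hN : N ≠ 0) :
    binomialProcess A N = 0 := by
  rw [← Measure.measure_univ_eq_zero, binomialProcess,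
    Measure.map_apply measurable_ofPoints MeasurableSet.univ, Set.preimage_univ, Measure.pi_univ,
    cond_eq_zero_of_meas_eq_zero hA]
  simp [hN]

lemma binomialProcess_univ_le (A : Set (Space d)) (N : ℕ) :
    binomialProcess A N Set.univ ≤ 1 := by
  rw [binomialProcess, Measure.map_apply measurable_ofPoints MeasurableSet.univ, Set.preimage_univ,
    Measure.pi_univ]
  exact Finset.prod_le_one' fun _ _ => prob_le_one

instance (A : Set (Space d)) (N : ℕ) : IsFiniteMeasure (binomialProcess A N) :=
  ⟨(binomialProcess_univ_le A N).trans_lt ENNReal.one_lt_top⟩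

lemma measurableSet_count_eq {A : Set (Space d)} (hA : MeasurableSet A) (hb : IsBounded A)
    (N : ℕ) : MeasurableSet {γ : Configuration d | count A γ = N} :=
  measurable_count hA hb (measurableSet_singleton N)

/-- The kernel `γ ↦ Bin_{Δ, N_Δ(γ)}`. -/
def binomialKernel {Δ : Set (Space d)} (hΔ : MeasurableSet Δ) (hb : IsBounded Δ) :
    Kernel (Configuration d) (Configuration d) :=
  ⟨fun γ => binomialProcess Δ (count Δ γ), (measurable_from_top (f := binomialProcess Δ)).comp
    (measurable_count hΔ hb)⟩

instance {Δ : Set (Space d)} (hΔ : MeasurableSet Δ) (hb : IsBounded Δ) :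
    IsFiniteKernel (binomialKernel hΔ hb) :=
  ⟨⟨1, ENNReal.one_lt_top, fun _ => binomialProcess_univ_le _ _⟩⟩

lemma measurable_lintegral_binomialProcess {Δ : Set (Space d)} (hΔ : MeasurableSet Δ)
    (hb : IsBounded Δ) {F : Configuration d × Configuration d → ENNReal} (hF : Measurable F) :
    Measurable fun γ => ∫⁻ η, F (γ, η) ∂(binomialProcess Δ (count Δ γ)) :=
  hF.lintegral_kernel_prod_right' (κ := binomialKernel hΔ hb)

lemma measurableSet_carrier_subset {A : Set (Space d)} (hA : MeasurableSet A) :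
    MeasurableSet {γ : Configuration d | γ.carrier ⊆ A} := by
  have hnull : {γ : Configuration d | γ.carrier ⊆ A} = {γ | pointKernel γ Aᶜ = 0} := by
    ext γ
    simp only [Set.mem_ofPred_eq, pointKernel_apply, pointMeasure,
      Measure.restrict_apply hA.compl, Measure.count_eq_zero_iff]
    rw [Set.inter_comm, ← Set.disjoint_iff_inter_eq_empty, Set.disjoint_compl_right_iff_subset]
  rw [hnull]
  exact measurableSet_eq_fun (Kernel.measurable_coe _ hA.compl) measurable_const

lemma ae_binomialProcess_subset {A : Set (Space d)} (hA : MeasurableSet A) (N : ℕ) :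
    ∀ᵐ γ ∂(binomialProcess A N), γ.carrier ⊆ A := by
  rw [binomialProcess, ae_map_iff measurable_ofPoints.aemeasurable
    (measurableSet_carrier_subset hA)]
  filter_upwards [ae_pi_forall (ae_cond_mem hA)] with x hx
  exact Set.range_subset_iff.2 hx

lemma ae_binomialProcess_count_eq_zero {Λ Δ : Set (Space d)} (hΔ : MeasurableSet Δ)
    (hΔb : IsBounded Δ) (hΔ0 : volume Δ = 0) (n : ℕ) :
    ∀ᵐ γ ∂(binomialProcess Λ n), count Δ γ = 0 := by
  classical
  rw [binomialProcess, ae_map_iff measurable_ofPoints.aemeasurable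
    (measurableSet_count_eq hΔ hΔb 0)]
  have hnotMem : ∀ᵐ y ∂(cond (volume : Measure (Space d)) Λ), y ∉ Δ :=
    measure_eq_zero_iff_ae_notMem.1 (cond_absolutelyContinuous hΔ0)
  filter_upwards [ae_pi_forall hnotMem] with x hx
  simp [count_ofPoints, hx]

section Atomless

variable [NeZero d]

instance : Nontrivial (Space d) := by
  have : Nonempty (Fin d) := ⟨0⟩
  infer_instance

instance (A : Set (Space d)) : NullSingletonClass (cond (volume : Measure (Space d)) A) :=
  ⟨fun x => by simp [ProbabilityTheory.cond]⟩

lemma ae_injective_cond {A : Set (Space d)} (hA : volume A ≠ 0) (hb : IsBounded A) (N : ℕ) :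
    ∀ᵐ x ∂(Measure.pi fun _ : Fin N => cond (volume : Measure (Space d)) A),
      Function.Injective x := by
  have := cond_isProbabilityMeasure_of_finite hA hb.measure_lt_top.ne
  exact ae_injective_pi

lemma ae_binomialProcess_count {A B : Set (Space d)} (hA : MeasurableSet A) (hB : MeasurableSet B)
    (hBb : IsBounded B) (hAB : A ⊆ B) (N : ℕ) :
    ∀ᵐ γ ∂(binomialProcess A N), count B γ = N := by
  classical
  by_cases hA0 : volume A = 0
  · by_cases hN : N = 0
    · rw [hN, binomialProcess_zero, ae_dirac_iff (measurableSet_count_eq hB hBb 0)]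
      simp [count, ofPoints_elim0_carrier]
    · simp [binomialProcess_eq_zero hA0 hN]
  rw [binomialProcess, ae_map_iff measurable_ofPoints.aemeasurable
    (measurableSet_count_eq hB hBb N)]
  filter_upwards [ae_pi_forall (ae_cond_mem hA), ae_injective_cond hA0 (hBb.subset hAB) N]
    with x hmem hinj
  rw [count_ofPoints_of_injective hinj, Finset.filter_true_of_mem fun i _ => hAB (hmem i)]
  simp

end Atomless

/-! ### Resampling of the points in `Δ` -/

open Classical in
lemma measurePreserving_ite_cond {X : Type*} [MeasurableSpace X] {μ : Measure X} {Λ Δ : Set X}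
    (hΔ : MeasurableSet Δ) (hΛ : MeasurableSet Λ) (hsub : Δ ⊆ Λ) (hΔ0 : μ Δ ≠ 0) (hΔt : μ Δ ≠ ⊤) :
    MeasurePreserving (fun p : X × X => if p.1 ∈ Δ then p.2 else p.1)
      ((cond μ Λ).prod (cond μ Δ)) (cond μ Λ) := by
  have := cond_isProbabilityMeasure_of_finite hΔ0 hΔt
  have hm : Measurable (fun p : X × X => if p.1 ∈ Δ then p.2 else p.1) :=
    Measurable.ite (measurable_fst hΔ) measurable_snd measurable_fst
  refine ⟨hm, ?_⟩
  ext B hB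
  have hpreimage : (fun p : X × X => if p.1 ∈ Δ then p.2 else p.1) ⁻¹' B
      = (Δ ×ˢ B) ∪ ((B \ Δ) ×ˢ Set.univ) := by
    ext p
    by_cases hp : p.1 ∈ Δ <;> simp [hp]
  have hdisj : Disjoint (Δ ×ˢ B) ((B \ Δ) ×ˢ (Set.univ : Set X)) :=
    Set.disjoint_left.2 fun p hp hp' => hp'.1.2 hp.1
  have hcond : cond μ Λ Δ * cond μ Δ B = cond μ Λ (B ∩ Δ) := by
    rw [cond_apply hΛ, cond_apply hΔ, cond_apply hΛ, Set.inter_eq_right.2 hsub,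
      Set.inter_eq_right.2 (Set.inter_subset_right.trans hsub), Set.inter_comm B, mul_assoc,
      ← mul_assoc (μ Δ), ENNReal.mul_inv_cancel hΔ0 hΔt, one_mul]
  rw [Measure.map_apply hm hB, hpreimage,
    measure_union hdisj ((hB.diff hΔ).prod MeasurableSet.univ), Measure.prod_prod,
    Measure.prod_prod, measure_univ, mul_one, hcond, measure_inter_add_sdiff _ hΔ]

open Classical in
lemma measurePreserving_ite_pi {ι X : Type*} [Fintype ι] [MeasurableSpace X] {μ : Measure X}
    {Λ Δ : Set X} (hΔ : MeasurableSet Δ) (hΛ : MeasurableSet Λ) (hsub : Δ ⊆ Λ) (hΔ0 : μ Δ ≠ 0)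
    (hΔt : μ Δ ≠ ⊤) :
    MeasurePreserving
      (fun (p : (ι → X) × (ι → X)) i => if p.1 i ∈ Δ then p.2 i else p.1 i)
      ((Measure.pi fun _ => cond μ Λ).prod (Measure.pi fun _ => cond μ Δ))
      (Measure.pi fun _ => cond μ Λ) :=
  (measurePreserving_pi (fun _ => (cond μ Λ).prod (cond μ Δ)) (fun _ => cond μ Λ)
    fun _ => measurePreserving_ite_cond hΔ hΛ hsub hΔ0 hΔt).comp
    (measurePreserving_arrowProdEquivProdArrow X X ι (fun _ => cond μ Λ) fun _ => cond μ Δ).symm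

lemma lintegral_glue_binomialProcess_zero {Δ : Set (Space d)} (hΔ : MeasurableSet Δ)
    (hΔb : IsBounded Δ) {γ : Configuration d} (hγ : count Δ γ = 0)
    {G : Configuration d → ENNReal} (hG : Measurable G) :
    ∫⁻ η, G (glue Δ η γ) ∂(binomialProcess Δ 0) = G γ := by
  have hempty : γ.carrier ∩ Δ = ∅ := (Set.ncard_eq_zero (carrier_inter_finite γ hΔb)).1 hγ
  have hglue : glue Δ (ofPoints Fin.elim0) γ = γ := by
    rw [glue_of_subset (by simp [ofPoints_elim0_carrier])]
    ext x
    have hx : x ∈ γ.carrier → x ∉ Δ := fun hx hxΔ => hempty.le ⟨hx, hxΔ⟩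
    simpa [Configuration.union, restrict, ofPoints_elim0_carrier] using hx
  have hGγ : Measurable fun η => G (glue Δ η γ) := hG.comp (measurable_glue_left hΔ γ)
  rw [binomialProcess_zero, lintegral_dirac' _ hGγ, hglue]

open Classical in
lemma glue_ofPoints {Δ : Set (Space d)} {n k : ℕ} {x y : Fin n → Space d} {σ : Fin k → Fin n}
    (hσ : ∀ i, x i ∈ Δ ↔ i ∈ Set.range σ) (hy : ∀ i, y i ∈ Δ) :
    glue Δ (ofPoints (y ∘ σ)) (ofPoints x) = ofPoints fun i => if x i ∈ Δ then y i else x i := by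
  ext z
  constructor
  · rintro (⟨⟨j, rfl⟩, -⟩ | ⟨⟨i, rfl⟩, hi⟩)
    · exact ⟨σ j, if_pos ((hσ _).2 ⟨j, rfl⟩)⟩
    · exact ⟨i, if_neg hi⟩
  · rintro ⟨i, hi⟩
    dsimp only at hi
    split_ifs at hi with hxi
    · obtain ⟨j, rfl⟩ := (hσ i).1 hxi
      exact Or.inl ⟨⟨j, hi⟩, hi ▸ hy _⟩
    · exact Or.inr ⟨⟨i, hi⟩, hi ▸ hxi⟩

open Classical in
lemma lintegral_glue_ofPoints {Δ : Set (Space d)} (hΔ : MeasurableSet Δ) (hΔb : IsBounded Δ)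
    (hΔ0 : volume Δ ≠ 0) {n : ℕ} {x : Fin n → Space d} (hx : Function.Injective x)
    {G : Configuration d → ENNReal} (hG : Measurable G) :
    ∫⁻ η, G (glue Δ η (ofPoints x)) ∂(binomialProcess Δ (count Δ (ofPoints x)))
      = ∫⁻ y : Fin n → Space d, G (ofPoints fun i => if x i ∈ Δ then y i else x i)
          ∂(Measure.pi fun _ => cond volume Δ) := by
  have := cond_isProbabilityMeasure_of_finite hΔ0 hΔb.measure_lt_top.ne
  have hGx : Measurable fun η => G (glue Δ η (ofPoints x)) :=
    hG.comp (measurable_glue_left hΔ _)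
  have hGpts (k : ℕ) : Measurable fun y : Fin k → Space d => G (glue Δ (ofPoints y) (ofPoints x)) :=
    hGx.comp measurable_ofPoints
  let I : Finset (Fin n) := {i | x i ∈ Δ}
  let σ : Fin I.card → Fin n := I.orderEmbOfFin rfl
  have hσ (i : Fin n) : x i ∈ Δ ↔ i ∈ Set.range σ := by
    simp [σ, Finset.range_orderEmbOfFin, I]
  have hσinj : Function.Injective σ := (I.orderEmbOfFin rfl).injective
  rw [count_ofPoints_of_injective hx, binomialProcess, lintegral_map hGx measurable_ofPoints,
    ← (measurePreserving_comp_pi hσinj).lintegral_comp (hGpts _)]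
  refine lintegral_congr_ae ?_
  filter_upwards [ae_pi_forall (ae_cond_mem hΔ)] with y hy
  exact congrArg G (glue_ofPoints hσ hy)

theorem lintegral_resample [NeZero d] {Λ Δ : Set (Space d)} (hΔ : MeasurableSet Δ)
    (hsub : Δ ⊆ Λ) (hΛ : MeasurableSet Λ) (hΛb : IsBounded Λ) (hΛ0 : volume Λ ≠ 0) (n : ℕ)
    {G : Configuration d → ENNReal} (hG : Measurable G) :
    ∫⁻ γ, ∫⁻ η, G (glue Δ η γ) ∂(binomialProcess Δ (count Δ γ)) ∂(binomialProcess Λ n)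
      = ∫⁻ γ, G γ ∂(binomialProcess Λ n) := by
  classical
  have hΔb := hΛb.subset hsub
  by_cases hΔ0 : volume Δ = 0
  · refine lintegral_congr_ae ?_
    filter_upwards [ae_binomialProcess_count_eq_zero hΔ hΔb hΔ0 n] with γ hγ
    rw [hγ, lintegral_glue_binomialProcess_zero hΔ hΔb hγ hG]
  have hmp := measurePreserving_ite_pi (ι := Fin n) hΔ hΛ hsub hΔ0 hΔb.measure_lt_top.ne
  have hGpts : Measurable fun x : Fin n → Space d => G (ofPoints x) := hG.comp measurable_ofPoints
  have hinner : Measurable fun γ : Configuration d =>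
      ∫⁻ η, G (glue Δ η γ) ∂(binomialProcess Δ (count Δ γ)) :=
    measurable_lintegral_binomialProcess hΔ hΔb
      ((hG.comp (measurable_glue hΔ)).comp measurable_swap)
  calc _ = ∫⁻ x, ∫⁻ η, G (glue Δ η (ofPoints x)) ∂(binomialProcess Δ (count Δ (ofPoints x)))
        ∂(Measure.pi fun _ : Fin n => cond volume Λ) := by
        rw [binomialProcess, lintegral_map hinner measurable_ofPoints]
    _ = ∫⁻ x, ∫⁻ y, G (ofPoints fun i => if x i ∈ Δ then y i else x i)
        ∂(Measure.pi fun _ : Fin n => cond volume Δ)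
        ∂(Measure.pi fun _ : Fin n => cond volume Λ) := by
        refine lintegral_congr_ae ?_
        filter_upwards [ae_injective_cond hΛ0 hΛb n] with x hx
        exact lintegral_glue_ofPoints hΔ hΔb hΔ0 hx hG
    _ = ∫⁻ x, G (ofPoints x) ∂(Measure.pi fun _ : Fin n => cond volume Λ) := by
        rw [← hmp.lintegral_comp hGpts]
        exact (lintegral_prod _ (hGpts.comp hmp.measurable).aemeasurable).symm
    _ = _ := by rw [binomialProcess, lintegral_map hG measurable_ofPoints]

/-! ### Boxes -/

lemma side_nonneg (d n : ℕ) : 0 ≤ side d n := Real.rpow_nonneg (Nat.cast_nonneg n) _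

lemma side_pos (d : ℕ) {n : ℕ} (hn : 1 ≤ n) : 0 < side d n :=
  Real.rpow_pos_of_pos (by exact_mod_cast hn) _

lemma side_mono (d : ℕ) {m n : ℕ} (h : m ≤ n) : side d m ≤ side d n :=
  Real.rpow_le_rpow (Nat.cast_nonneg m) (by exact_mod_cast h) (by positivity)

lemma side_pow (d n : ℕ) [NeZero d] : side d n ^ d = n := by
  rw [side, one_div, Real.rpow_inv_natCast_pow (Nat.cast_nonneg n) (NeZero.ne d)]

lemma tendsto_side (d : ℕ) [NeZero d] : Tendsto (side d) atTop atTop := by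
  have hd : 0 < (1 : ℝ) / d := by have := NeZero.pos d; positivity
  exact (tendsto_rpow_atTop hd).comp tendsto_natCast_atTop_atTop

lemma abs_apply_le_norm (x : Space d) (i : Fin d) : |x i| ≤ ‖x‖ := by
  simpa using PiLp.norm_apply_le x i

lemma exists_norm_le_sqrt_mul_abs_apply [NeZero d] (x : Space d) :
    ∃ i, ‖x‖ ≤ Real.sqrt d * |x i| := by
  obtain ⟨i, -, hi⟩ := Finset.exists_max_image Finset.univ (fun i => |x i|) ⟨0, Finset.mem_univ _⟩
  refine ⟨i, ?_⟩
  rw [EuclideanSpace.norm_eq, ← Real.sqrt_sq (abs_nonneg (x i)), ← Real.sqrt_mul (by positivity)]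
  refine Real.sqrt_le_sqrt ?_
  calc ∑ j, ‖x j‖ ^ 2 ≤ ∑ _j : Fin d, |x i| ^ 2 :=
        Finset.sum_le_sum fun j hj => pow_le_pow_left₀ (norm_nonneg _) (hi j hj) 2
    _ = d * |x i| ^ 2 := by simp

lemma box_mono {m n : ℕ} (h : m ≤ n) : box d m ⊆ box d n := fun _ hx i =>
  (hx i).trans (by have := side_mono d h; linarith)

lemma box_eq_preimage (d n : ℕ) : box d n
    = WithLp.ofLp ⁻¹' (Set.univ.pi fun _ : Fin d => Set.Icc (-(side d n / 2)) (side d n / 2)) := by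
  ext x
  simp only [box, abs_le, Set.mem_ofPred_eq, Set.mem_preimage, Set.mem_univ_pi, Set.mem_Icc]

lemma measurableSet_box (d n : ℕ) : MeasurableSet (box d n) := by
  rw [box_eq_preimage]
  exact (WithLp.measurable_ofLp _ _) (MeasurableSet.univ_pi fun _ => measurableSet_Icc)

lemma norm_le_of_mem_box [NeZero d] {n : ℕ} {x : Space d} (hx : x ∈ box d n) :
    ‖x‖ ≤ Real.sqrt d * side d n := by
  obtain ⟨i, hi⟩ := exists_norm_le_sqrt_mul_abs_apply x
  refine hi.trans (mul_le_mul_of_nonneg_left ?_ (Real.sqrt_nonneg _))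
  linarith [hx i, side_nonneg d n]

lemma isBounded_box (d n : ℕ) [NeZero d] : IsBounded (box d n) :=
  isBounded_iff_forall_norm_le.2 ⟨_, fun _ => norm_le_of_mem_box⟩

lemma half_side_le_norm {n : ℕ} {x : Space d} (hx : x ∉ box d n) : side d n / 2 ≤ ‖x‖ := by
  simp only [box, Set.mem_ofPred_eq, not_forall, not_le] at hx
  obtain ⟨i, hi⟩ := hx
  exact hi.le.trans (abs_apply_le_norm x i)

lemma closedBall_subset_box {n : ℕ} {r : ℝ} (h : r ≤ side d n / 2) :
    Metric.closedBall (0 : Space d) r ⊆ box d n := fun x hx i =>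
  (abs_apply_le_norm x i).trans ((mem_closedBall_zero_iff.1 hx).trans h)

lemma volume_box (d n : ℕ) [NeZero d] : volume (box d n) = n := by
  rw [box_eq_preimage, (PiLp.volume_preserving_ofLp (Fin d)).measure_preimage
    (MeasurableSet.univ_pi fun _ => measurableSet_Icc).nullMeasurableSet, volume_pi_pi]
  simp only [Real.volume_Icc, sub_neg_eq_add, add_halves, Finset.prod_const, Finset.card_univ,
    Fintype.card_fin]
  rw [← ENNReal.ofReal_pow (side_nonneg d n), side_pow, ENNReal.ofReal_natCast]

lemma volume_box_ne_zero [NeZero d] {n : ℕ} (hn : 1 ≤ n) : volume (box d n) ≠ 0 := by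
  rw [volume_box]
  exact_mod_cast (Nat.one_le_iff_ne_zero.1 hn)

/-! ### The Riesz potential -/

lemma pos_of_lt_add_one [NeZero d] {s : ℝ} (hsd : (d : ℝ) < s + 1) : 0 < s := by
  have hd : (1 : ℝ) ≤ d := by exact_mod_cast NeZero.one_le
  linarith

lemma abs_rpow_sub_rpow_le {s m a b : ℝ} (hs : 0 ≤ s) (hm : 0 < m) (ha : m ≤ a) (hb : m ≤ b) :
    |a ^ (-s) - b ^ (-s)| ≤ s * m ^ (-(s + 1)) * |a - b| := by
  refine (convex_Ici m).norm_image_sub_le_of_norm_hasDerivWithin_le (f := fun t : ℝ => t ^ (-s))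
    (f' := fun t => -s * t ^ (-s - 1)) (fun t ht => ?_) (fun t ht => ?_) hb ha
  · exact (Real.hasDerivAt_rpow_const (Or.inl (hm.trans_le ht).ne')).hasDerivWithinAt
  · rw [norm_mul, norm_neg, Real.norm_of_nonneg hs,
      Real.norm_of_nonneg (Real.rpow_nonneg (hm.le.trans ht) _), show -s - 1 = -(s + 1) by ring]
    exact mul_le_mul_of_nonneg_left (Real.rpow_le_rpow_of_nonpos hm ht (by linarith)) hs

lemma abs_riesz_sub_le {s m : ℝ} (hs : 0 ≤ s) (hm : 0 < m) {x y : Space d} (hx : m ≤ ‖x‖)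
    (hy : m ≤ ‖y‖) : |riesz s x - riesz s y| ≤ s * m ^ (-(s + 1)) * ‖x - y‖ :=
  (abs_rpow_sub_rpow_le hs hm hx hy).trans
    (mul_le_mul_of_nonneg_left (abs_norm_sub_norm_le x y) (by positivity))

lemma riesz_nonneg (s : ℝ) (x : Space d) : 0 ≤ riesz s x := Real.rpow_nonneg (norm_nonneg x) _

@[simp] lemma riesz_neg (s : ℝ) (x : Space d) : riesz s (-x) = riesz s x := by
  simp only [riesz, norm_neg]

lemma measurable_riesz (s : ℝ) : Measurable (riesz s : Space d → ℝ) := by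
  unfold riesz
  fun_prop

/-! ### Lattice vectors -/

/-- The vector `k ∈ ℤ^d`, seen in `ℝ^d`. -/
def intVec (k : Fin d → ℤ) : Space d := WithLp.toLp 2 fun i => (k i : ℝ)

@[simp] lemma intVec_apply (k : Fin d → ℤ) (i : Fin d) : intVec k i = k i := rfl

lemma intVec_ne_zero {k : Fin d → ℤ} (hk : k ≠ 0) : intVec k ≠ 0 := fun h =>
  hk (funext fun i => by simpa using congrArg (fun v : Space d => v i) h)

lemma latticeVec_apply (n : ℕ) (k : Fin d → ℤ) (i : Fin d) :
    latticeVec d n k i = side d n * k i := rfl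

lemma norm_latticeVec (n : ℕ) (k : Fin d → ℤ) :
    ‖latticeVec d n k‖ = side d n * ‖intVec k‖ := by
  rw [latticeVec, norm_smul, Real.norm_of_nonneg (side_nonneg d n), intVec]

lemma latticeVec_add (n : ℕ) (k l : Fin d → ℤ) :
    latticeVec d n (k + l) = latticeVec d n k + latticeVec d n l := by
  ext i
  simp [latticeVec_apply, mul_add]

lemma latticeVec_neg (n : ℕ) (k : Fin d → ℤ) :
    latticeVec d n (-k) = -latticeVec d n k := by
  ext i
  simp [latticeVec_apply]

@[simp] lemma latticeVec_zero (n : ℕ) : latticeVec d n 0 = 0 := by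
  ext i
  simp [latticeVec_apply]

lemma summable_norm_intVec_rpow {r : ℝ} (hr : (d : ℝ) < r) :
    Summable fun k : Fin d → ℤ => ‖intVec k‖ ^ (-r) := by
  let b := (EuclideanSpace.basisFun (Fin d) ℝ).toBasis
  let L : Submodule ℤ (Space d) := Submodule.span ℤ (Set.range b)
  let e : (Fin d → ℤ) ≃ L := (b.restrictScalars ℤ).equivFun.symm.toEquiv
  have hrank : Module.finrank ℤ L = d := by
    rw [Module.finrank_eq_card_basis (b.restrictScalars ℤ), Fintype.card_fin]
  have he (k : Fin d → ℤ) : (e k : Space d) = intVec k := by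
    simp only [e, LinearEquiv.coe_toEquiv, Module.Basis.equivFun_symm_apply, Submodule.coe_sum,
      Submodule.coe_smul, Module.Basis.restrictScalars_apply]
    ext i
    simp [b, EuclideanSpace.basisFun_apply, Pi.single_apply]
  have hL := ZLattice.summable_norm_rpow L (-r) (by rw [hrank]; linarith)
  refine (e.summable_iff.2 hL).congr fun k => ?_
  simp [← he]

lemma tendsto_norm_intVec_cofinite (d : ℕ) :
    Tendsto (fun k : Fin d → ℤ => ‖intVec k‖) cofinite atTop := by
  refine tendsto_atTop.2 fun R => eventually_cofinite.2 ?_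
  refine (Set.Finite.pi' fun _ : Fin d => Set.finite_Icc (-⌈R⌉) ⌈R⌉).subset fun k hk i => ?_
  have hki : |(k i : ℝ)| ≤ ⌈R⌉ :=
    (abs_apply_le_norm (intVec k) i).trans ((not_le.1 hk).le.trans (Int.le_ceil R))
  rw [Set.mem_Icc, ← abs_le]
  exact_mod_cast hki

lemma half_norm_latticeVec_le {n : ℕ} {z : Space d} {k : Fin d → ℤ}
    (h : 2 * ‖z‖ ≤ side d n * ‖intVec k‖) :
    1 / 2 * side d n * ‖intVec k‖ ≤ ‖z + latticeVec d n k‖ := by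
  have hle := norm_sub_le_norm_add (latticeVec d n k) z
  rw [norm_latticeVec, add_comm] at hle
  linarith

lemma mul_norm_intVec_le_norm_add_latticeVec [NeZero d] {n : ℕ} {z : Space d}
    (hz : ∀ i, |z i| ≤ 3 / 4 * side d n) {k : Fin d → ℤ} (hk : k ≠ 0) :
    1 / (4 * Real.sqrt d) * side d n * ‖intVec k‖ ≤ ‖z + latticeVec d n k‖ := by
  have hd : 0 < Real.sqrt d := Real.sqrt_pos.2 (by exact_mod_cast NeZero.pos d)
  have hL := side_nonneg d n
  obtain ⟨i, hi⟩ := exists_norm_le_sqrt_mul_abs_apply (intVec k)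
  rw [intVec_apply] at hi
  have hki : (1 : ℝ) ≤ |(k i : ℝ)| := by
    have hki0 : k i ≠ 0 := by
      intro hzero
      rw [hzero, Int.cast_zero, abs_zero, mul_zero] at hi
      exact intVec_ne_zero hk (norm_le_zero_iff.1 hi)
    exact_mod_cast Int.one_le_abs hki0
  have hcoord : side d n * |(k i : ℝ)| - 3 / 4 * side d n ≤ ‖z + latticeVec d n k‖ := by
    calc side d n * |(k i : ℝ)| - 3 / 4 * side d n
        ≤ |side d n * (k i : ℝ)| - |z i| := by
          rw [abs_mul, abs_of_nonneg hL]
          linarith [hz i]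
      _ ≤ |side d n * (k i : ℝ) + z i| := by
          simpa using norm_sub_le_norm_add (side d n * (k i : ℝ)) (z i)
      _ = |(z + latticeVec d n k) i| := by rw [PiLp.add_apply, latticeVec_apply, add_comm]
      _ ≤ ‖z + latticeVec d n k‖ := abs_apply_le_norm _ i
  calc 1 / (4 * Real.sqrt d) * side d n * ‖intVec k‖
      ≤ 1 / (4 * Real.sqrt d) * side d n * (Real.sqrt d * |(k i : ℝ)|) :=
        mul_le_mul_of_nonneg_left hi (by positivity)
    _ = side d n * |(k i : ℝ)| / 4 := by field_simp
    _ ≤ ‖z + latticeVec d n k‖ := by nlinarith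

lemma abs_riesz_add_latticeVec_sub_le {s c : ℝ} (hs : 0 ≤ s) (hc : 0 < c) {n : ℕ} (hn : 1 ≤ n)
    {k : Fin d → ℤ} (hk : k ≠ 0) {z w : Space d}
    (hz : c * side d n * ‖intVec k‖ ≤ ‖z + latticeVec d n k‖)
    (hw : c * side d n * ‖intVec k‖ ≤ ‖w + latticeVec d n k‖) :
    |riesz s (z + latticeVec d n k) - riesz s (w + latticeVec d n k)|
      ≤ s * (c * side d n) ^ (-(s + 1)) * ‖z - w‖ * ‖intVec k‖ ^ (-(s + 1)) := by
  have hL := side_pos d hn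
  have hk0 : 0 < ‖intVec k‖ := norm_pos_iff.2 (intVec_ne_zero hk)
  refine (abs_riesz_sub_le hs (by positivity) hz hw).trans (le_of_eq ?_)
  rw [Real.mul_rpow (by positivity) hk0.le, add_sub_add_right_eq_sub]
  ring

/-! ### The periodized potential -/

/-- The average of the `k`-th translate of the Riesz potential over `Λ_n`, which is subtracted in
the periodization to make the series converge. -/
def rieszAverage (d : ℕ) (s : ℝ) (n : ℕ) (k : Fin d → ℤ) : ℝ :=
  (1 / (n : ℝ)) * ∫ y in box d n, riesz s (y + latticeVec d n k)

lemma rieszAverage_eq_setAverage [NeZero d] (s : ℝ) (n : ℕ) (k : Fin d → ℤ) :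
    rieszAverage d s n k = ⨍ y in box d n, riesz s (y + latticeVec d n k) := by
  rw [setAverage_eq, measureReal_def, volume_box, ENNReal.toReal_natCast, smul_eq_mul,
    rieszAverage, one_div]

lemma periodicRiesz_eq_tsum (s : ℝ) (n : ℕ) (x : Space d) : periodicRiesz s n x
    = ∑' k, (riesz s (x + latticeVec d n k) - rieszAverage d s n k) := rfl

lemma rieszAverage_neg (s : ℝ) (n : ℕ) (k : Fin d → ℤ) :
    rieszAverage d s n (-k) = rieszAverage d s n k := by
  have hbox : Neg.neg ⁻¹' box d n = box d n := by
    ext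
    simp [box]
  have hneg := (Measure.measurePreserving_neg
    (volume : Measure (Space d))).setIntegral_preimage_emb
    (MeasurableEquiv.neg (Space d)).measurableEmbedding
    (fun y => riesz s (y + latticeVec d n k)) (box d n)
  rw [rieszAverage, rieszAverage, ← hneg, hbox]
  simp only [latticeVec_neg, ← sub_eq_add_neg, neg_add_eq_sub,
    ← riesz_neg s (_ - latticeVec d n k), neg_sub]

lemma exists_abs_riesz_sub_average_le [NeZero d] {s : ℝ} (hs : 0 ≤ s) {n : ℕ} (hn : 1 ≤ n)
    (ρ : ℝ) : ∃ C : ℝ, ∀ᶠ k : Fin d → ℤ in cofinite, ∀ z : Space d, ‖z‖ ≤ ρ →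
      |riesz s (z + latticeVec d n k) - rieszAverage d s n k| ≤ C * ‖intVec k‖ ^ (-(s + 1)) := by
  have hL := side_pos d hn
  set R : ℝ := max ρ (Real.sqrt d * side d n)
  refine ⟨s * (1 / 2 * side d n) ^ (-(s + 1)) * (2 * R), ?_⟩
  filter_upwards [((tendsto_norm_intVec_cofinite d).const_mul_atTop hL).eventually_ge_atTop (2 * R),
    eventually_cofinite_ne 0] with k hk hk0 z hz
  have hlow {y : Space d} (hy : ‖y‖ ≤ R) :
      1 / 2 * side d n * ‖intVec k‖ ≤ ‖y + latticeVec d n k‖ :=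
    half_norm_latticeVec_le (by linarith)
  have hzR : ‖z‖ ≤ R := hz.trans (le_max_left _ _)
  set C := s * (1 / 2 * side d n) ^ (-(s + 1)) * (2 * R) * ‖intVec k‖ ^ (-(s + 1)) with hC
  have hdiff (y : Space d) (hy : y ∈ box d n) : riesz s (y + latticeVec d n k)
      ∈ Metric.closedBall (riesz s (z + latticeVec d n k)) C := by
    have hyR : ‖y‖ ≤ R := (norm_le_of_mem_box hy).trans (le_max_right _ _)
    rw [Metric.mem_closedBall, Real.dist_eq]
    refine (abs_riesz_add_latticeVec_sub_le hs one_half_pos hn hk0 (hlow hyR) (hlow hzR)).trans ?_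
    rw [hC]
    gcongr
    linarith [norm_sub_le y z]
  have hae : ∀ᵐ y ∂(volume.restrict (box d n)), riesz s (y + latticeVec d n k)
      ∈ Metric.closedBall (riesz s (z + latticeVec d n k)) C :=
    (ae_restrict_mem (measurableSet_box d n)).mono hdiff
  have hint : IntegrableOn (fun y => riesz s (y + latticeVec d n k)) (box d n) :=
    Measure.integrableOn_of_bounded (M := ‖riesz s (z + latticeVec d n k)‖ + C)
      (isBounded_box d n).measure_lt_top.ne
      ((measurable_riesz s).comp (measurable_add_const _)).aestronglyMeasurable
      (hae.mono fun y hy => norm_le_of_mem_closedBall hy)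
  have hmem := (convex_closedBall _ _).set_average_mem Metric.isClosed_closedBall
    (volume_box_ne_zero hn) (isBounded_box d n).measure_lt_top.ne hae hint
  rwa [← rieszAverage_eq_setAverage, Metric.mem_closedBall', Real.dist_eq] at hmem

section Periodization

variable [NeZero d] {s : ℝ} (hsd : (d : ℝ) < s + 1) {n : ℕ} (hn : 1 ≤ n)
include hsd hn

lemma summable_periodicRiesz (x : Space d) :
    Summable fun k => riesz s (x + latticeVec d n k) - rieszAverage d s n k := by
  obtain ⟨C, hC⟩ := exists_abs_riesz_sub_average_le (d := d) (pos_of_lt_add_one hsd).le hn ‖x‖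
  exact Summable.of_norm_bounded_eventually ((summable_norm_intVec_rpow hsd).mul_left C)
    (hC.mono fun k hk => hk x le_rfl)

lemma exists_le_periodicRiesz (ρ : ℝ) :
    ∃ K : ℝ, ∀ z : Space d, ‖z‖ ≤ ρ → K ≤ periodicRiesz s n z := by
  classical
  obtain ⟨C, hC⟩ := exists_abs_riesz_sub_average_le (d := d) (pos_of_lt_add_one hsd).le hn ρ
  let good (k : Fin d → ℤ) : Prop := ∀ z : Space d, ‖z‖ ≤ ρ →
    |riesz s (z + latticeVec d n k) - rieszAverage d s n k| ≤ C * ‖intVec k‖ ^ (-(s + 1))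
  let b (k : Fin d → ℤ) : ℝ :=
    if good k then -(C * ‖intVec k‖ ^ (-(s + 1))) else -rieszAverage d s n k
  have hb : Summable b := by
    refine Summable.of_norm_bounded_eventually
      ((summable_norm_intVec_rpow hsd).mul_left |C|) (hC.mono fun k (hk : good k) => ?_)
    simp only [b, if_pos hk, norm_neg, norm_mul, Real.norm_eq_abs, Real.abs_rpow_of_nonneg,
      norm_nonneg, abs_norm, le_refl]
  refine ⟨∑' k, b k, fun z hz => ?_⟩
  rw [periodicRiesz_eq_tsum]
  refine hb.tsum_le_tsum (fun k => ?_) (summable_periodicRiesz hsd hn z)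
  by_cases hk : good k
  · simpa only [b, if_pos hk] using (abs_le.1 (hk z hz)).1
  · simpa only [b, if_neg hk, sub_eq_add_neg, le_add_iff_nonneg_left]
      using riesz_nonneg s (z + latticeVec d n k)

end Periodization

lemma measurable_periodicRiesz (s : ℝ) (n : ℕ) :
    Measurable (periodicRiesz s n : Space d → ℝ) :=
  Measurable.tsum fun _ => ((measurable_riesz s).comp (measurable_add_const _)).sub measurable_const

lemma periodicRiesz_neg (s : ℝ) (n : ℕ) (x : Space d) :
    periodicRiesz s n (-x) = periodicRiesz s n x := by
  rw [periodicRiesz_eq_tsum, periodicRiesz_eq_tsum, ← (Equiv.neg (Fin d → ℤ)).tsum_eq]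
  refine tsum_congr fun k => ?_
  rw [Equiv.neg_apply, rieszAverage_neg, latticeVec_neg, ← neg_add, riesz_neg]

lemma periodicRiesz_add_latticeVec [NeZero d] {s : ℝ} (hsd : (d : ℝ) < s + 1) {n : ℕ}
    (hn : 1 ≤ n) (e : Fin d → ℤ) (x : Space d) :
    periodicRiesz s n (x + latticeVec d n e) = periodicRiesz s n x := by
  -- The difference does not depend on `x`, and vanishes at `x = -e / 2` since `g_n` is even.
  have hdiff (x : Space d) : periodicRiesz s n (x + latticeVec d n e) - periodicRiesz s n x
      = ∑' k, (rieszAverage d s n (k + e) - rieszAverage d s n k) := by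
    have hshift : Summable fun k => riesz s (x + latticeVec d n (k + e))
        - rieszAverage d s n (k + e) :=
      (summable_periodicRiesz hsd hn x).comp_injective (add_left_injective e)
    rw [periodicRiesz_eq_tsum s n x, ← (Equiv.addRight e).tsum_eq
        fun k => riesz s (x + latticeVec d n k) - rieszAverage d s n k, periodicRiesz_eq_tsum]
    simp only [Equiv.coe_addRight]
    rw [← (summable_periodicRiesz hsd hn _).tsum_sub hshift]
    refine tsum_congr fun k => ?_
    rw [latticeVec_add, add_assoc x, add_comm (latticeVec d n e)]
    ring
  have hhalf : -((1 / 2 : ℝ) • latticeVec d n e) + latticeVec d n e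
      = (1 / 2 : ℝ) • latticeVec d n e := by
    module
  have hzero := hdiff (-((1 / 2 : ℝ) • latticeVec d n e))
  rw [hhalf, periodicRiesz_neg, sub_self] at hzero
  rw [← sub_eq_zero, hdiff, ← hzero]

lemma periodicRiesz_remainder_sub_eq_tsum [NeZero d] {s : ℝ} (hsd : (d : ℝ) < s + 1) {n : ℕ}
    (hn : 1 ≤ n) (z w : Space d) :
    (periodicRiesz s n z - riesz s z) - (periodicRiesz s n w - riesz s w)
      = ∑' k, if k = 0 then 0 else
          riesz s (z + latticeVec d n k) - riesz s (w + latticeVec d n k) := by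
  have hz := summable_periodicRiesz hsd hn z
  have hw := summable_periodicRiesz hsd hn w
  have hterm (k : Fin d → ℤ) : riesz s (z + latticeVec d n k) - rieszAverage d s n k
      - (riesz s (w + latticeVec d n k) - rieszAverage d s n k)
      = riesz s (z + latticeVec d n k) - riesz s (w + latticeVec d n k) := by ring
  have hsplit := (hz.sub hw).tsum_eq_add_tsum_ite 0
  rw [hz.tsum_sub hw] at hsplit
  simp only [hterm, latticeVec_zero, add_zero] at hsplit
  rw [periodicRiesz_eq_tsum, periodicRiesz_eq_tsum]
  linarith

lemma exists_lipschitz_periodicRiesz_sub_riesz [NeZero d] {s : ℝ} (hsd : (d : ℝ) < s + 1) :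
    ∃ K : ℝ, 0 ≤ K ∧ ∀ n : ℕ, 1 ≤ n → ∀ z w : Space d, (∀ i, |z i| ≤ 3 / 4 * side d n) →
      (∀ i, |w i| ≤ 3 / 4 * side d n) →
      |(periodicRiesz s n z - riesz s z) - (periodicRiesz s n w - riesz s w)|
        ≤ K * side d n ^ (-(s + 1)) * ‖z - w‖ := by
  have hs := (pos_of_lt_add_one hsd).le
  have hd : 0 < Real.sqrt d := Real.sqrt_pos.2 (by exact_mod_cast NeZero.pos d)
  set c : ℝ := 1 / (4 * Real.sqrt d)
  have hc : 0 < c := by positivity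
  refine ⟨s * c ^ (-(s + 1)) * ∑' k : Fin d → ℤ, ‖intVec k‖ ^ (-(s + 1)),
    mul_nonneg (by positivity) (tsum_nonneg fun k => by positivity), fun n hn z w hz hw => ?_⟩
  have hL := side_pos d hn
  have hbound (k : Fin d → ℤ) :
      ‖if k = 0 then 0 else riesz s (z + latticeVec d n k) - riesz s (w + latticeVec d n k)‖
        ≤ s * (c * side d n) ^ (-(s + 1)) * ‖z - w‖ * ‖intVec k‖ ^ (-(s + 1)) := by
    split_ifs with hk
    · rw [norm_zero]
      positivity
    · exact abs_riesz_add_latticeVec_sub_le hs hc hn hk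
        (mul_norm_intVec_le_norm_add_latticeVec hz hk)
        (mul_norm_intVec_le_norm_add_latticeVec hw hk)
  have htsum := tsum_of_norm_bounded ((summable_norm_intVec_rpow hsd).mul_left _).hasSum hbound
  rw [periodicRiesz_remainder_sub_eq_tsum hsd hn]
  refine htsum.trans (le_of_eq ?_)
  rw [tsum_mul_left, Real.mul_rpow hc.le hL.le]
  ring

/-! ### Translations on the torus -/

/-- The representative of `t - L / 2` modulo `L` in `[-L / 2, L / 2)`. As the half-turn `L / 2` is
absorbed by the translation, only the invariance of Lebesgue measure under `t ↦ wrap L (t + v)`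
matters. -/
def wrap (L t : ℝ) : ℝ := L * Int.fract (t / L) - L / 2

lemma measurable_wrap (L : ℝ) : Measurable (wrap L) :=
  ((measurable_fract.comp (measurable_id.div_const L)).const_mul L).sub_const _

lemma wrap_eq_sub_floor {L : ℝ} (hL : 0 < L) (t : ℝ) : wrap L t = t - L / 2 - L * ⌊t / L⌋ := by
  rw [wrap, ← Int.self_sub_floor]
  field_simp
  ring

lemma wrap_add_intCast_mul {L : ℝ} (hL : 0 < L) (t : ℝ) (k : ℤ) :
    wrap L (t + k * L) = wrap L t := by
  rw [wrap, wrap, add_div, mul_div_assoc, div_self hL.ne', mul_one, Int.fract_add_intCast]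

lemma wrap_of_mem_Ico {L t : ℝ} (hL : 0 < L) (ht : t ∈ Set.Ico 0 L) : wrap L t = t - L / 2 := by
  have hfloor : ⌊t / L⌋ = 0 := by
    rw [Int.floor_eq_zero_iff, Set.mem_Ico, le_div_iff₀ hL, div_lt_iff₀ hL, zero_mul, one_mul]
    exact ht
  rw [wrap_eq_sub_floor hL, hfloor, Int.cast_zero, mul_zero, sub_zero]

lemma volume_preimage_wrap_add_inter_Ico {L : ℝ} (hL : 0 < L) (v : ℝ) (B : Set ℝ) :
    volume ((fun t => wrap L (t + v)) ⁻¹' B ∩ Set.Ico (-v) (-v + L))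
      = volume (B ∩ Set.Icc (-(L / 2)) (L / 2)) := by
  have htranslate : (fun t => wrap L (t + v)) ⁻¹' B ∩ Set.Ico (-v) (-v + L)
      = (fun t => t + (v - L / 2)) ⁻¹' (B ∩ Set.Ico (-(L / 2)) (L / 2)) := by
    ext t
    have hiff : t ∈ Set.Ico (-v) (-v + L)
        ↔ t + (v - L / 2) ∈ Set.Ico (-(L / 2)) (L / 2) := by
      constructor <;> rintro ⟨h, h'⟩ <;> constructor <;> linarith
    rw [Set.preimage_inter, Set.mem_inter_iff, Set.mem_inter_iff,
      Set.mem_preimage (s := Set.Ico _ _), ← hiff]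
    refine and_congr_left fun ht => ?_
    rw [Set.mem_preimage, Set.mem_preimage, add_sub_assoc',
      wrap_of_mem_Ico hL ⟨by linarith [ht.1], by linarith [ht.2]⟩]
  rw [htranslate, measure_preimage_add_right]
  exact measure_congr ((ae_eq_refl B).inter Ico_ae_eq_Icc)

lemma measurePreserving_wrap_add {L : ℝ} (hL : 0 < L) (v : ℝ) :
    MeasurePreserving (fun t => wrap L (t + v)) (volume.restrict (Set.Icc (-(L / 2)) (L / 2)))
      (volume.restrict (Set.Icc (-(L / 2)) (L / 2))) := by
  have hm : Measurable fun t => wrap L (t + v) := (measurable_wrap L).comp (measurable_add_const v)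
  refine ⟨hm, ?_⟩
  ext B hB
  rw [Measure.map_apply hm hB, Measure.restrict_apply (hm hB), Measure.restrict_apply hB]
  set A := (fun t => wrap L (t + v)) ⁻¹' B
  have hperiodic (g : AddSubgroup.zmultiples L) : (fun t => g +ᵥ t) ⁻¹' A = A := by
    obtain ⟨_, k, rfl⟩ := g
    ext t
    have hshift : k • L + t + v = t + v + k * L := by rw [zsmul_eq_mul]; ring
    simp only [A, Set.mem_preimage, AddSubgroup.vadd_def, vadd_eq_add, hshift,
      wrap_add_intCast_mul hL]
  calc volume (A ∩ Set.Icc (-(L / 2)) (L / 2))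
      = volume (A ∩ Set.Ioc (-(L / 2)) (-(L / 2) + L)) := by
        rw [neg_add_eq_sub, sub_half]
        exact measure_congr ((ae_eq_refl A).inter Ioc_ae_eq_Icc.symm)
    _ = volume (A ∩ Set.Ioc (-v) (-v + L)) :=
        (isAddFundamentalDomain_Ioc hL _).measure_set_eq (isAddFundamentalDomain_Ioc hL _)
          (hm hB) hperiodic
    _ = volume (A ∩ Set.Ico (-v) (-v + L)) :=
        measure_congr ((ae_eq_refl A).inter Ico_ae_eq_Ioc.symm)
    _ = volume (B ∩ Set.Icc (-(L / 2)) (L / 2)) := volume_preimage_wrap_add_inter_Ico hL v B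

/-- Translation on the torus of side `n^{1/d}`, with fundamental domain `Λ_n`: it agrees modulo the
lattice with `x ↦ x + v` followed by the half-turn built into `wrap`. -/
def torusShift (d n : ℕ) (v x : Space d) : Space d :=
  WithLp.toLp 2 fun i => wrap (side d n) (x i + v i)

lemma torusShift_comm (n : ℕ) (v x : Space d) : torusShift d n v x = torusShift d n x v := by
  simp [torusShift, add_comm]

lemma measurable_torusShift (n : ℕ) :
    Measurable fun p : Space d × Space d => torusShift d n p.1 p.2 := by
  refine (MeasurableEquiv.toLp 2 (Fin d → ℝ)).measurable.comp (measurable_pi_lambda _ fun i => ?_)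
  exact (measurable_wrap _).comp (by fun_prop)

lemma measurePreserving_ofLp_box (d n : ℕ) :
    MeasurePreserving (WithLp.ofLp : Space d → Fin d → ℝ) (volume.restrict (box d n))
      (Measure.pi fun _ => volume.restrict (Set.Icc (-(side d n / 2)) (side d n / 2))) := by
  have h := (PiLp.volume_preserving_ofLp (Fin d)).restrict_preimage
    (MeasurableSet.univ_pi fun _ => measurableSet_Icc (a := -(side d n / 2)) (b := side d n / 2))
  rwa [← box_eq_preimage, volume_pi, Measure.restrict_pi_pi] at h

lemma measurePreserving_torusShift_restrict {n : ℕ} (hn : 1 ≤ n) (v : Space d) :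
    MeasurePreserving (torusShift d n v) (volume.restrict (box d n))
      (volume.restrict (box d n)) := by
  have hofLp := measurePreserving_ofLp_box d n
  have hwrap := measurePreserving_pi (ι := Fin d)
    (fun _ => volume.restrict (Set.Icc (-(side d n / 2)) (side d n / 2)))
    (fun _ => volume.restrict (Set.Icc (-(side d n / 2)) (side d n / 2)))
    fun i => measurePreserving_wrap_add (side_pos d hn) (v i)
  exact (hofLp.symm (MeasurableEquiv.toLp 2 (Fin d → ℝ)).symm).comp (hwrap.comp hofLp)

lemma measurePreserving_torusShift {n : ℕ} (hn : 1 ≤ n) (v : Space d) :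
    MeasurePreserving (torusShift d n v) (cond volume (box d n)) (cond volume (box d n)) :=
  (measurePreserving_torusShift_restrict hn v).smul_measure _

lemma exists_torusShift_sub_eq {n : ℕ} (hn : 1 ≤ n) (v x y : Space d) :
    ∃ k, torusShift d n v x - torusShift d n v y = x - y + latticeVec d n k := by
  refine ⟨fun i => ⌊(y i + v i) / side d n⌋ - ⌊(x i + v i) / side d n⌋, ?_⟩
  ext i
  simp only [torusShift, latticeVec, PiLp.sub_apply, PiLp.add_apply, PiLp.smul_apply, smul_eq_mul,
    wrap_eq_sub_floor (side_pos d hn)]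
  push_cast
  ring

/-! ### The Gibbs measure on the torus -/

lemma pairEnergy_ofPoints {N : ℕ} {x : Fin N → Space d} (hx : Function.Injective x)
    (φ : Space d → ℝ) :
    pairEnergy φ (ofPoints x) = (1 / 2) * ∑ i, ∑ j, if i = j then 0 else φ (x i - x j) := by
  classical
  have hoffDiag : (ofPoints x).carrier.offDiag
      = (((Finset.univ.image x) ×ˢ (Finset.univ.image x)).filter fun p => p.1 ≠ p.2 :
          Finset (Space d × Space d)) := by
    ext p
    simp [ofPoints, and_assoc]
  rw [pairEnergy, hoffDiag, finsum_mem_coe_finset, Finset.sum_filter, Finset.sum_product,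
    Finset.sum_image hx.injOn]
  congr 1
  refine Finset.sum_congr rfl fun i _ => ?_
  rw [Finset.sum_image hx.injOn]
  refine Finset.sum_congr rfl fun j _ => ?_
  by_cases hij : i = j
  · simp [hij]
  · simp [hij, hx.eq_iff]

lemma lintegral_pointMeasure_ofPoints {N : ℕ} {x : Fin N → Space d}
    (hx : Function.Injective x) (φ : Space d → ENNReal) :
    ∫⁻ y, φ y ∂(pointMeasure (ofPoints x)) = ∑ i, φ (x i) := by
  classical
  have hcarrier : (ofPoints x).carrier = (Finset.univ.image x : Finset (Space d)) := by
    simp [ofPoints]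
  rw [pointMeasure, hcarrier, lintegral_finset, Finset.sum_image hx.injOn]
  simp

/-- The Boltzmann weight `e^{-β H_n}` as a function of an `n`-tuple of points, with the pair sum
running over indices. -/
def coordWeight (s β : ℝ) (n : ℕ) (x : Fin n → Space d) : ℝ :=
  Real.exp (-β * ((1 / 2) * ∑ i, ∑ j, if i = j then 0 else periodicRiesz s n (x i - x j)))

lemma coordWeight_pos (s β : ℝ) (n : ℕ) (x : Fin n → Space d) : 0 < coordWeight s β n x :=
  Real.exp_pos _

lemma measurable_coordWeight (s β : ℝ) (n : ℕ) :
    Measurable (coordWeight s β n : (Fin n → Space d) → ℝ) := by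
  refine Real.measurable_exp.comp (Measurable.const_mul (Measurable.const_mul ?_ _) _)
  refine Finset.measurable_sum _ fun i _ => Finset.measurable_sum _ fun j _ => ?_
  by_cases hij : i = j
  · simp [hij]
  · simp only [if_neg hij]
    exact (measurable_periodicRiesz s n).comp
      ((measurable_pi_apply i).sub (measurable_pi_apply j))

lemma measurable_ofReal_coordWeight_mul (s β : ℝ) {n : ℕ} {G : (Fin n → Space d) → ENNReal}
    (hG : Measurable G) : Measurable fun x => ENNReal.ofReal (coordWeight s β n x) * G x :=
  (measurable_coordWeight s β n).ennreal_ofReal.mul hG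

lemma coordWeight_torusShift [NeZero d] {s : ℝ} (hsd : (d : ℝ) < s + 1) (β : ℝ)
    {n : ℕ} (hn : 1 ≤ n) (v : Space d) (x : Fin n → Space d) :
    coordWeight s β n (fun i => torusShift d n v (x i)) = coordWeight s β n x := by
  have hpair (i j : Fin n) : periodicRiesz s n (torusShift d n v (x i) - torusShift d n v (x j))
      = periodicRiesz s n (x i - x j) := by
    obtain ⟨k, hk⟩ := exists_torusShift_sub_eq hn v (x i) (x j)
    rw [hk, periodicRiesz_add_latticeVec hsd hn]
  simp only [coordWeight, hpair]

lemma exists_coordWeight_le [NeZero d] {s : ℝ} (hsd : (d : ℝ) < s + 1) {β : ℝ}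
    (hβ : 0 ≤ β) {n : ℕ} (hn : 1 ≤ n) : ∃ C, ∀ x : Fin n → Space d, (∀ i, x i ∈ box d n) →
      coordWeight s β n x ≤ C := by
  obtain ⟨K, hK⟩ := exists_le_periodicRiesz (d := d) hsd hn (2 * (Real.sqrt d * side d n))
  refine ⟨Real.exp (-β * ((1 / 2) * ∑ i : Fin n, ∑ j : Fin n, if i = j then 0 else K)),
    fun x hx => Real.exp_le_exp.2 ?_⟩
  refine mul_le_mul_of_nonpos_left (mul_le_mul_of_nonneg_left ?_ (by norm_num)) (by linarith)
  refine Finset.sum_le_sum fun i _ => Finset.sum_le_sum fun j _ => ?_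
  split_ifs
  · rfl
  · refine hK _ ((norm_sub_le _ _).trans ?_)
    linarith [norm_le_of_mem_box (hx i), norm_le_of_mem_box (hx j)]

/-- The exponent `-β H_n(γ_{Λ_n})` of the Gibbs density. Restricting to `Λ_n` changes nothing
almost surely under `binomialProcess (box d n) n`, and makes the exponent measurable. -/
def torusPotential (s β : ℝ) (n : ℕ) (γ : Configuration d) : ℝ :=
  -β * periodicEnergy s n (γ.restrict (box d n))

lemma measurable_torusPotential [NeZero d] (s β : ℝ) (n : ℕ) :
    Measurable (torusPotential s β n : Configuration d → ℝ) :=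
  (measurable_pairEnergy_restrict (measurable_periodicRiesz s n) (measurableSet_box d n)
    (isBounded_box d n)).const_mul _

theorem torusGibbs_eq_tilted (s β : ℝ) (n : ℕ) :
    torusGibbs d s β n = (binomialProcess (box d n) n).tilted (torusPotential s β n) := by
  have hae : (fun γ => -β * periodicEnergy s n γ)
      =ᵐ[binomialProcess (box d n) n] torusPotential s β n := by
    filter_upwards [ae_binomialProcess_subset (measurableSet_box d n) n] with γ hγ
    rw [torusPotential, restrict_of_subset hγ]
  rw [← tilted_congr hae, Measure.tilted]
  simp only [torusGibbs, torusPartition, one_div_mul_eq_div]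

/-- The law of `n` independent uniform points in `Λ_n`, of which the binomial process in `Λ_n` is
the image. -/
abbrev uniformPoints (d n : ℕ) : Measure (Fin n → Space d) :=
  Measure.pi fun _ => cond (volume : Measure (Space d)) (box d n)

section Torus

variable [NeZero d] {s β : ℝ} {n : ℕ}

lemma isProbabilityMeasure_cond_box (hn : 1 ≤ n) :
    IsProbabilityMeasure (cond (volume : Measure (Space d)) (box d n)) :=
  cond_isProbabilityMeasure_of_finite (volume_box_ne_zero hn) (isBounded_box d n).measure_lt_top.ne

lemma ae_exp_torusPotential_ofPoints (hn : 1 ≤ n) (s β : ℝ) :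
    ∀ᵐ x ∂(uniformPoints d n),
      Real.exp (torusPotential s β n (ofPoints x)) = coordWeight s β n x := by
  filter_upwards [ae_injective_cond (volume_box_ne_zero hn) (isBounded_box d n) n,
    ae_pi_forall (ae_cond_mem (measurableSet_box d n))] with x hx hmem
  have hsub : (ofPoints x).carrier ⊆ box d n := Set.range_subset_iff.2 hmem
  rw [torusPotential, restrict_of_subset hsub, periodicEnergy, pairEnergy_ofPoints hx, coordWeight]

lemma integrable_exp_torusPotential (hsd : (d : ℝ) < s + 1) (hβ : 0 ≤ β) (hn : 1 ≤ n) :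
    Integrable (fun γ => Real.exp (torusPotential s β n γ)) (binomialProcess (box d n) n) := by
  have := isProbabilityMeasure_cond_box (d := d) hn
  obtain ⟨C, hC⟩ := exists_coordWeight_le (d := d) hsd hβ hn
  have hmeas := (measurable_torusPotential (d := d) s β n).exp
  rw [binomialProcess, integrable_map_measure hmeas.aestronglyMeasurable
    measurable_ofPoints.aemeasurable]
  refine Integrable.of_bound (hmeas.comp measurable_ofPoints).aestronglyMeasurable C ?_
  filter_upwards [ae_exp_torusPotential_ofPoints hn s β,
    ae_pi_forall (ae_cond_mem (measurableSet_box d n))] with x hx hmem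
  rw [Function.comp_apply, hx, Real.norm_of_nonneg (coordWeight_pos s β n x).le]
  exact hC x hmem

lemma isProbabilityMeasure_torusGibbs (hsd : (d : ℝ) < s + 1) (hβ : 0 ≤ β) (hn : 1 ≤ n) :
    IsProbabilityMeasure (torusGibbs d s β n) := by
  have := isProbabilityMeasure_binomialProcess (volume_box_ne_zero (d := d) hn)
    (isBounded_box d n) n
  rw [torusGibbs_eq_tilted]
  exact isProbabilityMeasure_tilted (integrable_exp_torusPotential hsd hβ hn)

lemma lintegral_tilted_eq_mul {Ω : Type*} [MeasurableSpace Ω] {ν : Measure Ω} {V : Ω → ℝ}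
    (hV : Measurable V) {G : Ω → ENNReal} (hG : Measurable G) :
    ∫⁻ ω, G ω ∂(ν.tilted V) = ENNReal.ofReal (∫ ω, Real.exp (V ω) ∂ν)⁻¹
      * ∫⁻ ω, ENNReal.ofReal (Real.exp (V ω)) * G ω ∂ν := by
  have hZ : 0 ≤ (∫ ω, Real.exp (V ω) ∂ν)⁻¹ :=
    inv_nonneg.2 (integral_nonneg fun ω => (Real.exp_pos _).le)
  rw [lintegral_tilted, ← lintegral_const_mul _ (hV.exp.ennreal_ofReal.fun_mul hG)]
  simp only [div_eq_inv_mul, ENNReal.ofReal_mul hZ, mul_assoc]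

lemma lintegral_torusGibbs (hn : 1 ≤ n) (s β : ℝ) {G : Configuration d → ENNReal}
    (hG : Measurable G) :
    ∫⁻ γ, G γ ∂(torusGibbs d s β n)
      = ENNReal.ofReal (∫ γ, Real.exp (torusPotential s β n γ) ∂(binomialProcess (box d n) n))⁻¹
        * ∫⁻ x, ENNReal.ofReal (coordWeight s β n x) * G (ofPoints x) ∂(uniformPoints d n) := by
  have hV := measurable_torusPotential (d := d) s β n
  rw [torusGibbs_eq_tilted, lintegral_tilted_eq_mul hV hG]
  congr 1
  refine (lintegral_map (hV.exp.ennreal_ofReal.mul hG) measurable_ofPoints).trans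
    (lintegral_congr_ae ?_)
  filter_upwards [ae_exp_torusPotential_ofPoints hn s β] with x hx
  rw [Pi.mul_apply, hx]

/-! ### Intensity of the Gibbs measure on the torus -/

lemma lintegral_coordWeight_mul_torusShift (hsd : (d : ℝ) < s + 1) (hn : 1 ≤ n)
    (i : Fin n) {φ : Space d → ENNReal} (hφ : Measurable φ) (v : Space d) :
    ∫⁻ x, ENNReal.ofReal (coordWeight s β n x) * φ (torusShift d n v (x i)) ∂(uniformPoints d n)
      = ∫⁻ x, ENNReal.ofReal (coordWeight s β n x) * φ (x i) ∂(uniformPoints d n) := by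
  have := isProbabilityMeasure_cond_box (d := d) hn
  have hshift := measurePreserving_pi (ι := Fin n) (fun _ => cond volume (box d n))
    (fun _ => cond volume (box d n)) (f := fun _ => torusShift d n v)
    fun _ => measurePreserving_torusShift hn v
  rw [← hshift.lintegral_comp
    (measurable_ofReal_coordWeight_mul s β (hφ.fun_comp (measurable_pi_apply i)))]
  simp only [coordWeight_torusShift hsd β hn v]

/-- Averaging over all translations of the torus makes the law of each point uniform. -/
lemma lintegral_coordWeight_mul (hsd : (d : ℝ) < s + 1) (hn : 1 ≤ n)
    (i : Fin n) {φ : Space d → ENNReal} (hφ : Measurable φ) :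
    ∫⁻ x, ENNReal.ofReal (coordWeight s β n x) * φ (x i) ∂(uniformPoints d n)
      = (∫⁻ x, ENNReal.ofReal (coordWeight s β n x) ∂(uniformPoints d n))
        * ∫⁻ y, φ y ∂(cond (volume : Measure (Space d)) (box d n)) := by
  have := isProbabilityMeasure_cond_box (d := d) hn
  set μ := cond (volume : Measure (Space d)) (box d n)
  have hweight : Measurable fun x : Fin n → Space d => ENNReal.ofReal (coordWeight s β n x) :=
    (measurable_coordWeight s β n).ennreal_ofReal
  have hjoint : Measurable (Function.uncurry fun (v : Space d) (x : Fin n → Space d) =>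
      ENNReal.ofReal (coordWeight s β n x) * φ (torusShift d n v (x i))) :=
    (hweight.comp measurable_snd).mul (hφ.comp ((measurable_torusShift n).comp
      (measurable_fst.prodMk ((measurable_pi_apply i).comp measurable_snd))))
  have hinner (x : Fin n → Space d) :
      ∫⁻ v, ENNReal.ofReal (coordWeight s β n x) * φ (torusShift d n v (x i)) ∂μ
        = ENNReal.ofReal (coordWeight s β n x) * ∫⁻ y, φ y ∂μ := by
    simp only [torusShift_comm n _ (x i)]
    have hshift := measurePreserving_torusShift hn (x i)
    rw [lintegral_const_mul _ (hφ.fun_comp hshift.measurable), hshift.lintegral_comp hφ]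
  calc ∫⁻ x, ENNReal.ofReal (coordWeight s β n x) * φ (x i) ∂(uniformPoints d n)
      = ∫⁻ _v, (∫⁻ x, ENNReal.ofReal (coordWeight s β n x) * φ (x i) ∂(uniformPoints d n)) ∂μ := by
        rw [lintegral_const, measure_univ, mul_one]
    _ = ∫⁻ v, ∫⁻ x, ENNReal.ofReal (coordWeight s β n x) * φ (torusShift d n v (x i))
          ∂(uniformPoints d n) ∂μ :=
        lintegral_congr fun v => (lintegral_coordWeight_mul_torusShift hsd hn i hφ v).symm
    _ = ∫⁻ x, ∫⁻ v, ENNReal.ofReal (coordWeight s β n x) * φ (torusShift d n v (x i)) ∂μ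
          ∂(uniformPoints d n) := lintegral_lintegral_swap hjoint.aemeasurable
    _ = ∫⁻ x, ENNReal.ofReal (coordWeight s β n x) * ∫⁻ y, φ y ∂μ ∂(uniformPoints d n) :=
        lintegral_congr hinner
    _ = _ := lintegral_mul_const _ hweight

lemma lintegral_coordWeight_mul_pointMeasure (hsd : (d : ℝ) < s + 1) (hn : 1 ≤ n)
    {φ : Space d → ENNReal} (hφ : Measurable φ) :
    ∫⁻ x, ENNReal.ofReal (coordWeight s β n x) *
        ∫⁻ y, φ y ∂(pointMeasure (ofPoints x)) ∂(uniformPoints d n)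
      = (∫⁻ x, ENNReal.ofReal (coordWeight s β n x) ∂(uniformPoints d n))
        * ∫⁻ y in box d n, φ y := by
  have hsum : ∫⁻ x, ENNReal.ofReal (coordWeight s β n x) *
        ∫⁻ y, φ y ∂(pointMeasure (ofPoints x)) ∂(uniformPoints d n)
      = ∑ i, ∫⁻ x, ENNReal.ofReal (coordWeight s β n x) * φ (x i) ∂(uniformPoints d n) := by
    rw [← lintegral_finsetSum _ fun i _ =>
      measurable_ofReal_coordWeight_mul s β (hφ.fun_comp (measurable_pi_apply i))]
    refine lintegral_congr_ae ?_
    filter_upwards [ae_injective_cond (volume_box_ne_zero hn) (isBounded_box d n) n] with x hx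
    rw [lintegral_pointMeasure_ofPoints hx, Finset.mul_sum]
  have hn0 : (n : ENNReal) ≠ 0 := by exact_mod_cast (by omega : n ≠ 0)
  rw [hsum, Finset.sum_congr rfl fun i _ => lintegral_coordWeight_mul hsd hn i hφ,
    Finset.sum_const, Finset.card_univ, Fintype.card_fin, nsmul_eq_mul, mul_left_comm,
    ProbabilityTheory.cond, lintegral_smul_measure, volume_box, smul_eq_mul,
    ← mul_assoc (n : ENNReal), ENNReal.mul_inv_cancel hn0 (ENNReal.natCast_ne_top n), one_mul]

theorem lintegral_pointMeasure_torusGibbs (hsd : (d : ℝ) < s + 1) (hβ : 0 ≤ β) (hn : 1 ≤ n)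
    {φ : Space d → ENNReal} (hφ : Measurable φ) :
    ∫⁻ γ, ∫⁻ y, φ y ∂(pointMeasure γ) ∂(torusGibbs d s β n) = ∫⁻ y in box d n, φ y := by
  have := isProbabilityMeasure_torusGibbs (d := d) hsd hβ hn
  have hnormalized := lintegral_torusGibbs (d := d) hn s β (G := fun _ => 1) measurable_const
  simp only [lintegral_const, measure_univ, mul_one] at hnormalized
  have hmeas : Measurable fun γ : Configuration d => ∫⁻ y, φ y ∂(pointMeasure γ) :=
    hφ.lintegral_kernel (κ := pointKernel)
  rw [lintegral_torusGibbs hn s β hmeas, lintegral_coordWeight_mul_pointMeasure hsd hn hφ,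
    ← mul_assoc, ← hnormalized, one_mul]

end Torus

/-! ### Tails of configurations -/

/-- The weight `(1 + |y|)^{-(s+1)}`, which dominates the decay of `g(x - y) - g(y)` and is
integrable on `ℝ^d` as soon as `d < s + 1`. -/
def tailWeight (s : ℝ) (y : Space d) : ℝ := (1 + ‖y‖) ^ (-(s + 1))

lemma tailWeight_nonneg (s : ℝ) (y : Space d) : 0 ≤ tailWeight s y :=
  Real.rpow_nonneg (by positivity) _

lemma measurable_tailWeight (s : ℝ) : Measurable (tailWeight s : Space d → ℝ) := by
  unfold tailWeight
  fun_prop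

/-- The tail `∑_{y ∈ γ ∖ Λ_p} (1 + |y|)^{-(s+1)}` of a configuration, which bounds the interaction
of a bounded set with the points outside `Λ_p`. -/
def tail (s : ℝ) (p : ℕ) (γ : Configuration d) : ENNReal :=
  ∫⁻ y in (box d p)ᶜ, ENNReal.ofReal (tailWeight s y) ∂(pointMeasure γ)

/-- The value `∫_{ℝ^d ∖ Λ_p} (1 + |y|)^{-(s+1)} dy` of the mean tail under intensity one. -/
def meanTail (d : ℕ) (s : ℝ) (p : ℕ) : ENNReal :=
  ∫⁻ y in (box d p)ᶜ, ENNReal.ofReal (tailWeight s (y : Space d))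

lemma measurable_tail (s : ℝ) (p : ℕ) : Measurable (tail s p : Configuration d → ENNReal) :=
  (measurable_tailWeight s).ennreal_ofReal.setLIntegral_kernel (κ := pointKernel)
    (measurableSet_box d p).compl

lemma iInter_box_compl [NeZero d] : ⋂ p, (box d p)ᶜ = ∅ := by
  refine Set.eq_empty_of_forall_notMem fun x hx => ?_
  obtain ⟨p, hp⟩ := ((tendsto_side d).eventually_ge_atTop (2 * ‖x‖)).exists
  exact Set.mem_iInter.1 hx p (closedBall_subset_box (r := ‖x‖) (by linarith) (by simp))

lemma tendsto_setLIntegral_box_compl [NeZero d] {μ : Measure (Space d)} {f : Space d → ENNReal}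
    {q : ℕ} (hf : ∫⁻ y in (box d q)ᶜ, f y ∂μ ≠ ⊤) :
    Tendsto (fun p => ∫⁻ y in (box d p)ᶜ, f y ∂μ) atTop (𝓝 0) := by
  have hlim := tendsto_measure_iInter_atTop (μ := μ.withDensity f) (s := fun p => (box d p)ᶜ)
    (fun p => (measurableSet_box d p).compl.nullMeasurableSet)
    (fun p q hpq => Set.compl_subset_compl.2 (box_mono hpq))
    ⟨q, by rwa [withDensity_apply _ (measurableSet_box d q).compl]⟩
  rw [iInter_box_compl, measure_empty] at hlim
  refine hlim.congr fun p => ?_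
  rw [Function.comp_apply, withDensity_apply _ (measurableSet_box d p).compl]

lemma meanTail_ne_top {s : ℝ} (hsd : (d : ℝ) < s + 1) (p : ℕ) : meanTail d s p ≠ ⊤ := by
  have hint : Integrable (tailWeight s : Space d → ℝ) :=
    integrable_one_add_norm (by simpa using hsd)
  have hfull : ∫⁻ y, ENNReal.ofReal (tailWeight s (y : Space d)) ≠ ⊤ := by
    rw [← ofReal_integral_eq_lintegral_ofReal hint (Eventually.of_forall (tailWeight_nonneg s))]
    exact ENNReal.ofReal_ne_top
  exact ne_top_of_le_ne_top hfull (setLIntegral_le_lintegral _ _)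

lemma tendsto_meanTail [NeZero d] {s : ℝ} (hsd : (d : ℝ) < s + 1) :
    Tendsto (meanTail d s) atTop (𝓝 0) :=
  tendsto_setLIntegral_box_compl (meanTail_ne_top hsd 0)

lemma tendsto_tail [NeZero d] {s : ℝ} {q : ℕ} {γ : Configuration d} (h : tail s q γ ≠ ⊤) :
    Tendsto (fun p => tail s p γ) atTop (𝓝 0) :=
  tendsto_setLIntegral_box_compl h

lemma finsum_tailWeight_le {s : ℝ} {p : ℕ} {γ : Configuration d} (h : tail s p γ ≠ ⊤)
    {A : Set (Space d)} (hA : MeasurableSet A) (hb : IsBounded A) (hAp : A ⊆ (box d p)ᶜ) :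
    ∑ᶠ y ∈ γ.carrier ∩ A, tailWeight s y ≤ (tail s p γ).toReal := by
  rw [finsum_mem_eq_integral _ hA hb, integral_eq_lintegral_of_nonneg_ae
    (Eventually.of_forall (tailWeight_nonneg s)) (measurable_tailWeight s).aestronglyMeasurable]
  exact ENNReal.toReal_mono h (lintegral_mono_set hAp)

/-! ### Convergence of the move function -/

section FiniteSums

variable {α : Type*}

lemma abs_finsum_mem_sub_le {S : Set α} (hS : S.Finite) {f g : α → ℝ} {c : ℝ}
    (h : ∀ x ∈ S, |f x - g x| ≤ c) :
    |∑ᶠ x ∈ S, f x - ∑ᶠ x ∈ S, g x| ≤ S.ncard * c := by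
  obtain ⟨S, rfl⟩ := hS.exists_finset_coe
  rw [finsum_mem_coe_finset, finsum_mem_coe_finset, ← Finset.sum_sub_distrib,
    Set.ncard_coe_finset, ← nsmul_eq_mul]
  exact (Finset.abs_sum_le_sum_abs _ _).trans
    (Finset.sum_le_card_nsmul _ _ _ fun x hx => h x (by simpa using hx))

lemma abs_finsum_mem_sub_le_of_subset {S T : Set α} (hT : T.Finite) (hST : S ⊆ T)
    {f h : α → ℝ} (hf : ∀ x ∈ T \ S, |f x| ≤ h x) :
    |∑ᶠ x ∈ T, f x - ∑ᶠ x ∈ S, f x| ≤ ∑ᶠ x ∈ T \ S, h x := by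
  rw [← finsum_mem_add_sdiff hST hT, add_sub_cancel_left]
  obtain ⟨R, hR⟩ := (hT.subset (Set.sdiff_subset (t := S))).exists_finset_coe
  rw [← hR] at hf ⊢
  rw [finsum_mem_coe_finset, finsum_mem_coe_finset]
  exact (Finset.abs_sum_le_sum_abs _ _).trans
    (Finset.sum_le_sum fun x hx => hf x (by simpa using hx))

end FiniteSums

/-- The constant `C` in `|g(x - y) - g(y)| ≤ C (1 + |y|)^{-(s+1)}` for `|x| ≤ D` and `|y|` large:
there `|x - y|` and `|y|` are at least `(1 + |y|) / 4`, whence the factor `(1 / 4)^{-(s+1)}`. -/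
def moveConst (s D : ℝ) : ℝ := s * (1 / 4) ^ (-(s + 1)) * D

lemma moveConst_nonneg {s D : ℝ} (hs : 0 ≤ s) (hD : 0 ≤ D) : 0 ≤ moveConst s D := by
  unfold moveConst
  positivity

lemma abs_riesz_sub_riesz_le_tailWeight {s D : ℝ} (hs : 0 ≤ s) {x y : Space d}
    (hx : ‖x‖ ≤ D) (hy : 2 * D + 1 ≤ ‖y‖) :
    |riesz s (x - y) - riesz s y| ≤ moveConst s D * tailWeight s y := by
  have hquarter : 0 < 1 / 4 * (1 + ‖y‖) := by positivity
  have hdist : ‖y‖ - ‖x‖ ≤ ‖x - y‖ := norm_sub_rev x y ▸ norm_sub_norm_le y x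
  have hriesz := abs_riesz_sub_le hs hquarter (x := x - y) (y := -y)
    (by linarith [norm_nonneg x]) (by rw [norm_neg]; linarith [norm_nonneg x])
  rw [riesz_neg, sub_neg_eq_add, sub_add_cancel,
    Real.mul_rpow (by norm_num) (by positivity)] at hriesz
  calc |riesz s (x - y) - riesz s y|
      ≤ s * ((1 / 4) ^ (-(s + 1)) * (1 + ‖y‖) ^ (-(s + 1))) * ‖x‖ := hriesz
    _ ≤ s * ((1 / 4) ^ (-(s + 1)) * (1 + ‖y‖) ^ (-(s + 1))) * D := by gcongr
    _ = moveConst s D * tailWeight s y := by rw [moveConst, tailWeight]; ring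

lemma abs_truncatedMove_sub_le [NeZero d] {s D : ℝ} (hs : 0 ≤ s) {Δ : Set (Space d)}
    (hD : Δ ⊆ Metric.closedBall 0 D) {p q : ℕ} (hp : 2 * D + 1 ≤ side d p / 2)
    (hpq : p ≤ q) {γ : Configuration d} (hT : tail s p γ ≠ ⊤) (η : Configuration d) :
    |truncatedMove s Δ q η γ - truncatedMove s Δ p η γ|
      ≤ count Δ η * (moveConst s D * (tail s p γ).toReal) := by
  have hΔb : IsBounded Δ := Metric.isBounded_closedBall.subset hD
  refine abs_finsum_mem_sub_le (carrier_inter_finite η hΔb) fun x hx => ?_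
  have hxD : ‖x‖ ≤ D := mem_closedBall_zero_iff.1 (hD hx.2)
  have hD0 : 0 ≤ D := (norm_nonneg x).trans hxD
  have hΔp : Δ ⊆ box d p := hD.trans (closedBall_subset_box (by linarith))
  have hfin := carrier_inter_finite γ ((isBounded_box d q).subset (Set.sdiff_subset (t := Δ)))
  have hsub : γ.carrier ∩ (box d p \ Δ) ⊆ γ.carrier ∩ (box d q \ Δ) :=
    Set.inter_subset_inter_right _ (Set.sdiff_subset_sdiff_left (box_mono hpq))
  have hdiff : (γ.carrier ∩ (box d q \ Δ)) \ (γ.carrier ∩ (box d p \ Δ))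
      = γ.carrier ∩ (box d q \ box d p) := by
    ext y
    have := @hΔp y
    simp only [Set.mem_sdiff, Set.mem_inter_iff]
    tauto
  have hdecay (y : Space d) (hy : y ∈ γ.carrier ∩ (box d q \ box d p)) :
      |riesz s (x - y) - riesz s y| ≤ moveConst s D * tailWeight s y :=
    abs_riesz_sub_riesz_le_tailWeight hs hxD (hp.trans (half_side_le_norm hy.2.2))
  refine (abs_finsum_mem_sub_le_of_subset hfin hsub fun y hy => hdecay y (hdiff ▸ hy)).trans ?_
  rw [hdiff, ← mul_finsum_mem]
  exact mul_le_mul_of_nonneg_left (finsum_tailWeight_le hT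
    ((measurableSet_box d q).diff (measurableSet_box d p))
    ((isBounded_box d q).subset Set.sdiff_subset) fun y hy => hy.2) (moveConst_nonneg hs hD0)

lemma tendsto_truncatedMove [NeZero d] {s D : ℝ} (hs : 0 ≤ s) {Δ : Set (Space d)}
    (hD : Δ ⊆ Metric.closedBall 0 D) {q : ℕ} {γ : Configuration d}
    (hT : tail s q γ ≠ ⊤) (η : Configuration d) :
    Tendsto (fun p => truncatedMove s Δ p η γ) atTop (𝓝 (move s Δ η γ)) := by
  have hside := (tendsto_side d).eventually_ge_atTop (2 * (2 * D + 1))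
  have htail := tendsto_tail hT
  have hfin : ∀ᶠ p in atTop, tail s p γ < ⊤ := htail.eventually_lt_const (by simp)
  have hbound : Tendsto (fun p => count Δ η * (moveConst s D * (tail s p γ).toReal)) atTop
      (𝓝 0) := by
    have htoReal := (ENNReal.tendsto_toReal ENNReal.zero_ne_top).comp htail
    simpa using (htoReal.const_mul (moveConst s D)).const_mul (count Δ η : ℝ)
  refine CauchySeq.tendsto_limUnder (Metric.cauchySeq_iff'.2 fun ε hε => ?_)
  obtain ⟨p, hp, hpfin, hpε⟩ :=
    (hside.and (hfin.and (hbound.eventually_lt_const hε))).exists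
  refine ⟨p, fun r hr => ?_⟩
  rw [Real.dist_eq]
  exact (abs_truncatedMove_sub_le hs hD (by linarith) hr hpfin.ne η).trans_lt hpε

lemma abs_move_sub_truncatedMove_le [NeZero d] {s D : ℝ} (hs : 0 ≤ s) {Δ : Set (Space d)}
    (hD : Δ ⊆ Metric.closedBall 0 D) {p : ℕ} (hp : 2 * D + 1 ≤ side d p / 2)
    {γ : Configuration d} (hT : tail s p γ ≠ ⊤) (η : Configuration d) :
    |move s Δ η γ - truncatedMove s Δ p η γ|
      ≤ count Δ η * (moveConst s D * (tail s p γ).toReal) := by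
  refine le_of_tendsto ((tendsto_truncatedMove hs hD hT η).sub_const _).abs ?_
  filter_upwards [eventually_ge_atTop p] with q hq
  exact abs_truncatedMove_sub_le hs hD hp hq hT η

lemma count_eq_card {A : Set (Space d)} {X : Finset (Space d)} {γ : Configuration d}
    (h : X = γ.carrier ∩ A) : count A γ = X.card := by
  rw [count, ← h, Set.ncard_coe_finset]

lemma truncatedMove_eq_sum {s : ℝ} {Δ : Set (Space d)} {p : ℕ} {X Y : Finset (Space d)}
    {η γ : Configuration d} (hX : X = η.carrier ∩ Δ) (hY : Y = γ.carrier ∩ (box d p \ Δ)) :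
    truncatedMove s Δ p η γ = ∑ x ∈ X, ∑ y ∈ Y, (riesz s (x - y) - riesz s y) := by
  rw [truncatedMove, ← hX, ← hY]
  simp only [finsum_mem_coe_finset]

lemma neg_count_mul_finsum_riesz_le_truncatedMove [NeZero d] (s : ℝ) {Δ : Set (Space d)}
    (hb : IsBounded Δ) (p : ℕ) (η γ : Configuration d) :
    -(count Δ η * ∑ᶠ y ∈ γ.carrier ∩ (box d p \ Δ), riesz s y) ≤ truncatedMove s Δ p η γ := by
  obtain ⟨X, hX⟩ := (carrier_inter_finite η hb).exists_finset_coe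
  obtain ⟨Y, hY⟩ := (carrier_inter_finite γ
    ((isBounded_box d p).subset (Set.sdiff_subset (t := Δ)))).exists_finset_coe
  rw [truncatedMove_eq_sum hX hY, count_eq_card hX, ← hY, finsum_mem_coe_finset]
  rw [← nsmul_eq_mul, ← Finset.sum_const, ← Finset.sum_neg_distrib]
  refine Finset.sum_le_sum fun x _ => ?_
  rw [← Finset.sum_neg_distrib]
  refine Finset.sum_le_sum fun y _ => ?_
  linarith [riesz_nonneg s (x - y)]

/-! ### Comparison of the energies -/

section Finset

variable {φ ψ : Space d → ℝ} {X Y : Finset (Space d)} {γ η ξ : Configuration d}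

lemma pairEnergy_eq_sum_offDiag (φ : Space d → ℝ) (h : γ.carrier = X) :
    pairEnergy φ γ = (1 / 2) * ∑ p ∈ X.offDiag, φ (p.1 - p.2) := by
  rw [pairEnergy, h, ← Finset.coe_offDiag, finsum_mem_coe_finset]

lemma pairEnergy_union [DecidableEq (Space d)] (hφ : ∀ x, φ (-x) = φ x) (hXY : Disjoint X Y)
    (hγ : γ.carrier = (X ∪ Y : Finset (Space d))) (hη : η.carrier = X) (hξ : ξ.carrier = Y) :
    pairEnergy φ γ = pairEnergy φ η + pairEnergy φ ξ + ∑ x ∈ X, ∑ y ∈ Y, φ (x - y) := by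
  have hsymm : ∑ p ∈ Y ×ˢ X, φ (p.1 - p.2) = ∑ p ∈ X ×ˢ Y, φ (p.1 - p.2) := by
    rw [Finset.sum_product_right, Finset.sum_product]
    refine Finset.sum_congr rfl fun x _ => Finset.sum_congr rfl fun y _ => ?_
    rw [← hφ, neg_sub]
  have hne {x : Space d} (hx : x ∈ X) : x ∉ Y := Finset.disjoint_left.1 hXY hx
  rw [pairEnergy_eq_sum_offDiag φ hγ, pairEnergy_eq_sum_offDiag φ hη,
    pairEnergy_eq_sum_offDiag φ hξ, Finset.offDiag_union hXY, Finset.sum_union, Finset.sum_union,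
    Finset.sum_union, hsymm, Finset.sum_product]
  · ring
  all_goals
    simp only [Finset.disjoint_left, Finset.mem_union, Finset.mem_offDiag, Finset.mem_product]
    rintro ⟨x, y⟩
    have hx := @hne x
    have hy := @hne y
    tauto

lemma abs_pairEnergy_sub_le (hη : η.carrier = X) {r c : ℝ}
    (h : ∀ x ∈ X, ∀ y ∈ X, |φ (x - y) - ψ (x - y) - r| ≤ c) :
    |pairEnergy φ η - pairEnergy ψ η - 1 / 2 * (X.offDiag.card * r)|
      ≤ 1 / 2 * (X.offDiag.card * c) := by
  rw [pairEnergy_eq_sum_offDiag φ hη, pairEnergy_eq_sum_offDiag ψ hη, ← mul_sub, ← mul_sub,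
    abs_mul, abs_of_pos (by norm_num : (0 : ℝ) < 1 / 2), ← nsmul_eq_mul, ← Finset.sum_const,
    ← Finset.sum_sub_distrib, ← Finset.sum_sub_distrib, ← nsmul_eq_mul]
  refine mul_le_mul_of_nonneg_left ((Finset.abs_sum_le_sum_abs _ _).trans
    (Finset.sum_le_card_nsmul _ _ _ fun p hp => ?_)) (by norm_num)
  obtain ⟨hx, hy, -⟩ := Finset.mem_offDiag.1 hp
  exact h _ hx _ hy

lemma abs_sum_sum_sub_le {c : ℝ}
    (h : ∀ x ∈ X, ∀ y ∈ Y, |(φ (x - y) - ψ (x - y)) - (φ y - ψ y)| ≤ c) :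
    |∑ x ∈ X, ∑ y ∈ Y, φ (x - y) - ∑ x ∈ X, ∑ y ∈ Y, (ψ (x - y) - ψ y) - X.card * ∑ y ∈ Y, φ y|
      ≤ X.card * (Y.card * c) := by
  rw [← nsmul_eq_mul, ← Finset.sum_const, ← Finset.sum_sub_distrib, ← Finset.sum_sub_distrib,
    ← nsmul_eq_mul, ← nsmul_eq_mul]
  refine (Finset.abs_sum_le_sum_abs _ _).trans (Finset.sum_le_card_nsmul _ _ _ fun x hx => ?_)
  rw [← Finset.sum_sub_distrib, ← Finset.sum_sub_distrib]
  refine (Finset.abs_sum_le_sum_abs _ _).trans (Finset.sum_le_card_nsmul _ _ _ fun y hy => ?_)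
  rw [show φ (x - y) - (ψ (x - y) - ψ y) - φ y = (φ (x - y) - ψ (x - y)) - (φ y - ψ y) by ring]
  exact h x hx y hy

/-- When `φ - ψ` is nearly constant near the origin, the `φ`-energy of `X ∪ Y` is, up to a quantity
depending on `X` through its cardinality only, the `ψ`-energy of moving `X` in the field of `Y`. -/
lemma abs_pairEnergy_union_sub_le [DecidableEq (Space d)] {L R D : ℝ} (hφ : ∀ x, φ (-x) = φ x)
    (hψ : ∀ x, ψ (-x) = ψ x) (hD : 0 ≤ D) (hR : 0 ≤ R) (hDL : 4 * D ≤ L)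
    (hlip : ∀ z w : Space d, (∀ i, |z i| ≤ 3 / 4 * L) → (∀ i, |w i| ≤ 3 / 4 * L) →
      |(φ z - ψ z) - (φ w - ψ w)| ≤ R * ‖z - w‖)
    (hX : ∀ x ∈ X, ‖x‖ ≤ D) (hY : ∀ y ∈ Y, ∀ i, |y i| ≤ L / 2) (hXY : Disjoint X Y)
    (hγ : γ.carrier = (X ∪ Y : Finset (Space d))) (hη : η.carrier = X) (hξ : ξ.carrier = Y) :
    |pairEnergy φ γ - (pairEnergy ψ η + ∑ x ∈ X, ∑ y ∈ Y, (ψ (x - y) - ψ y))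
        - (pairEnergy φ ξ + 1 / 2 * (X.offDiag.card * (φ 0 - ψ 0)) + X.card * ∑ y ∈ Y, φ y)|
      ≤ X.card * ((X.card + Y.card) * (R * D)) := by
  have hinside (x : Space d) (hx : x ∈ X) (y : Space d) (hy : y ∈ X) :
      |φ (x - y) - ψ (x - y) - (φ 0 - ψ 0)| ≤ R * (2 * D) := by
    have hxy : ‖x - y‖ ≤ 2 * D := (norm_sub_le x y).trans (by linarith [hX x hx, hX y hy])
    refine (hlip (x - y) 0 (fun i => ?_) (fun i => ?_)).trans ?_
    · linarith [abs_apply_le_norm (x - y) i]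
    · rw [PiLp.zero_apply, abs_zero]
      linarith
    · rw [sub_zero]
      gcongr
  have hacross (x : Space d) (hx : x ∈ X) (y : Space d) (hy : y ∈ Y) :
      |(φ (x - y) - ψ (x - y)) - (φ y - ψ y)| ≤ R * D := by
    have hdist := hlip (x - y) (-y) (fun i => ?_) (fun i => ?_)
    · rw [hφ, hψ, sub_neg_eq_add, sub_add_cancel] at hdist
      exact hdist.trans (mul_le_mul_of_nonneg_left (hX x hx) hR)
    · rw [PiLp.sub_apply]
      linarith [abs_sub (x i) (y i), abs_apply_le_norm x i, hX x hx, hY y hy i]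
    · rw [PiLp.neg_apply, abs_neg]
      linarith [hY y hy i]
  have hself := abs_pairEnergy_sub_le hη hinside
  have hcross := abs_sum_sum_sub_le hacross
  have hcard : (X.offDiag.card : ℝ) ≤ X.card * X.card := by
    rw [Finset.offDiag_card]
    exact_mod_cast Nat.sub_le _ _
  rw [pairEnergy_union hφ hXY hγ hη hξ]
  calc _ = |(pairEnergy φ η - pairEnergy ψ η - 1 / 2 * (X.offDiag.card * (φ 0 - ψ 0)))
        + (∑ x ∈ X, ∑ y ∈ Y, φ (x - y) - ∑ x ∈ X, ∑ y ∈ Y, (ψ (x - y) - ψ y)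
          - X.card * ∑ y ∈ Y, φ y)| := by congr 1; ring
    _ ≤ 1 / 2 * (X.offDiag.card * (R * (2 * D))) + X.card * (Y.card * (R * D)) :=
        (abs_add_le _ _).trans (add_le_add hself hcross)
    _ = X.offDiag.card * (R * D) + X.card * (Y.card * (R * D)) := by ring
    _ ≤ X.card * X.card * (R * D) + X.card * (Y.card * (R * D)) := by gcongr
    _ = X.card * ((X.card + Y.card) * (R * D)) := by ring

end Finset

lemma restrict_compl_carrier_of_subset {γ : Configuration d} {B : Set (Space d)}
    (h : γ.carrier ⊆ B) (Δ : Set (Space d)) :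
    (γ.restrict Δᶜ).carrier = γ.carrier ∩ (B \ Δ) := by
  ext y
  have := @h y
  simp only [restrict, Set.mem_inter_iff, Set.mem_compl_iff, Set.mem_sdiff]
  tauto

lemma count_add_count_sdiff {A B : Set (Space d)} (hAB : A ⊆ B) (hB : IsBounded B)
    (γ : Configuration d) : count A γ + count (B \ A) γ = count B γ := by
  rw [count, count, count, Set.inter_sdiff_distrib_left,
    ← Set.ncard_sdiff_add_ncard_of_subset (Set.inter_subset_inter_right _ hAB)
      (carrier_inter_finite γ hB), add_comm]

lemma exists_abs_periodicEnergy_glue_sub_le [NeZero d] {s D : ℝ} (hsd : (d : ℝ) < s + 1)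
    {Δ : Set (Space d)} (hD0 : 0 ≤ D) (hD : Δ ⊆ Metric.closedBall 0 D) :
    ∃ K : ℝ, 0 ≤ K ∧ ∀ n : ℕ, 1 ≤ n → 4 * D ≤ side d n →
      ∀ γ : Configuration d, γ.carrier ⊆ box d n → count (box d n) γ = n →
      ∃ c : ℝ, ∀ η : Configuration d, η.carrier ⊆ Δ → count Δ η = count Δ γ →
        |periodicEnergy s n (glue Δ η γ) - (energy s η + truncatedMove s Δ n η γ) - c|
          ≤ count Δ γ * (K * (n * side d n ^ (-(s + 1)))) := by
  classical
  obtain ⟨K, hK0, hK⟩ := exists_lipschitz_periodicRiesz_sub_riesz (d := d) hsd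
  refine ⟨D * K, by positivity, fun n hn hDn γ hγ hγn => ?_⟩
  have hL := side_pos d hn
  have hΔb : IsBounded Δ := Metric.isBounded_closedBall.subset hD
  have hΔn : Δ ⊆ box d n := hD.trans (closedBall_subset_box (by linarith))
  obtain ⟨Y, hY⟩ := (carrier_inter_finite γ
    ((isBounded_box d n).subset (Set.sdiff_subset (t := Δ)))).exists_finset_coe
  have hξ : (γ.restrict Δᶜ).carrier = Y := by rw [hY, restrict_compl_carrier_of_subset hγ]
  have hcard : count Δ γ + Y.card = n := by
    rw [← hγn, ← count_add_count_sdiff hΔn (isBounded_box d n), count_eq_card hY]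
  refine ⟨pairEnergy (periodicRiesz s n) (γ.restrict Δᶜ)
    + 1 / 2 * ((count Δ γ * count Δ γ - count Δ γ : ℕ)
      * (periodicRiesz s n (0 : Space d) - riesz s (0 : Space d)))
    + count Δ γ * ∑ y ∈ Y, periodicRiesz s n y, fun η hη hηγ => ?_⟩
  obtain ⟨X, hX⟩ := (carrier_inter_finite η hΔb).exists_finset_coe
  have hηX : η.carrier = X := by rw [hX, Set.inter_eq_left.2 hη]
  have hXcard : X.card = count Δ γ := by rw [← hηγ, count_eq_card hX]
  have hXΔ {x : Space d} (hx : x ∈ X) : x ∈ Δ := (hX ▸ hx : x ∈ η.carrier ∩ Δ).2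
  have hYbox {y : Space d} (hy : y ∈ Y) : y ∈ box d n \ Δ :=
    (hY ▸ hy : y ∈ γ.carrier ∩ (box d n \ Δ)).2
  have hdisj : Disjoint X Y := Finset.disjoint_left.2 fun x hx hy => (hYbox hy).2 (hXΔ hx)
  have hglue : (glue Δ η γ).carrier = (X ∪ Y : Finset (Space d)) := by
    rw [glue_of_subset hη, Finset.coe_union, ← hξ, ← hηX]
    rfl
  have hcompare := abs_pairEnergy_union_sub_le (periodicRiesz_neg s n) (riesz_neg s) hD0
    (by positivity) hDn (hK n hn) (fun x hx => mem_closedBall_zero_iff.1 (hD (hXΔ hx)))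
    (fun y hy => (hYbox hy).1) hdisj hglue hηX hξ
  rw [Finset.offDiag_card, hXcard, ← Nat.cast_add, hcard, ← truncatedMove_eq_sum hX hY] at hcompare
  refine hcompare.trans_eq ?_
  ring

theorem exists_abs_periodicEnergy_glue_sub_truncatedMove_le [NeZero d] {s D : ℝ}
    (hsd : (d : ℝ) < s + 1) {Δ : Set (Space d)} (hD0 : 0 ≤ D) (hD : Δ ⊆ Metric.closedBall 0 D) :
    ∃ K : ℝ, 0 ≤ K ∧ ∀ n p : ℕ, 1 ≤ n → p ≤ n → 2 * D + 1 ≤ side d p / 2 →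
      ∀ γ : Configuration d, γ.carrier ⊆ box d n → count (box d n) γ = n → tail s p γ ≠ ⊤ →
      ∃ c : ℝ, ∀ η : Configuration d, η.carrier ⊆ Δ → count Δ η = count Δ γ →
        |periodicEnergy s n (glue Δ η γ) - (energy s η + truncatedMove s Δ p η γ) - c|
          ≤ count Δ γ *
            (moveConst s D * (tail s p γ).toReal + K * (n * side d n ^ (-(s + 1)))) := by
  obtain ⟨K, hK0, hK⟩ := exists_abs_periodicEnergy_glue_sub_le (d := d) hsd hD0 hD
  refine ⟨K, hK0, fun n p hn hpn hp γ hγ hγn hT => ?_⟩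
  obtain ⟨c, hc⟩ := hK n hn (by linarith [side_mono d hpn]) γ hγ hγn
  refine ⟨c, fun η hη hηγ => ?_⟩
  have hmove := abs_truncatedMove_sub_le (pos_of_lt_add_one hsd).le hD hp hpn hT η
  rw [hηγ] at hmove
  calc _ = |(periodicEnergy s n (glue Δ η γ) - (energy s η + truncatedMove s Δ n η γ) - c)
        + (truncatedMove s Δ n η γ - truncatedMove s Δ p η γ)| := by congr 1; ring
    _ ≤ _ := (abs_add_le _ _).trans (add_le_add (hc η hη hηγ) hmove)
    _ = _ := by ring

/-! ### Comparison of exponential tilts -/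

lemma le_of_four_mul_le_sq {a z t : ℝ} (ht : 0 ≤ t) (hz : 0 ≤ z) (hzt : 4 * z ≤ t ^ 2)
    (ha : a ≤ 1) (haz : a ≤ Real.exp z - 1) : a ≤ t := by
  rcases le_or_gt z 1 with hz1 | hz1
  · have hexp : Real.exp z - 1 - z ≤ z ^ 2 :=
      (le_abs_self _).trans (Real.abs_exp_sub_one_sub_id_le (by rwa [abs_of_nonneg hz]))
    have h2z : 2 * z ≤ t := by nlinarith
    nlinarith
  · nlinarith

section Tilted

variable {Ω : Type*} [MeasurableSpace Ω] {ν : Measure Ω} {V₁ V₂ : Ω → ℝ}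

theorem tilted_le_smul_tilted (hV₁ : Integrable (fun ω => Real.exp (V₁ ω)) ν)
    (hV₂ : Integrable (fun ω => Real.exp (V₂ ω)) ν) {c δ : ℝ}
    (h : ∀ᵐ ω ∂ν, |V₁ ω - V₂ ω - c| ≤ δ) :
    ν.tilted V₁ ≤ ENNReal.ofReal (Real.exp (2 * δ)) • ν.tilted V₂ := by
  rcases eq_zero_or_neZero ν with rfl | _
  · simp
  have hpartition : Real.exp (c - δ) * ∫ ω, Real.exp (V₂ ω) ∂ν ≤ ∫ ω, Real.exp (V₁ ω) ∂ν := by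
    rw [← integral_const_mul]
    refine integral_mono_ae (hV₂.const_mul _) hV₁ ?_
    filter_upwards [h] with ω hω
    rw [← Real.exp_add]
    exact Real.exp_le_exp.2 (by linarith [(abs_le.1 hω).1])
  have hZ₂ := integral_exp_pos hV₂
  rw [Measure.tilted, Measure.tilted, ← withDensity_smul' _ _ ENNReal.ofReal_ne_top]
  refine withDensity_mono ?_
  filter_upwards [h] with ω hω
  rw [Pi.smul_apply, smul_eq_mul, ← ENNReal.ofReal_mul (Real.exp_pos _).le]
  refine ENNReal.ofReal_le_ofReal ?_
  calc Real.exp (V₁ ω) / ∫ ω, Real.exp (V₁ ω) ∂ν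
      ≤ Real.exp (c + δ + V₂ ω) / (Real.exp (c - δ) * ∫ ω, Real.exp (V₂ ω) ∂ν) := by
        gcongr
        linarith [(abs_le.1 hω).2]
    _ = Real.exp (2 * δ) * (Real.exp (V₂ ω) / ∫ ω, Real.exp (V₂ ω) ∂ν) := by
        rw [← div_div, ← Real.exp_sub, ← mul_div_assoc, ← Real.exp_add]
        ring_nf

lemma real_tilted_sub_le (hV₁ : Integrable (fun ω => Real.exp (V₁ ω)) ν)
    (hV₂ : Integrable (fun ω => Real.exp (V₂ ω)) ν) {c δ : ℝ} (hδ : 0 ≤ δ)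
    (h : ∀ᵐ ω ∂ν, |V₁ ω - V₂ ω - c| ≤ δ) (E : Set Ω) :
    (ν.tilted V₁).real E - (ν.tilted V₂).real E ≤ Real.exp (2 * δ) - 1 := by
  have hle : (ν.tilted V₁).real E ≤ Real.exp (2 * δ) * (ν.tilted V₂).real E := by
    have hE := ENNReal.toReal_mono
      (ENNReal.mul_ne_top ENNReal.ofReal_ne_top (measure_ne_top _ E))
      (tilted_le_smul_tilted hV₁ hV₂ h E)
    rwa [ENNReal.toReal_mul, ENNReal.toReal_ofReal (Real.exp_pos _).le] at hE
  nlinarith [measureReal_le_one (μ := ν.tilted V₂) (s := E),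
    Real.one_le_exp (by linarith : 0 ≤ 2 * δ)]

/-- Since `min 1 (e^z - 1) ≤ 2 √z`, the error caused by a perturbation of size `N b` is at most of
order `√(N b)`, which the parameter `θ` splits into a multiple of `N` and a multiple of `b`. -/
theorem abs_real_tilted_sub_le (hV₁ : Integrable (fun ω => Real.exp (V₁ ω)) ν)
    (hV₂ : Integrable (fun ω => Real.exp (V₂ ω)) ν) {c N b θ : ℝ} (hN : 0 ≤ N) (hb : 0 ≤ b)
    (hθ : 0 < θ) (h : ∀ᵐ ω ∂ν, |V₁ ω - V₂ ω - c| ≤ N * b) (E : Set Ω) :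
    |(ν.tilted V₁).real E - (ν.tilted V₂).real E| ≤ θ * N + 2 * b / θ := by
  have hsymm : ∀ᵐ ω ∂ν, |V₂ ω - V₁ ω - (-c)| ≤ N * b := by
    filter_upwards [h] with ω hω
    rwa [← abs_neg, show -(V₂ ω - V₁ ω - (-c)) = V₁ ω - V₂ ω - c by ring]
  have hsq : 4 * (2 * (N * b)) ≤ (θ * N + 2 * b / θ) ^ 2 := by
    have hsplit : (θ * N + 2 * b / θ) ^ 2 = (θ * N - 2 * b / θ) ^ 2 + 4 * (2 * (N * b)) := by
      field_simp
      ring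
    linarith [sq_nonneg (θ * N - 2 * b / θ)]
  have hNb : 0 ≤ N * b := mul_nonneg hN hb
  refine le_of_four_mul_le_sq (by positivity) (by positivity) hsq ?_ (abs_sub_le_iff.2
    ⟨real_tilted_sub_le hV₁ hV₂ hNb h E, real_tilted_sub_le hV₂ hV₁ hNb hsymm E⟩)
  exact abs_sub_le_of_nonneg_of_le measureReal_nonneg measureReal_le_one measureReal_nonneg
    measureReal_le_one

end Tilted

/-! ### Intensity -/

/-- The intensity measure `A ↦ E[N_A]` of a point process. -/
def intensity (Q : Measure (Configuration d)) : Measure (Space d) := Q.bind pointKernel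

section Intensity

variable {Q : Measure (Configuration d)}

lemma lintegral_intensity {φ : Space d → ENNReal} (hφ : Measurable φ) :
    ∫⁻ y, φ y ∂(intensity Q) = ∫⁻ γ, ∫⁻ y, φ y ∂(pointMeasure γ) ∂Q :=
  Measure.lintegral_bind pointKernel.aemeasurable hφ.aemeasurable

lemma intensity_apply_eq_lintegral_count {A : Set (Space d)} (hA : MeasurableSet A)
    (hb : IsBounded A) : intensity Q A = ∫⁻ γ, (count A γ : ENNReal) ∂Q := by
  rw [intensity, Measure.bind_apply hA pointKernel.aemeasurable]
  simp only [pointKernel_apply, pointMeasure_apply _ hA hb]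

theorem intensity_torusGibbs [NeZero d] {s β : ℝ} (hsd : (d : ℝ) < s + 1) (hβ : 0 ≤ β) {n : ℕ}
    (hn : 1 ≤ n) : intensity (torusGibbs d s β n) = volume.restrict (box d n) :=
  Measure.ext_of_lintegral _ fun φ hφ => by
    rw [lintegral_intensity hφ, lintegral_pointMeasure_torusGibbs hsd hβ hn hφ]

lemma measure_le_of_forall_isBounded {μ ν : Measure (Space d)}
    (h : ∀ A : Set (Space d), MeasurableSet A → IsBounded A → μ A ≤ ν A) : μ ≤ ν := by
  refine Measure.le_iff.2 fun A hA => ?_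
  rw [← sum_restrict_shell μ, ← sum_restrict_shell ν, Measure.sum_apply _ hA,
    Measure.sum_apply _ hA]
  refine ENNReal.tsum_le_tsum fun m => ?_
  rw [Measure.restrict_apply hA, Measure.restrict_apply hA]
  exact h _ (hA.inter (measurableSet_shell m)) ((isBounded_shell m).subset Set.inter_subset_right)

lemma measurable_natCast_count {A : Set (Space d)} (hA : MeasurableSet A) (hb : IsBounded A) :
    Measurable fun γ : Configuration d => (count A γ : ENNReal) :=
  measurable_from_top.comp (measurable_count hA hb)

section IntensityLE

variable (hQ : intensity Q ≤ volume)
include hQ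

lemma ae_pointMeasure_eq_zero {A : Set (Space d)} (hA0 : volume A = 0) :
    ∀ᵐ γ ∂Q, pointMeasure γ A = 0 := by
  have hzero : intensity Q A = 0 := le_antisymm ((hQ A).trans hA0.le) zero_le
  exact (Measure.ae_ae_of_ae_bind pointKernel.aemeasurable
    (measure_eq_zero_iff_ae_notMem.1 hzero)).mono fun γ hγ => measure_eq_zero_iff_ae_notMem.2 hγ

lemma ae_count_eq_zero {A : Set (Space d)} (hA : MeasurableSet A) (hb : IsBounded A) :
    ∀ᵐ γ ∂Q, volume A = 0 → count A γ = 0 := by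
  by_cases hA0 : volume A = 0
  · filter_upwards [ae_pointMeasure_eq_zero hQ hA0] with γ hγ _
    rwa [pointMeasure_apply _ hA hb, Nat.cast_eq_zero] at hγ
  · exact Eventually.of_forall fun _ h => absurd h hA0

lemma ae_zero_notMem [NeZero d] : ∀ᵐ γ ∂Q, (0 : Space d) ∉ γ.carrier := by
  filter_upwards [ae_pointMeasure_eq_zero hQ (A := {0}) (by simp)] with γ hγ hzero
  rw [pointMeasure, Measure.restrict_apply (measurableSet_singleton _),
    Set.inter_eq_left.2 (Set.singleton_subset_iff.2 hzero)] at hγ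
  simp at hγ

lemma lintegral_tail_le (s : ℝ) (p : ℕ) : ∫⁻ γ, tail s p γ ∂Q ≤ meanTail d s p := by
  have hbox := (measurableSet_box d p).compl
  have hweight := (measurable_tailWeight (d := d) s).ennreal_ofReal.indicator hbox
  simp only [tail, meanTail, ← lintegral_indicator hbox]
  rw [← lintegral_intensity hweight]
  exact lintegral_mono' hQ le_rfl

lemma ae_tail_ne_top {s : ℝ} (hsd : (d : ℝ) < s + 1) (p : ℕ) : ∀ᵐ γ ∂Q, tail s p γ ≠ ⊤ :=
  (ae_lt_top (measurable_tail s p)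
    (ne_top_of_le_ne_top (meanTail_ne_top hsd p) (lintegral_tail_le hQ s p))).mono
    fun _ => LT.lt.ne

lemma integrable_tail {s : ℝ} (hsd : (d : ℝ) < s + 1) (p : ℕ) :
    Integrable (fun γ => (tail s p γ).toReal) Q :=
  integrable_toReal_of_lintegral_ne_top (measurable_tail s p).aemeasurable
    (ne_top_of_le_ne_top (meanTail_ne_top hsd p) (lintegral_tail_le hQ s p))

lemma integral_tail_le {s : ℝ} (hsd : (d : ℝ) < s + 1) (p : ℕ) :
    ∫ γ, (tail s p γ).toReal ∂Q ≤ (meanTail d s p).toReal := by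
  rw [integral_toReal (measurable_tail s p).aemeasurable
    ((ae_tail_ne_top hQ hsd p).mono fun _ => lt_top_iff_ne_top.2)]
  exact ENNReal.toReal_mono (meanTail_ne_top hsd p) (lintegral_tail_le hQ s p)

lemma lintegral_count_le {A : Set (Space d)} (hA : MeasurableSet A) (hb : IsBounded A) :
    ∫⁻ γ, (count A γ : ENNReal) ∂Q ≤ volume A :=
  (intensity_apply_eq_lintegral_count hA hb).symm.trans_le (hQ A)

lemma integrable_count {A : Set (Space d)} (hA : MeasurableSet A) (hb : IsBounded A) :
    Integrable (fun γ => (count A γ : ℝ)) Q := by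
  simpa using integrable_toReal_of_lintegral_ne_top
    (measurable_natCast_count hA hb).aemeasurable
    (ne_top_of_le_ne_top hb.measure_lt_top.ne (lintegral_count_le hQ hA hb))

lemma integral_count_le {A : Set (Space d)} (hA : MeasurableSet A) (hb : IsBounded A) :
    ∫ γ, (count A γ : ℝ) ∂Q ≤ volume.real A := by
  have hcount := integral_toReal (μ := Q) (measurable_natCast_count hA hb).aemeasurable
    (Eventually.of_forall fun γ => ENNReal.natCast_lt_top _)
  simp only [ENNReal.toReal_natCast] at hcount
  rw [hcount]
  exact ENNReal.toReal_mono hb.measure_lt_top.ne (lintegral_count_le hQ hA hb)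

end IntensityLE

end Intensity

/-! ### Circular Riesz gases as limits along an ultrafilter -/

lemma exists_ultrafilter_tendsto {s β : ℝ} {P : Measure (Configuration d)}
    (hP : IsCircularRieszGas s β P) : ∃ U : Ultrafilter ℕ, (U : Filter ℕ) ≤ atTop ∧
      ∀ f : Configuration d → ℝ, IsLocalTame f →
        Tendsto (fun n => ∫ γ, f γ ∂(torusGibbs d s β n)) U (𝓝 (∫ γ, f γ ∂P)) := by
  let _ := localTopology d
  obtain ⟨U, hU, hlim⟩ := mapClusterPt_iff_ultrafilter.1 hP.2
  refine ⟨U, hU, fun f hf => ?_⟩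
  rw [localTopology, nhds_iInf, tendsto_iInf] at hlim
  have hlim_f := hlim ⟨f, hf⟩
  rwa [nhds_induced, tendsto_comap_iff] at hlim_f

lemma isLocalTame_of_bounded {A : Set (Space d)} (hA : MeasurableSet A) (hb : IsBounded A)
    {f : Configuration d → ℝ} (hf : Measurable[sigmaOf d A] f) {b : ℝ} (hfb : ∀ γ, |f γ| ≤ b) :
    IsLocalTame f :=
  ⟨A, hA, hb, hf, b, fun γ => (hfb γ).trans
    (le_mul_of_one_le_right ((abs_nonneg _).trans (hfb γ)) (by simp))⟩

lemma measurable_natCast_min_count {A : Set (Space d)} (hA : MeasurableSet A)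
    (hb : IsBounded A) (M : ℕ) :
    Measurable fun γ : Configuration d => ((min (count A γ) M : ℕ) : ENNReal) :=
  (measurable_from_top (f := fun k : ℕ => ((min k M : ℕ) : ENNReal))).comp (measurable_count hA hb)

section Gas

variable [NeZero d] {s β : ℝ} {P : Measure (Configuration d)} {A : Set (Space d)}

lemma integral_min_count_le (hsd : (d : ℝ) < s + 1) (hβ : 0 ≤ β) (hP : IsCircularRieszGas s β P)
    (hA : MeasurableSet A) (hb : IsBounded A) (M : ℕ) :
    ∫ γ, ((min (count A γ) M : ℕ) : ℝ) ∂P ≤ volume.real A := by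
  obtain ⟨U, hU, hlim⟩ := exists_ultrafilter_tendsto hP
  have hmeas : Measurable[sigmaOf d A] fun γ : Configuration d => ((min (count A γ) M : ℕ) : ℝ) :=
    (measurable_from_top (f := fun k : ℕ => ((min k M : ℕ) : ℝ))).comp
      (measurable_count_sigmaOf hA hb le_rfl)
  have htame := isLocalTame_of_bounded hA hb hmeas (b := M) fun γ => by
    rw [Nat.abs_cast]
    exact_mod_cast min_le_right _ _
  refine le_of_tendsto (hlim _ htame) ?_
  filter_upwards [hU (eventually_ge_atTop 1)] with n hn
  have hint : intensity (torusGibbs d s β n) ≤ volume :=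
    (intensity_torusGibbs hsd hβ hn).trans_le Measure.restrict_le_self
  refine le_trans ?_ (integral_count_le hint hA hb)
  exact integral_mono_of_nonneg (Eventually.of_forall fun γ => Nat.cast_nonneg _)
    (integrable_count hint hA hb) (Eventually.of_forall fun γ => Nat.cast_le.2 (min_le_left _ _))

lemma lintegral_min_count_le (hsd : (d : ℝ) < s + 1) (hβ : 0 ≤ β) (hP : IsCircularRieszGas s β P)
    (hA : MeasurableSet A) (hb : IsBounded A) (M : ℕ) :
    ∫⁻ γ, ((min (count A γ) M : ℕ) : ENNReal) ∂P ≤ volume A := by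
  have := hP.1
  have hfin : ∫⁻ γ, ((min (count A γ) M : ℕ) : ENNReal) ∂P ≠ ⊤ := by
    refine ne_top_of_le_ne_top (b := ∫⁻ _γ : Configuration d, (M : ENNReal) ∂P) (by simp) ?_
    exact lintegral_mono fun γ => Nat.cast_le.2 (min_le_right _ _)
  have hreal := integral_toReal (μ := P) (measurable_natCast_min_count hA hb M).aemeasurable
    (Eventually.of_forall fun γ => ENNReal.natCast_lt_top _)
  simp only [ENNReal.toReal_natCast] at hreal
  rw [← ENNReal.toReal_le_toReal hfin hb.measure_lt_top.ne, ← hreal]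
  exact integral_min_count_le hsd hβ hP hA hb M

theorem intensity_le_volume_of_isCircularRieszGas (hsd : (d : ℝ) < s + 1) (hβ : 0 ≤ β)
    (hP : IsCircularRieszGas s β P) : intensity P ≤ volume := by
  refine measure_le_of_forall_isBounded fun A hA hb => ?_
  have hsup (γ : Configuration d) : (count A γ : ENNReal)
      = ⨆ M : ℕ, ((min (count A γ) M : ℕ) : ENNReal) :=
    le_antisymm (le_iSup_of_le (count A γ) (by rw [min_self]))
      (iSup_le fun M => Nat.cast_le.2 (min_le_left _ _))
  rw [intensity_apply_eq_lintegral_count hA hb]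
  simp only [hsup]
  rw [lintegral_iSup (measurable_natCast_min_count hA hb)
    fun M M' hM γ => Nat.cast_le.2 (min_le_min_left _ hM)]
  exact iSup_le (lintegral_min_count_le hsd hβ hP hA hb)

end Gas

/-! ### Resampling kernels -/

/-- The law of `γ` after its points in `Δ` have been replaced by `N` new ones, distributed with
density proportional to `e^V` with respect to the binomial process. -/
def resample (Δ : Set (Space d)) (V : Configuration d → ℝ) (N : ℕ) (γ : Configuration d) :
    Measure (Configuration d) :=
  ((binomialProcess Δ N).tilted V).map fun η => glue Δ η γ

instance (Δ : Set (Space d)) (V : Configuration d → ℝ) (N : ℕ) (γ : Configuration d) :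
    IsZeroOrProbabilityMeasure (resample Δ V N γ) := by
  unfold resample
  infer_instance

section Resample

variable {Δ : Set (Space d)} (hΔ : MeasurableSet Δ)
include hΔ

lemma resample_apply (V : Configuration d → ℝ) (N : ℕ) (γ : Configuration d)
    {E : Set (Configuration d)} (hE : MeasurableSet E) :
    resample Δ V N γ E = (binomialProcess Δ N).tilted V ((glue Δ · γ) ⁻¹' E) :=
  Measure.map_apply (measurable_glue_left hΔ γ) hE

lemma resample_real_apply (V : Configuration d → ℝ) (N : ℕ) (γ : Configuration d)
    {E : Set (Configuration d)} (hE : MeasurableSet E) :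
    (resample Δ V N γ).real E = ((binomialProcess Δ N).tilted V).real ((glue Δ · γ) ⁻¹' E) :=
  map_measureReal_apply (measurable_glue_left hΔ γ) hE

lemma integral_resample (V : Configuration d → ℝ) (N : ℕ) (γ : Configuration d)
    {f : Configuration d → ℝ} (hf : Measurable f) :
    ∫ γ', f γ' ∂(resample Δ V N γ)
      = ∫ η, Real.exp (V η) / (∫ η', Real.exp (V η') ∂(binomialProcess Δ N)) * f (glue Δ η γ)
        ∂(binomialProcess Δ N) := by
  rw [resample, integral_map (measurable_glue_left hΔ γ).aemeasurable hf.aestronglyMeasurable,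
    integral_tilted]
  simp only [smul_eq_mul]

lemma measurable_resample {V : Configuration d → Configuration d → ℝ}
    (hV : Measurable (Function.uncurry V)) :
    Measurable fun q : Configuration d × ℕ => resample Δ (V q.1) q.2 q.1 := by
  refine measurable_from_prod_countable_left fun N => Measure.measurable_of_measurable_coe _
    fun E hE => ?_
  have hpartition : Measurable fun γ => ∫ η, Real.exp (V γ η) ∂(binomialProcess Δ N) :=
    (hV.exp.stronglyMeasurable.integral_prod_right' (ν := binomialProcess Δ N)).measurable
  have hglue : Measurable fun q : Configuration d × Configuration d => glue Δ q.2 q.1 :=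
    (measurable_glue hΔ).comp measurable_swap
  have hdensity : Measurable fun q : Configuration d × Configuration d =>
      ENNReal.ofReal (Real.exp (V q.1 q.2) / ∫ η, Real.exp (V q.1 η) ∂(binomialProcess Δ N))
        * E.indicator 1 (glue Δ q.2 q.1) :=
    (hV.exp.div (hpartition.comp measurable_fst)).ennreal_ofReal.mul
      ((measurable_one.indicator hE).comp hglue)
  have hvalue (γ : Configuration d) : resample Δ (V γ) N γ E
      = ∫⁻ η, ENNReal.ofReal (Real.exp (V γ η) / ∫ η, Real.exp (V γ η) ∂(binomialProcess Δ N))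
        * E.indicator 1 (glue Δ η γ) ∂(binomialProcess Δ N) := by
    rw [resample_apply hΔ _ _ _ hE, ← lintegral_indicator_one (measurable_glue_left hΔ γ hE),
      lintegral_tilted]
    rfl
  simpa only [hvalue] using hdensity.lintegral_prod_right' (ν := binomialProcess Δ N)

end Resample

/-- The kernel resampling the points of `γ` in `Δ`, whose number is kept, with density proportional
to `e^{V(γ, ·)}` with respect to the binomial process. -/
def resampleKernel {Δ : Set (Space d)} (hΔ : MeasurableSet Δ) (hb : IsBounded Δ)
    {V : Configuration d → Configuration d → ℝ} (hV : Measurable (Function.uncurry V)) :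
    Kernel (Configuration d) (Configuration d) :=
  ⟨fun γ => resample Δ (V γ) (count Δ γ) γ,
    (measurable_resample hΔ hV).comp (measurable_id.prodMk (measurable_count hΔ hb))⟩

instance {Δ : Set (Space d)} (hΔ : MeasurableSet Δ) (hb : IsBounded Δ)
    {V : Configuration d → Configuration d → ℝ} (hV : Measurable (Function.uncurry V)) :
    IsFiniteKernel (resampleKernel hΔ hb hV) :=
  ⟨⟨1, ENNReal.one_lt_top, fun _ => prob_le_one (μ := resample _ _ _ _)⟩⟩

lemma resampleKernel_apply {Δ : Set (Space d)} (hΔ : MeasurableSet Δ) (hb : IsBounded Δ)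
    {V : Configuration d → Configuration d → ℝ} (hV : Measurable (Function.uncurry V))
    (γ : Configuration d) : resampleKernel hΔ hb hV γ = resample Δ (V γ) (count Δ γ) γ := rfl

/-! ### Potentials of the points in a window -/

/-- The potential `-β (H(η_Δ) + M_Δ^{(p)}(η, γ))` of the points of `η` in `Δ`, which interact with
those of `γ` in `Λ_p ∖ Δ` only. It depends on `γ` through a bounded region, so that its resampling
kernel passes to the limit in the local topology. -/
def truncatedPotential (s β : ℝ) (Δ : Set (Space d)) (p : ℕ) (γ η : Configuration d) : ℝ :=
  -β * (energy s (η.restrict Δ) + truncatedMove s Δ p η γ)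

/-- The potential `-β (H(η_Δ) + M_Δ(η, γ))` of the points of `η` in `Δ`, which interact with all
points of `γ` outside `Δ`. It agrees with the exponent of `weight` when `η` is contained in `Δ`,
and the restriction to `Δ` makes it measurable in `η`. -/
def limitPotential (s β : ℝ) (Δ : Set (Space d)) (γ η : Configuration d) : ℝ :=
  -β * (energy s (η.restrict Δ) + move s Δ η γ)

lemma measurable_energy_restrict {Δ : Set (Space d)} (hΔ : MeasurableSet Δ) (hb : IsBounded Δ)
    (s : ℝ) : Measurable fun η : Configuration d => energy s (η.restrict Δ) :=
  measurable_pairEnergy_restrict (measurable_riesz s) hΔ hb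

lemma energy_nonneg (s : ℝ) (η : Configuration d) : 0 ≤ energy s η :=
  mul_nonneg (by norm_num) (finsum_nonneg fun _ => finsum_nonneg fun _ => riesz_nonneg s _)

lemma measurable_truncatedMove [NeZero d] {Δ : Set (Space d)} (hΔ : MeasurableSet Δ)
    (hb : IsBounded Δ) (s : ℝ) (p : ℕ) :
    Measurable fun q : Configuration d × Configuration d => truncatedMove s Δ p q.2 q.1 := by
  have hφ : Measurable fun q : Space d × Space d => riesz s (q.1 - q.2) - riesz s q.2 :=
    ((measurable_riesz s).comp (measurable_fst.sub measurable_snd)).sub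
      ((measurable_riesz s).comp measurable_snd)
  exact (measurable_finsum_mem_finsum_mem hφ hΔ hb ((measurableSet_box d p).diff hΔ)
    ((isBounded_box d p).subset Set.sdiff_subset)).comp measurable_swap

lemma measurable_truncatedPotential [NeZero d] {Δ : Set (Space d)} (hΔ : MeasurableSet Δ)
    (hb : IsBounded Δ) (s β : ℝ) (p : ℕ) :
    Measurable (Function.uncurry (truncatedPotential s β Δ p)) :=
  (((measurable_energy_restrict hΔ hb s).comp measurable_snd).add
    (measurable_truncatedMove hΔ hb s p)).const_mul _

lemma measurable_limitPotential [NeZero d] {Δ : Set (Space d)} (hΔ : MeasurableSet Δ)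
    (hb : IsBounded Δ) (s β : ℝ) : Measurable (Function.uncurry (limitPotential s β Δ)) := by
  have hmove : StronglyMeasurable fun q : Configuration d × Configuration d =>
      limUnder atTop fun p : ℕ => truncatedMove s Δ p q.2 q.1 :=
    StronglyMeasurable.limUnder fun p => (measurable_truncatedMove hΔ hb s p).stronglyMeasurable
  exact (((measurable_energy_restrict hΔ hb s).comp measurable_snd).add
    hmove.measurable).const_mul _

lemma measurable_comp_glue {Δ : Set (Space d)} (hΔ : MeasurableSet Δ) {W : Configuration d → ℝ}
    (hW : Measurable W) : Measurable (Function.uncurry fun γ η => W (glue Δ η γ)) :=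
  hW.comp ((measurable_glue hΔ).comp measurable_swap)

section Exponential

variable {Ω : Type*} [MeasurableSpace Ω] {ν : Measure Ω} {V V₁ V₂ : Ω → ℝ}

lemma integrable_exp_of_le [IsFiniteMeasure ν] (hV : Measurable V) {C : ℝ}
    (h : ∀ᵐ ω ∂ν, V ω ≤ C) : Integrable (fun ω => Real.exp (V ω)) ν := by
  refine Integrable.of_bound hV.exp.aestronglyMeasurable (Real.exp C) ?_
  filter_upwards [h] with ω hω
  rwa [Real.norm_of_nonneg (Real.exp_pos _).le, Real.exp_le_exp]

lemma integrable_exp_of_abs_sub_le (hV₁ : Measurable V₁)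
    (hV₂ : Integrable (fun ω => Real.exp (V₂ ω)) ν) {c δ : ℝ}
    (h : ∀ᵐ ω ∂ν, |V₁ ω - V₂ ω - c| ≤ δ) : Integrable (fun ω => Real.exp (V₁ ω)) ν := by
  refine (hV₂.const_mul (Real.exp (c + δ))).mono' hV₁.exp.aestronglyMeasurable ?_
  filter_upwards [h] with ω hω
  rw [Real.norm_of_nonneg (Real.exp_pos _).le, ← Real.exp_add]
  exact Real.exp_le_exp.2 (by linarith [(abs_le.1 hω).2])

end Exponential

lemma abs_resample_sub_le {Δ : Set (Space d)} (hΔ : MeasurableSet Δ) {V₁ V₂ : Configuration d → ℝ}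
    {N : ℕ} {b c θ : ℝ} (hV₁ : Measurable V₁)
    (hV₂ : Integrable (fun η => Real.exp (V₂ η)) (binomialProcess Δ N)) (hb : 0 ≤ b) (hθ : 0 < θ)
    (h : ∀ᵐ η ∂(binomialProcess Δ N), |V₁ η - V₂ η - c| ≤ N * b) (γ : Configuration d)
    {E : Set (Configuration d)} (hE : MeasurableSet E) :
    |(resample Δ V₁ N γ).real E - (resample Δ V₂ N γ).real E| ≤ θ * N + 2 * b / θ := by
  rw [resample_real_apply hΔ _ _ _ hE, resample_real_apply hΔ _ _ _ hE]
  exact abs_real_tilted_sub_le (integrable_exp_of_abs_sub_le hV₁ hV₂ h) hV₂ N.cast_nonneg hb hθ h _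

section Potentials

variable [NeZero d] {s β D : ℝ} {Δ : Set (Space d)}

lemma integrable_exp_truncatedPotential (hΔ : MeasurableSet Δ) (hb : IsBounded Δ) (s : ℝ)
    (hβ : 0 ≤ β) (p : ℕ) (γ : Configuration d) (N : ℕ) :
    Integrable (fun η => Real.exp (truncatedPotential s β Δ p γ η)) (binomialProcess Δ N) := by
  refine integrable_exp_of_le (measurable_truncatedPotential hΔ hb s β p).of_uncurry_left
    (C := β * (N * ∑ᶠ y ∈ γ.carrier ∩ (box d p \ Δ), riesz s y)) ?_
  filter_upwards [ae_binomialProcess_count hΔ hΔ hb le_rfl N] with η hη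
  have hmove := neg_count_mul_finsum_riesz_le_truncatedMove s hb p η γ
  rw [hη] at hmove
  rw [truncatedPotential, neg_mul, ← mul_neg]
  exact mul_le_mul_of_nonneg_left (by linarith [energy_nonneg s (η.restrict Δ)]) hβ

variable (hβ : 0 ≤ β) (hΔ : MeasurableSet Δ) (hD : Δ ⊆ Metric.closedBall 0 D)
include hβ hΔ hD

lemma ae_abs_limitPotential_sub_le (hs : 0 ≤ s) {p : ℕ} (hp : 2 * D + 1 ≤ side d p / 2)
    {γ : Configuration d} (hT : tail s p γ ≠ ⊤) (N : ℕ) :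
    ∀ᵐ η ∂(binomialProcess Δ N),
      |limitPotential s β Δ γ η - truncatedPotential s β Δ p γ η - 0|
        ≤ N * (β * (moveConst s D * (tail s p γ).toReal)) := by
  have hb : IsBounded Δ := Metric.isBounded_closedBall.subset hD
  filter_upwards [ae_binomialProcess_count hΔ hΔ hb le_rfl N] with η hη
  have hmove := abs_move_sub_truncatedMove_le hs hD hp hT η
  rw [hη] at hmove
  rw [limitPotential, truncatedPotential, sub_zero, ← mul_sub, add_sub_add_left_eq_sub, abs_mul,
    abs_neg, abs_of_nonneg hβ, mul_left_comm]
  exact mul_le_mul_of_nonneg_left hmove hβ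

lemma integrable_exp_limitPotential (hs : 0 ≤ s) {p : ℕ} {γ : Configuration d}
    (hp : 2 * D + 1 ≤ side d p / 2) (hT : tail s p γ ≠ ⊤) (N : ℕ) :
    Integrable (fun η => Real.exp (limitPotential s β Δ γ η)) (binomialProcess Δ N) :=
  have hb : IsBounded Δ := Metric.isBounded_closedBall.subset hD
  integrable_exp_of_abs_sub_le (measurable_limitPotential hΔ hb s β).of_uncurry_left
    (integrable_exp_truncatedPotential hΔ hb s hβ p γ N)
    (ae_abs_limitPotential_sub_le hβ hΔ hD hs hp hT N)

theorem abs_resample_limit_sub_resample_truncated_le (hs : 0 ≤ s) (hD0 : 0 ≤ D) {p : ℕ}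
    (hp : 2 * D + 1 ≤ side d p / 2) {γ : Configuration d} (hT : tail s p γ ≠ ⊤)
    {E : Set (Configuration d)} (hE : MeasurableSet E) {θ : ℝ} (hθ : 0 < θ) (N : ℕ) :
    |(resample Δ (limitPotential s β Δ γ) N γ).real E
      - (resample Δ (truncatedPotential s β Δ p γ) N γ).real E|
      ≤ θ * N + 2 * (β * (moveConst s D * (tail s p γ).toReal)) / θ := by
  have hb : IsBounded Δ := Metric.isBounded_closedBall.subset hD
  have hC := moveConst_nonneg hs hD0
  exact abs_resample_sub_le hΔ (measurable_limitPotential hΔ hb s β).of_uncurry_left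
    (integrable_exp_truncatedPotential hΔ hb s hβ p γ N) (by positivity) hθ
    (ae_abs_limitPotential_sub_le hβ hΔ hD hs hp hT N) γ hE

theorem exists_abs_resample_torus_sub_resample_truncated_le (hsd : (d : ℝ) < s + 1)
    (hD0 : 0 ≤ D) :
    ∃ K : ℝ, 0 ≤ K ∧ ∀ n p : ℕ, 1 ≤ n → p ≤ n → 2 * D + 1 ≤ side d p / 2 →
      ∀ γ : Configuration d, γ.carrier ⊆ box d n → count (box d n) γ = n → tail s p γ ≠ ⊤ →
      ∀ E : Set (Configuration d), MeasurableSet E → ∀ θ : ℝ, 0 < θ →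
      |(resample Δ (fun η => torusPotential s β n (glue Δ η γ)) (count Δ γ) γ).real E
        - (resample Δ (truncatedPotential s β Δ p γ) (count Δ γ) γ).real E|
      ≤ θ * count Δ γ + 2 * (β * (moveConst s D * (tail s p γ).toReal
        + K * (n * side d n ^ (-(s + 1))))) / θ := by
  have hb : IsBounded Δ := Metric.isBounded_closedBall.subset hD
  obtain ⟨K, hK0, hK⟩ := exists_abs_periodicEnergy_glue_sub_truncatedMove_le hsd hD0 hD
  refine ⟨K, hK0, fun n p hn hpn hp γ hγ hγn hT E hE θ hθ => ?_⟩
  obtain ⟨c, hc⟩ := hK n p hn hpn hp γ hγ hγn hT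
  have hΔn : Δ ⊆ box d n := hD.trans (closedBall_subset_box (by linarith [side_mono d hpn]))
  have hclose : ∀ᵐ η ∂(binomialProcess Δ (count Δ γ)),
      |torusPotential s β n (glue Δ η γ) - truncatedPotential s β Δ p γ η - (-β * c)|
        ≤ count Δ γ * (β * (moveConst s D * (tail s p γ).toReal
          + K * (n * side d n ^ (-(s + 1))))) := by
    filter_upwards [ae_binomialProcess_subset hΔ _, ae_binomialProcess_count hΔ hΔ hb le_rfl _]
      with η hη hηN
    have hglue : (glue Δ η γ).carrier ⊆ box d n :=
      Set.union_subset (Set.inter_subset_right.trans hΔn) (Set.inter_subset_left.trans hγ)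
    rw [torusPotential, truncatedPotential, restrict_of_subset hglue, restrict_of_subset hη,
      ← mul_sub, ← mul_sub, abs_mul, abs_neg, abs_of_nonneg hβ, mul_left_comm]
    exact mul_le_mul_of_nonneg_left (hc η hη hηN) hβ
  have hside := side_nonneg d n
  have hC := moveConst_nonneg (pos_of_lt_add_one hsd).le hD0
  exact abs_resample_sub_le hΔ ((measurable_torusPotential s β n).comp (measurable_glue_left hΔ γ))
    (integrable_exp_truncatedPotential hΔ hb s hβ p γ _) (by positivity) hθ hclose γ hE

end Potentials

/-! ### Canonical DLR equations on the torus -/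

section Tilted

variable {Ω : Type*} [MeasurableSpace Ω] {ν : Measure Ω} {V : Ω → ℝ}

lemma lintegral_exp_mul_tilted_apply (hV : Integrable (fun ω => Real.exp (V ω)) ν)
    {S : Set Ω} (hS : MeasurableSet S) :
    (∫⁻ ω, ENNReal.ofReal (Real.exp (V ω)) ∂ν) * ν.tilted V S
      = ∫⁻ ω in S, ENNReal.ofReal (Real.exp (V ω)) ∂ν := by
  rcases eq_or_ne ν 0 with rfl | hν
  · simp
  have : NeZero ν := ⟨hν⟩
  have hZ := integral_exp_pos hV
  rw [← ofReal_integral_eq_lintegral_ofReal hV (ae_of_all _ fun ω => (Real.exp_pos _).le),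
    tilted_apply' _ _ hS, ← lintegral_const_mul' _ _ ENNReal.ofReal_ne_top]
  simp only [← ENNReal.ofReal_mul hZ.le, mul_div_cancel₀ _ hZ.ne']

end Tilted

section Resample

variable {Δ : Set (Space d)} (hΔ : MeasurableSet Δ) (hb : IsBounded Δ) {W : Configuration d → ℝ}
  (hW : Measurable W)

lemma resampleKernel_glue {η γ : Configuration d} (h : count Δ η = count Δ γ) :
    resampleKernel hΔ hb (measurable_comp_glue hΔ hW) (glue Δ η γ)
      = resampleKernel hΔ hb (measurable_comp_glue hΔ hW) γ := by
  simp only [resampleKernel_apply, resample, glue_glue, count_glue_self hb, h]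

/-- Up to normalisation, the left-hand side is the average of the kernel with respect to the law
obtained by resampling the points of `γ` in `Δ`, on which it is constant. -/
lemma lintegral_exp_mul_resampleKernel_glue [NeZero d] {γ : Configuration d}
    (hint : Integrable (fun η => Real.exp (W (glue Δ η γ))) (binomialProcess Δ (count Δ γ)))
    {E : Set (Configuration d)} (hE : MeasurableSet E) :
    ∫⁻ η, ENNReal.ofReal (Real.exp (W (glue Δ η γ)))
        * resampleKernel hΔ hb (measurable_comp_glue hΔ hW) (glue Δ η γ) E
        ∂(binomialProcess Δ (count Δ γ))
      = ∫⁻ η, ENNReal.ofReal (Real.exp (W (glue Δ η γ))) * E.indicator 1 (glue Δ η γ)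
        ∂(binomialProcess Δ (count Δ γ)) := by
  set κ := resampleKernel hΔ hb (measurable_comp_glue hΔ hW)
  have hglue := measurable_glue_left hΔ γ
  calc _ = ∫⁻ η, ENNReal.ofReal (Real.exp (W (glue Δ η γ))) * κ γ E
        ∂(binomialProcess Δ (count Δ γ)) := by
        refine lintegral_congr_ae ?_
        filter_upwards [ae_binomialProcess_count hΔ hΔ hb le_rfl _] with η hη
        rw [resampleKernel_glue hΔ hb hW hη]
    _ = ∫⁻ η in (glue Δ · γ) ⁻¹' E, ENNReal.ofReal (Real.exp (W (glue Δ η γ)))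
        ∂(binomialProcess Δ (count Δ γ)) := by
        rw [lintegral_mul_const _ (hW.fun_comp hglue).exp.ennreal_ofReal, resampleKernel_apply,
          resample_apply hΔ _ _ _ hE]
        exact lintegral_exp_mul_tilted_apply hint (hglue hE)
    _ = _ := by
        rw [← lintegral_indicator (hglue hE)]
        refine lintegral_congr fun η => ?_
        by_cases hη : glue Δ η γ ∈ E <;> simp [hη]

theorem invariant_tilted_binomialProcess [NeZero d] {Λ : Set (Space d)} (hsub : Δ ⊆ Λ)
    (hΛ : MeasurableSet Λ) (hΛb : IsBounded Λ) (hΛ0 : volume Λ ≠ 0) {n : ℕ}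
    (hint : Integrable (fun γ => Real.exp (W γ)) (binomialProcess Λ n)) :
    Kernel.Invariant (resampleKernel hΔ hb (measurable_comp_glue hΔ hW))
      ((binomialProcess Λ n).tilted W) := by
  refine Measure.ext fun E hE => ?_
  set κ := resampleKernel hΔ hb (measurable_comp_glue hΔ hW)
  have hκ : Measurable fun γ => κ γ E := κ.measurable_coe hE
  have hind : Measurable (E.indicator (1 : Configuration d → ENNReal)) :=
    measurable_one.indicator hE
  have hw : Measurable fun γ => ENNReal.ofReal (Real.exp (W γ)) := hW.exp.ennreal_ofReal
  have hresample {G : Configuration d → ENNReal} (hG : Measurable G) :=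
    lintegral_resample hΔ hsub hΛ hΛb hΛ0 n hG
  have hfinite : ∀ᵐ γ ∂(binomialProcess Λ n), ∫⁻ η, ENNReal.ofReal (Real.exp (W (glue Δ η γ)))
      ∂(binomialProcess Δ (count Δ γ)) < ⊤ := by
    refine ae_lt_top (measurable_lintegral_binomialProcess hΔ hb
      (hw.comp ((measurable_glue hΔ).comp measurable_swap))) ?_
    rw [hresample hw]
    exact hint.lintegral_lt_top.ne
  rw [Measure.bind_apply hE κ.aemeasurable, ← lintegral_indicator_one hE,
    lintegral_tilted_eq_mul hW hκ, lintegral_tilted_eq_mul hW hind,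
    ← hresample (hw.fun_mul hκ), ← hresample (hw.fun_mul hind)]
  congr 1
  refine lintegral_congr_ae ?_
  filter_upwards [hfinite] with γ hγ
  refine lintegral_exp_mul_resampleKernel_glue hΔ hb hW
    ⟨(hW.comp (measurable_glue_left hΔ γ)).exp.aestronglyMeasurable, ?_⟩ hE
  rwa [hasFiniteIntegral_iff_ofReal (ae_of_all _ fun η => (Real.exp_pos _).le)]

end Resample

theorem invariant_torusGibbs [NeZero d] {s β : ℝ} (hsd : (d : ℝ) < s + 1) (hβ : 0 ≤ β) {n : ℕ}
    (hn : 1 ≤ n) {Δ : Set (Space d)} (hΔ : MeasurableSet Δ) (hb : IsBounded Δ)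
    (hsub : Δ ⊆ box d n) :
    Kernel.Invariant
      (resampleKernel hΔ hb (measurable_comp_glue hΔ (measurable_torusPotential s β n)))
      (torusGibbs d s β n) := by
  rw [torusGibbs_eq_tilted]
  exact invariant_tilted_binomialProcess hΔ hb (measurable_torusPotential s β n) hsub
    (measurableSet_box d n) (isBounded_box d n) (volume_box_ne_zero hn)
    (integrable_exp_torusPotential hsd hβ hn)

/-! ### Infinite volume -/

lemma measureReal_bind {Ω : Type*} [MeasurableSpace Ω] (μ : Measure Ω) (κ : Kernel Ω Ω)
    [IsFiniteKernel κ] {E : Set Ω} (hE : MeasurableSet E) :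
    (μ.bind κ).real E = ∫ ω, (κ ω).real E ∂μ := by
  rw [measureReal_def, Measure.bind_apply hE κ.aemeasurable]
  exact (integral_toReal (κ.measurable_coe hE).aemeasurable
    (ae_of_all _ fun _ => measure_lt_top _ _)).symm

lemma real_eq_integral_of_invariant {Ω : Type*} [MeasurableSpace Ω] {μ : Measure Ω}
    {κ : Kernel Ω Ω} [IsFiniteKernel κ] (h : κ.Invariant μ) {E : Set Ω} (hE : MeasurableSet E) :
    μ.real E = ∫ ω, (κ ω).real E ∂μ := by
  rw [← measureReal_bind μ κ hE, h.def]

lemma tendsto_of_forall_abs_sub_le {ι : Type*} {l : Filter ι} {q m : ι → ℝ} {x v K : ℝ}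
    (hm : Tendsto m l (𝓝 0)) (h : ∀ θ > 0, ∀ᶠ p in l, |x - q p| ≤ θ * v + K / θ * m p) :
    Tendsto q l (𝓝 x) := by
  refine Metric.tendsto_nhds.2 fun ε hε => ?_
  have hsmall : Tendsto (fun θ : ℝ => θ * v) (𝓝[>] 0) (𝓝 0) := by
    have hcont := (continuous_id.mul_const v).tendsto (0 : ℝ)
    rw [id, zero_mul] at hcont
    exact hcont.mono_left nhdsWithin_le_nhds
  obtain ⟨θ, hθv, hθ⟩ := ((hsmall.eventually_lt_const hε).and self_mem_nhdsWithin).exists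
  have hbound : Tendsto (fun p => θ * v + K / θ * m p) l (𝓝 (θ * v)) := by
    simpa using (hm.const_mul (K / θ)).const_add (θ * v)
  filter_upwards [h θ hθ, hbound.eventually_lt_const hθv] with p hp hpε
  rw [dist_comm]
  exact hp.trans_lt hpε

lemma exists_subset_closedBall {E : Type*} [SeminormedAddGroup E] {A : Set E}
    (hb : IsBounded A) : ∃ D : ℝ, 0 ≤ D ∧ A ⊆ Metric.closedBall 0 D := by
  obtain ⟨D, hD⟩ := hb.subset_closedBall 0
  exact ⟨max D 0, le_max_right _ _,
    hD.trans (Metric.closedBall_subset_closedBall (le_max_left _ _))⟩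

lemma tendsto_natCast_mul_side_rpow [NeZero d] {s : ℝ} (hsd : (d : ℝ) < s + 1) :
    Tendsto (fun n : ℕ => (n : ℝ) * side d n ^ (-(s + 1))) atTop (𝓝 0) := by
  have hpow := (tendsto_rpow_neg_atTop (sub_pos.2 hsd)).comp (tendsto_side d)
  refine hpow.congr' ?_
  filter_upwards [eventually_ge_atTop 1] with n hn
  rw [Function.comp_apply, ← side_pow d n, ← Real.rpow_natCast, ← Real.rpow_add (side_pos d hn)]
  ring_nf

lemma abs_integral_sub_integral_le {Q : Measure (Configuration d)} [IsProbabilityMeasure Q]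
    (hQ : intensity Q ≤ volume) {s : ℝ} (hsd : (d : ℝ) < s + 1) {Δ : Set (Space d)}
    (hΔ : MeasurableSet Δ) (hb : IsBounded Δ) {f g : Configuration d → ℝ} (hf : Integrable f Q)
    (hg : Integrable g Q) {θ K c : ℝ} (hθ : 0 ≤ θ) (hK : 0 ≤ K) {p : ℕ}
    (h : ∀ᵐ γ ∂Q, |f γ - g γ| ≤ θ * count Δ γ + K * (tail s p γ).toReal + c) :
    |∫ γ, f γ ∂Q - ∫ γ, g γ ∂Q| ≤ θ * volume.real Δ + K * (meanTail d s p).toReal + c := by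
  have hcount := (integrable_count hQ hΔ hb).const_mul θ
  have htail := (integrable_tail hQ hsd p).const_mul K
  have hsum := hcount.fun_add htail
  calc |∫ γ, f γ ∂Q - ∫ γ, g γ ∂Q| ≤ ∫ γ, |f γ - g γ| ∂Q := by
        rw [← integral_sub hf hg]
        exact abs_integral_le_integral_abs
    _ ≤ ∫ γ, (θ * count Δ γ + K * (tail s p γ).toReal + c) ∂Q :=
        integral_mono_ae (hf.sub hg).abs (hsum.add (integrable_const c)) h
    _ = θ * ∫ γ, (count Δ γ : ℝ) ∂Q + K * ∫ γ, (tail s p γ).toReal ∂Q + c := by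
        rw [integral_add hsum (integrable_const c), integral_add hcount htail,
          integral_const_mul, integral_const_mul, integral_const, probReal_univ, one_smul]
    _ ≤ θ * volume.real Δ + K * (meanTail d s p).toReal + c := by
        gcongr
        · exact integral_count_le hQ hΔ hb
        · exact integral_tail_le hQ hsd p

section Kernels

variable [NeZero d] {Δ : Set (Space d)} (hΔ : MeasurableSet Δ) (hb : IsBounded Δ) (s β : ℝ)

/-- The canonical DLR kernel in `Δ`: the points of `γ` in `Δ` are resampled in the field of all
points of `γ` outside `Δ`. -/
def dlrKernel : Kernel (Configuration d) (Configuration d) :=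
  resampleKernel hΔ hb (measurable_limitPotential hΔ hb s β)

/-- The local approximation of `dlrKernel` obtained by ignoring the points of `γ` outside `Λ_p`. -/
def truncatedKernel (p : ℕ) : Kernel (Configuration d) (Configuration d) :=
  resampleKernel hΔ hb (measurable_truncatedPotential hΔ hb s β p)

instance : IsFiniteKernel (dlrKernel hΔ hb s β) :=
  inferInstanceAs (IsFiniteKernel (resampleKernel _ _ _))

instance (p : ℕ) : IsFiniteKernel (truncatedKernel hΔ hb s β p) :=
  inferInstanceAs (IsFiniteKernel (resampleKernel _ _ _))

end Kernels

section Locality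

variable {Δ A B : Set (Space d)}

lemma truncatedPotential_restrict (s β : ℝ) {p : ℕ} (hB : box d p ⊆ B) (γ η : Configuration d) :
    truncatedPotential s β Δ p (γ.restrict B) η = truncatedPotential s β Δ p γ η := by
  have hinter : (γ.restrict B).carrier ∩ (box d p \ Δ) = γ.carrier ∩ (box d p \ Δ) := by
    rw [restrict, Set.inter_assoc, Set.inter_eq_right.2 (Set.sdiff_subset.trans hB)]
  rw [truncatedPotential, truncatedPotential, truncatedMove, truncatedMove, hinter]

lemma glue_restrict_mem_iff {E : Set (Configuration d)} (hE : MeasurableSet[sigmaOf d A] E)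
    (hB : A ⊆ B) (η γ : Configuration d) : glue Δ η (γ.restrict B) ∈ E ↔ glue Δ η γ ∈ E := by
  have hrestrict : (glue Δ η (γ.restrict B)).restrict A = (glue Δ η γ).restrict A := by
    ext x
    simp only [glue, Configuration.union, restrict, Set.mem_inter_iff, Set.mem_union]
    have := @hB x
    tauto
  rw [← restrict_mem_iff hE, hrestrict, restrict_mem_iff hE]

lemma isLocalTame_indicator (hA : MeasurableSet A) (hb : IsBounded A) {E : Set (Configuration d)}
    (hE : MeasurableSet[sigmaOf d A] E) : IsLocalTame (E.indicator (1 : Configuration d → ℝ)) := by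
  refine isLocalTame_of_bounded hA hb (Measurable.indicator (m := sigmaOf d A) measurable_const hE)
    (b := 1) fun γ => ?_
  simpa using norm_indicator_le_norm_self (s := E) (1 : Configuration d → ℝ) γ

variable [NeZero d] (hΔ : MeasurableSet Δ) (hb : IsBounded Δ) (s β : ℝ)
include hΔ hb

lemma truncatedKernel_restrict_real_apply {p : ℕ} {E : Set (Configuration d)}
    (hE : MeasurableSet[sigmaOf d A] E) (hB : Δ ∪ (A ∪ box d p) ⊆ B) (γ : Configuration d) :
    (truncatedKernel hΔ hb s β p (γ.restrict B)).real E
      = (truncatedKernel hΔ hb s β p γ).real E := by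
  obtain ⟨hΔB, hAB, hpB⟩ := by simpa only [Set.union_subset_iff] using hB
  have hcount : count Δ (γ.restrict B) = count Δ γ := by
    rw [count_restrict, Set.inter_eq_right.2 hΔB]
  have hpotential : truncatedPotential s β Δ p (γ.restrict B) = truncatedPotential s β Δ p γ :=
    funext fun η => truncatedPotential_restrict s β hpB γ η
  have hevent : (glue Δ · (γ.restrict B)) ⁻¹' E = (glue Δ · γ) ⁻¹' E :=
    Set.ext fun η => glue_restrict_mem_iff hE hAB η γ
  have hE' := sigmaOf_le A E hE
  rw [truncatedKernel, resampleKernel_apply, resampleKernel_apply, resample_real_apply hΔ _ _ _ hE',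
    resample_real_apply hΔ _ _ _ hE', hcount, hpotential, hevent]

lemma isLocalTame_truncatedKernel_real (hA : MeasurableSet A) (hAb : IsBounded A) (p : ℕ)
    {E : Set (Configuration d)} (hE : MeasurableSet[sigmaOf d A] E) :
    IsLocalTame fun γ => (truncatedKernel hΔ hb s β p γ).real E := by
  have hwindow : MeasurableSet (Δ ∪ (A ∪ box d p)) := hΔ.union (hA.union (measurableSet_box d p))
  have hmeas : Measurable[sigmaOf d (Δ ∪ (A ∪ box d p))] fun γ =>
      (truncatedKernel hΔ hb s β p γ).real E := by
    rw [← funext (truncatedKernel_restrict_real_apply hΔ hb s β hE le_rfl)]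
    exact ((Kernel.measurable_coe _ (sigmaOf_le A E hE)).ennreal_toReal).comp
      (measurable_restrict_sigmaOf hwindow)
  refine isLocalTame_of_bounded hwindow (hb.union (hAb.union (isBounded_box d p))) hmeas (b := 1)
    fun γ => ?_
  rw [abs_of_nonneg measureReal_nonneg]
  exact measureReal_le_one (μ := resample _ _ _ _)

end Locality

lemma ae_torusGibbs_subset_and_count [NeZero d] (s β : ℝ) (n : ℕ) :
    ∀ᵐ γ ∂(torusGibbs d s β n), γ.carrier ⊆ box d n ∧ count (box d n) γ = n := by
  have hbox := measurableSet_box d n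
  rw [torusGibbs_eq_tilted]
  exact (tilted_absolutelyContinuous _ _).ae_le ((ae_binomialProcess_subset hbox n).and
    (ae_binomialProcess_count hbox hbox (isBounded_box d n) le_rfl n))

section Comparison

variable [NeZero d] {s β D : ℝ} {Δ : Set (Space d)} (hsd : (d : ℝ) < s + 1) (hβ : 0 ≤ β)
  (hΔ : MeasurableSet Δ) (hD0 : 0 ≤ D) (hD : Δ ⊆ Metric.closedBall 0 D)
include hsd hβ hD0 hD

lemma exists_abs_torusGibbs_real_sub_integral_truncatedKernel_le (hb : IsBounded Δ) :
    ∃ K : ℝ, ∀ n p : ℕ, 1 ≤ n → p ≤ n → 2 * D + 1 ≤ side d p / 2 →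
      ∀ E : Set (Configuration d), MeasurableSet E → ∀ θ : ℝ, 0 < θ →
      |(torusGibbs d s β n).real E
        - ∫ γ, (truncatedKernel hΔ hb s β p γ).real E ∂(torusGibbs d s β n)|
      ≤ θ * volume.real Δ + 2 * β * moveConst s D / θ * (meanTail d s p).toReal
        + K / θ * (n * side d n ^ (-(s + 1))) := by
  obtain ⟨K, -, hK⟩ := exists_abs_resample_torus_sub_resample_truncated_le hβ hΔ hD hsd hD0
  refine ⟨2 * β * K, fun n p hn hpn hp E hE θ hθ => ?_⟩
  have hΔn : Δ ⊆ box d n := hD.trans (closedBall_subset_box (by linarith [side_mono d hpn]))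
  have := isProbabilityMeasure_torusGibbs (d := d) hsd hβ hn
  have hintensity : intensity (torusGibbs d s β n) ≤ volume :=
    (intensity_torusGibbs hsd hβ hn).trans_le Measure.restrict_le_self
  have hC := moveConst_nonneg (pos_of_lt_add_one hsd).le hD0
  rw [real_eq_integral_of_invariant (invariant_torusGibbs hsd hβ hn hΔ hb hΔn) hE]
  refine abs_integral_sub_integral_le hintensity hsd hΔ hb
    (Kernel.IsFiniteKernel.integrable _ _ hE) (Kernel.IsFiniteKernel.integrable _ _ hE) hθ.le
    (by positivity) ?_
  filter_upwards [ae_torusGibbs_subset_and_count s β n, ae_tail_ne_top hintensity hsd p]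
    with γ ⟨hγ, hγn⟩ hT
  refine (hK n p hn hpn hp γ hγ hγn hT E hE θ hθ).trans_eq ?_
  ring

lemma abs_integral_dlrKernel_sub_integral_truncatedKernel_le {Q : Measure (Configuration d)}
    [IsProbabilityMeasure Q] (hQ : intensity Q ≤ volume) (hb : IsBounded Δ) {p : ℕ}
    (hp : 2 * D + 1 ≤ side d p / 2) {E : Set (Configuration d)} (hE : MeasurableSet E) {θ : ℝ}
    (hθ : 0 < θ) :
    |∫ γ, (dlrKernel hΔ hb s β γ).real E ∂Q - ∫ γ, (truncatedKernel hΔ hb s β p γ).real E ∂Q|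
      ≤ θ * volume.real Δ + 2 * β * moveConst s D / θ * (meanTail d s p).toReal := by
  have hs := (pos_of_lt_add_one hsd).le
  have hC := moveConst_nonneg hs hD0
  rw [← add_zero (_ + _)]
  refine abs_integral_sub_integral_le hQ hsd hΔ hb
    (Kernel.IsFiniteKernel.integrable _ _ hE) (Kernel.IsFiniteKernel.integrable _ _ hE) hθ.le
    (by positivity) ?_
  filter_upwards [ae_tail_ne_top hQ hsd p] with γ hT
  refine (abs_resample_limit_sub_resample_truncated_le hβ hΔ hD hs hD0 hp hT hE hθ _).trans_eq ?_
  ring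

end Comparison

section Gas

variable [NeZero d] {s β : ℝ} {P : Measure (Configuration d)} (hsd : (d : ℝ) < s + 1) (hβ : 0 ≤ β)
  (hP : IsCircularRieszGas s β P) {Δ : Set (Space d)} (hΔ : MeasurableSet Δ)
include hsd hβ hP

lemma abs_real_sub_integral_truncatedKernel_le {D : ℝ} (hD0 : 0 ≤ D)
    (hD : Δ ⊆ Metric.closedBall 0 D) (hb : IsBounded Δ) {p : ℕ} (hp : 2 * D + 1 ≤ side d p / 2)
    {A : Set (Space d)} (hA : MeasurableSet A) (hAb : IsBounded A) {E : Set (Configuration d)}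
    (hE : MeasurableSet[sigmaOf d A] E) {θ : ℝ} (hθ : 0 < θ) :
    |P.real E - ∫ γ, (truncatedKernel hΔ hb s β p γ).real E ∂P|
      ≤ θ * volume.real Δ + 2 * β * moveConst s D / θ * (meanTail d s p).toReal := by
  obtain ⟨U, hU, hlim⟩ := exists_ultrafilter_tendsto hP
  obtain ⟨K, hK⟩ := exists_abs_torusGibbs_real_sub_integral_truncatedKernel_le hsd hβ hΔ hD0 hD hb
  have hE' := sigmaOf_le A E hE
  have hevent : Tendsto (fun n => (torusGibbs d s β n).real E) U (𝓝 (P.real E)) := by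
    simpa only [integral_indicator_one hE'] using hlim _ (isLocalTame_indicator hA hAb hE)
  have hkernel := hlim _ (isLocalTame_truncatedKernel_real hΔ hb s β hA hAb p hE)
  have herror := (((tendsto_natCast_mul_side_rpow hsd).mono_left hU).const_mul (K / θ)).const_add
    (θ * volume.real Δ + 2 * β * moveConst s D / θ * (meanTail d s p).toReal)
  rw [mul_zero, add_zero] at herror
  refine le_of_tendsto_of_tendsto (hevent.sub hkernel).abs herror ?_
  filter_upwards [hU (eventually_ge_atTop (max 1 p))] with n hn
  exact hK n p (le_of_max_le_left hn) (le_of_max_le_right hn) hp E hE' θ hθ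

lemma real_eq_integral_dlrKernel_of_local (hb : IsBounded Δ) {A : Set (Space d)}
    (hA : MeasurableSet A) (hAb : IsBounded A) {E : Set (Configuration d)}
    (hE : MeasurableSet[sigmaOf d A] E) :
    P.real E = ∫ γ, (dlrKernel hΔ hb s β γ).real E ∂P := by
  have := hP.1
  obtain ⟨D, hD0, hD⟩ := exists_subset_closedBall hb
  have hlarge : ∀ᶠ p in atTop, 2 * D + 1 ≤ side d p / 2 :=
    ((tendsto_side d).eventually_ge_atTop (2 * (2 * D + 1))).mono fun p hp => by linarith
  have htail : Tendsto (fun p => (meanTail d s p).toReal) atTop (𝓝 0) := by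
    simpa only [Function.comp_def, ENNReal.toReal_zero] using
      (ENNReal.tendsto_toReal ENNReal.zero_ne_top).comp (tendsto_meanTail (d := d) hsd)
  have hevent : Tendsto (fun p => ∫ γ, (truncatedKernel hΔ hb s β p γ).real E ∂P) atTop
      (𝓝 (P.real E)) :=
    tendsto_of_forall_abs_sub_le htail fun θ hθ => hlarge.mono fun p hp =>
      abs_real_sub_integral_truncatedKernel_le hsd hβ hP hΔ hD0 hD hb hp hA hAb hE hθ
  have hdlr : Tendsto (fun p => ∫ γ, (truncatedKernel hΔ hb s β p γ).real E ∂P) atTop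
      (𝓝 (∫ γ, (dlrKernel hΔ hb s β γ).real E ∂P)) :=
    tendsto_of_forall_abs_sub_le htail fun θ hθ => hlarge.mono fun p hp =>
      abs_integral_dlrKernel_sub_integral_truncatedKernel_le hsd hβ hΔ hD0 hD
        (intensity_le_volume_of_isCircularRieszGas hsd hβ hP) hb hp (sigmaOf_le A E hE) hθ
  exact tendsto_nhds_unique hevent hdlr

end Gas

lemma ext_of_local {μ ν : Measure (Configuration d)} [IsFiniteMeasure μ]
    (h : ∀ A, MeasurableSet A → IsBounded A → ∀ E, MeasurableSet[sigmaOf d A] E → μ E = ν E) :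
    μ = ν := by
  let ball (m : ℕ) : Set (Space d) := Metric.closedBall 0 m
  have hball : Monotone ball := fun m m' hm =>
    Metric.closedBall_subset_closedBall (Nat.cast_le.2 hm)
  have hlocal (m : ℕ) := h (ball m) measurableSet_closedBall Metric.isBounded_closedBall
  refine ext_of_generate_finite (⋃ m, {E | MeasurableSet[sigmaOf d (ball m)] E}) ?_
    (isPiSystem_iUnion_of_monotone _ (fun m => (sigmaOf d (ball m)).isPiSystem_measurableSet)
      fun m m' hm => sigmaOf_mono (hball hm)) ?_ (hlocal 0 _ MeasurableSet.univ)
  · refine Eq.trans ?_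
      (MeasurableSpace.generateFrom_iUnion_measurableSet fun m => sigmaOf d (ball m)).symm
    refine le_antisymm (iSup_le fun A => ?_) (iSup_le fun m => sigmaOf_le _)
    obtain ⟨r, hr⟩ := A.2.2.1.subset_closedBall 0
    obtain ⟨m, hm⟩ := exists_nat_ge r
    exact le_iSup_of_le m (measurable_count_sigmaOf A.2.1 A.2.2.1
      (hr.trans (Metric.closedBall_subset_closedBall hm))).comap_le
  · rintro E hE
    obtain ⟨m, hm⟩ := Set.mem_iUnion.1 hE
    exact hlocal m E hm

theorem invariant_dlrKernel [NeZero d] {s β : ℝ} (hsd : (d : ℝ) < s + 1) (hβ : 0 ≤ β)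
    {P : Measure (Configuration d)} (hP : IsCircularRieszGas s β P) {Δ : Set (Space d)}
    (hΔ : MeasurableSet Δ) (hb : IsBounded Δ) : (dlrKernel hΔ hb s β).Invariant P := by
  have := hP.1
  refine (ext_of_local fun A hA hAb E hE => ?_).symm
  rw [← measureReal_eq_measureReal_iff, measureReal_bind _ _ (sigmaOf_le A E hE)]
  exact real_eq_integral_dlrKernel_of_local hsd hβ hP hΔ hb hA hAb hE

/-! ### The canonical DLR equations -/

section Invariant

variable {Ω : Type*} [MeasurableSpace Ω] {μ : Measure Ω} {κ : Kernel Ω Ω} {f : Ω → ℝ}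

lemma integrable_integral_of_invariant (h : κ.Invariant μ) (hf : Integrable f μ) :
    Integrable (fun ω => ∫ ω', f ω' ∂(κ ω)) μ := by
  rw [← h.def, Measure.comp_eq_comp_const_apply] at hf
  exact hf.integral_comp

lemma integral_integral_of_invariant (h : κ.Invariant μ) (hf : Integrable f μ) :
    ∫ ω, ∫ ω', f ω' ∂(κ ω) ∂μ = ∫ ω, f ω ∂μ := by
  conv_rhs => rw [← h.def]
  rw [← h.def] at hf
  rw [Measure.comp_eq_comp_const_apply] at hf ⊢
  exact (Kernel.integral_comp hf).symm

end Invariant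

lemma weight_ae_eq {Δ : Set (Space d)} (hΔ : MeasurableSet Δ) (s β : ℝ) (γ : Configuration d)
    (N : ℕ) :
    weight s β Δ γ =ᵐ[binomialProcess Δ N] fun η => Real.exp (limitPotential s β Δ γ η) := by
  filter_upwards [ae_binomialProcess_subset hΔ N] with η hη
  rw [weight, limitPotential, restrict_of_subset hη]

lemma localPartition_eq {Δ : Set (Space d)} (hΔ : MeasurableSet Δ) (s β : ℝ)
    (γ : Configuration d) : localPartition s β Δ γ
      = ∫ η, Real.exp (limitPotential s β Δ γ η) ∂(binomialProcess Δ (count Δ γ)) :=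
  integral_congr_ae (weight_ae_eq hΔ s β γ _)

lemma dlrAverage_eq_integral_resample {Δ : Set (Space d)} (hΔ : MeasurableSet Δ) (s β : ℝ)
    {f : Configuration d → ℝ} (hf : Measurable f) (γ : Configuration d) :
    dlrAverage s β Δ f γ
      = ∫ γ', f γ' ∂(resample Δ (limitPotential s β Δ γ) (count Δ γ) γ) := by
  rw [dlrAverage, integral_resample hΔ _ _ _ hf, ← localPartition_eq hΔ]
  refine integral_congr_ae ?_
  filter_upwards [ae_binomialProcess_subset hΔ _, weight_ae_eq hΔ s β γ _] with η hη hw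
  rw [hw, glue_of_subset hη]
  ring

lemma limitPotential_restrict_compl (s β : ℝ) (Δ : Set (Space d)) (γ : Configuration d) :
    limitPotential s β Δ (γ.restrict Δᶜ) = limitPotential s β Δ γ := by
  have hinter (p : ℕ) : (γ.restrict Δᶜ).carrier ∩ (box d p \ Δ) = γ.carrier ∩ (box d p \ Δ) := by
    rw [restrict, Set.inter_assoc,
      Set.inter_eq_right.2 (Set.sdiff_subset_compl _ _)]
  funext η
  simp only [limitPotential, move, truncatedMove, hinter]

section Exterior

variable {Δ : Set (Space d)} (hΔ : MeasurableSet Δ)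
include hΔ

lemma exteriorSigma_le (hb : IsBounded Δ) :
    exteriorSigma Δ ≤ instMeasurableSpaceConfiguration d :=
  sup_le (measurable_count hΔ hb).comap_le (sigmaOf_le _)

lemma exteriorSigma_eq_comap :
    exteriorSigma Δ = MeasurableSpace.comap
      (fun γ : Configuration d => (γ.restrict Δᶜ, count Δ γ)) inferInstance := by
  refine le_antisymm ?_ (measurable_iff_comap_le.1 (Measurable.prodMk
    ((measurable_restrict_sigmaOf hΔ.compl).mono le_sup_right le_rfl)
    ((comap_measurable (count Δ)).mono le_sup_left le_rfl)))
  have hpair := comap_measurable (m := inferInstance)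
    fun γ : Configuration d => (γ.restrict Δᶜ, count Δ γ)
  refine sup_le (measurable_snd.comp hpair).comap_le (iSup_le fun ⟨A, hA, hAb, hAΔ⟩ => ?_)
  have hcount := ((measurable_count hA hAb).comp measurable_fst).comp hpair
  simp only [Function.comp_def, count_restrict, Set.inter_eq_right.2 hAΔ] at hcount
  exact hcount.comap_le

lemma glue_mem_iff_of_exteriorSigma (hb : IsBounded Δ) {S : Set (Configuration d)}
    (hS : MeasurableSet[exteriorSigma Δ] S) {η γ : Configuration d}
    (hcount : count Δ η = count Δ γ) : glue Δ η γ ∈ S ↔ γ ∈ S := by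
  rw [exteriorSigma_eq_comap hΔ] at hS
  obtain ⟨T, -, rfl⟩ := hS
  simp only [Set.mem_preimage, glue_restrict_compl, count_glue_self hb, hcount]

lemma measurable_exteriorSigma_dlrAverage [NeZero d] (hb : IsBounded Δ) (s β : ℝ)
    {f : Configuration d → ℝ} (hf : Measurable f) :
    Measurable[exteriorSigma Δ] (dlrAverage s β Δ f) := by
  have hkernel := measurable_resample hΔ (measurable_limitPotential hΔ hb s β)
  have hintegral : Measurable fun q : Configuration d × ℕ =>
      ∫ γ', f γ' ∂(resample Δ (limitPotential s β Δ q.1) q.2 q.1) :=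
    (hf.stronglyMeasurable.integral_kernel (κ := ⟨_, hkernel⟩)).measurable
  have hpair : Measurable[exteriorSigma Δ] fun γ : Configuration d =>
      (γ.restrict Δᶜ, count Δ γ) := by
    rw [exteriorSigma_eq_comap hΔ]
    exact comap_measurable _
  have hcomp : dlrAverage s β Δ f = (fun q : Configuration d × ℕ =>
      ∫ γ', f γ' ∂(resample Δ (limitPotential s β Δ q.1) q.2 q.1))
        ∘ fun γ => (γ.restrict Δᶜ, count Δ γ) := by
    funext γ
    simp only [Function.comp_apply, dlrAverage_eq_integral_resample hΔ s β hf, resample,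
      limitPotential_restrict_compl, glue_restrict_compl_right]
  rw [hcomp]
  exact hintegral.comp hpair

lemma dlrAverage_indicator [NeZero d] (hb : IsBounded Δ) (s β : ℝ) (f : Configuration d → ℝ)
    {S : Set (Configuration d)} (hS : MeasurableSet[exteriorSigma Δ] S) (γ : Configuration d) :
    dlrAverage s β Δ (S.indicator f) γ = S.indicator (dlrAverage s β Δ f) γ := by
  have hmem : ∀ᵐ η ∂(binomialProcess Δ (count Δ γ)),
      η.union (γ.restrict Δᶜ) ∈ S ↔ γ ∈ S := by
    filter_upwards [ae_binomialProcess_subset hΔ _, ae_binomialProcess_count hΔ hΔ hb le_rfl _]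
      with η hη hcount
    rw [← glue_of_subset hη, glue_mem_iff_of_exteriorSigma hΔ hb hS hcount]
  by_cases hγ : γ ∈ S
  · rw [Set.indicator_of_mem hγ]
    refine integral_congr_ae ?_
    filter_upwards [hmem] with η hη
    rw [Set.indicator_of_mem (hη.2 hγ)]
  · rw [Set.indicator_of_notMem hγ]
    refine integral_eq_zero_of_ae ?_
    filter_upwards [hmem] with η hη
    rw [Set.indicator_of_notMem (mt hη.1 hγ), mul_zero, zero_mul, Pi.zero_apply]

end Exterior

lemma ae_integrable_exp_limitPotential [NeZero d] {s β : ℝ} (hsd : (d : ℝ) < s + 1) (hβ : 0 ≤ β)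
    {Q : Measure (Configuration d)} (hQ : intensity Q ≤ volume) {Δ : Set (Space d)}
    (hΔ : MeasurableSet Δ) (hb : IsBounded Δ) :
    ∀ᵐ γ ∂Q, ∀ N, Integrable (fun η => Real.exp (limitPotential s β Δ γ η))
      (binomialProcess Δ N) := by
  obtain ⟨D, -, hD⟩ := exists_subset_closedBall hb
  obtain ⟨p, hp⟩ := ((tendsto_side d).eventually_ge_atTop (2 * (2 * D + 1))).exists
  filter_upwards [ae_tail_ne_top hQ hsd p] with γ hT
  exact integrable_exp_limitPotential hβ hΔ hD (pos_of_lt_add_one hsd).le (by linarith) hT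

lemma ae_binomialProcess_count_ne_zero {Q : Measure (Configuration d)}
    (hQ : intensity Q ≤ volume) {Δ : Set (Space d)} (hΔ : MeasurableSet Δ) (hb : IsBounded Δ) :
    ∀ᵐ γ ∂Q, binomialProcess Δ (count Δ γ) ≠ 0 := by
  filter_upwards [ae_count_eq_zero hQ hΔ hb] with γ hγ
  by_cases hΔ0 : volume Δ = 0
  · rw [hγ hΔ0, binomialProcess_zero]
    exact NeZero.ne _
  · have := isProbabilityMeasure_binomialProcess hΔ0 hb (count Δ γ)
    exact IsProbabilityMeasure.ne_zero _

section CanonicalDLR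

variable [NeZero d] {s β : ℝ} {P : Measure (Configuration d)} {Δ : Set (Space d)}
  (hsd : (d : ℝ) < s + 1) (hβ : 0 ≤ β) (hP : IsCircularRieszGas s β P) (hΔ : MeasurableSet Δ)
  (hb : IsBounded Δ) {f : Configuration d → ℝ} (hf : Measurable f) (hfP : Integrable f P)
include hsd hβ hP hΔ hb hf hfP

theorem integrable_dlrAverage : Integrable (dlrAverage s β Δ f) P := by
  rw [funext (dlrAverage_eq_integral_resample hΔ s β hf)]
  exact integrable_integral_of_invariant (invariant_dlrKernel hsd hβ hP hΔ hb) hfP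

theorem integral_dlrAverage : ∫ γ, dlrAverage s β Δ f γ ∂P = ∫ γ, f γ ∂P := by
  rw [funext (dlrAverage_eq_integral_resample hΔ s β hf)]
  exact integral_integral_of_invariant (invariant_dlrKernel hsd hβ hP hΔ hb) hfP

theorem condExp_exteriorSigma_ae_eq :
    condExp (exteriorSigma Δ) P f =ᵐ[P] dlrAverage s β Δ f := by
  have := hP.1
  have hle := exteriorSigma_le hΔ hb
  refine (ae_eq_condExp_of_forall_setIntegral_eq hle hfP
    (fun _ _ _ => (integrable_dlrAverage hsd hβ hP hΔ hb hf hfP).integrableOn) (fun S hS _ => ?_)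
    (measurable_exteriorSigma_dlrAverage hΔ hb s β hf).stronglyMeasurable.aestronglyMeasurable).symm
  have hS' := hle S hS
  calc ∫ γ in S, dlrAverage s β Δ f γ ∂P = ∫ γ, dlrAverage s β Δ (S.indicator f) γ ∂P := by
        rw [← integral_indicator hS', funext (dlrAverage_indicator hΔ hb s β f hS)]
    _ = ∫ γ in S, f γ ∂P := by
        rw [integral_dlrAverage hsd hβ hP hΔ hb (hf.indicator hS') (hfP.indicator hS'),
          integral_indicator hS']

end CanonicalDLR

end RieszGas

end

theorem mainTheorem2 (d : ℕ) (hd : 1 ≤ d) (s : ℝ) (hs : (d : ℝ) - 1 < s) (hsd : s < (d : ℝ))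
    (β : ℝ) (hβ : 0 < β)
    (P : MeasureTheory.Measure (RieszGas.Configuration d))
    (hP : RieszGas.IsCircularRieszGas s β P)
    (Δ : Set (RieszGas.Space d)) (hΔ : MeasurableSet Δ) (hΔb : Bornology.IsBounded Δ) :
    -- almost surely, `0 ∉ γ` and the limit defining the move cost exists for every `η`
    (∀ᵐ γ ∂P, (0 : RieszGas.Space d) ∉ γ.carrier ∧
      ∀ η : RieszGas.Configuration d,
        Filter.Tendsto (fun p : ℕ => RieszGas.truncatedMove s Δ p η γ) Filter.atTop
          (nhds (RieszGas.move s Δ η γ))) ∧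
    -- almost surely, the normalisation constant is finite and positive
    (∀ᵐ γ ∂P,
      MeasureTheory.Integrable (RieszGas.weight s β Δ γ)
        (RieszGas.binomialProcess Δ (RieszGas.Configuration.count Δ γ)) ∧
      0 < RieszGas.localPartition s β Δ γ) ∧
    -- the canonical DLR equations, and their formulation as conditional expectations
    (∀ f : RieszGas.Configuration d → ℝ, Measurable f → (∃ C : ℝ, ∀ γ, |f γ| ≤ C) →
      MeasureTheory.Integrable (RieszGas.dlrAverage s β Δ f) P ∧
      ∫ γ, f γ ∂P = ∫ γ, RieszGas.dlrAverage s β Δ f γ ∂P ∧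
      MeasureTheory.condExp (RieszGas.exteriorSigma Δ) P f
        =ᵐ[P] RieszGas.dlrAverage s β Δ f) := by
  have : NeZero d := ⟨by omega⟩
  have hd' : (1 : ℝ) ≤ d := by exact_mod_cast hd
  have hs0 : 0 ≤ s := by linarith
  have hsd1 : (d : ℝ) < s + 1 := by linarith
  have hintensity := RieszGas.intensity_le_volume_of_isCircularRieszGas hsd1 hβ.le hP
  refine ⟨?_, ?_, fun f hf ⟨C, hC⟩ => ?_⟩
  · obtain ⟨D, -, hD⟩ := RieszGas.exists_subset_closedBall hΔb
    filter_upwards [RieszGas.ae_zero_notMem hintensity,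
      RieszGas.ae_tail_ne_top hintensity hsd1 0] with γ hzero htail
    exact ⟨hzero, RieszGas.tendsto_truncatedMove hs0 hD htail⟩
  · filter_upwards [RieszGas.ae_integrable_exp_limitPotential hsd1 hβ.le hintensity hΔ hΔb,
      RieszGas.ae_binomialProcess_count_ne_zero hintensity hΔ hΔb] with γ hexp hne
    have : NeZero (RieszGas.binomialProcess Δ (RieszGas.Configuration.count Δ γ)) := ⟨hne⟩
    rw [RieszGas.localPartition_eq hΔ]
    exact ⟨(hexp _).congr (RieszGas.weight_ae_eq hΔ s β γ _).symm, integral_exp_pos (hexp _)⟩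
  · have := hP.1
    have hfP := Integrable.of_bound (μ := P) hf.aestronglyMeasurable C (ae_of_all _ hC)
    exact ⟨RieszGas.integrable_dlrAverage hsd1 hβ.le hP hΔ hΔb hf hfP,
      (RieszGas.integral_dlrAverage hsd1 hβ.le hP hΔ hΔb hf hfP).symm,
      RieszGas.condExp_exteriorSigma_ae_eq hsd1 hβ.le hP hΔ hΔb hf hfP⟩
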